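/- **Setting.** Let $H^1$ denote the Sobolev space of $2\pi$-periodic functions $\mathbb R\to\mathbb R^3$ (identified with their continuous representatives), and for ${\bf X}\in H^1$ put $$\mathcal L({\bf X})=\frac12\int_0^{2\pi}\bigl\{|{\bf X}'(s)|^2-|{\bf X}(s)|^2\bigr\}\,ds .$$ For real $a,b$ let $\cos_{ab}$ be the $2\pi$-periodic function equal to $a\cos s$ on $[-\pi/2,\pi/2]$ and to $b\cos s$ on $[\pi/2,3\pi/2]$. The functions $\cos_{ab}(s)\,{\bf v}$ with ${\bf v}\in\mathbb R^3$ are called collapsed orbits, and the functions $\cos(s)\,{\bf v}_1+\sin(s)\,{\bf v}_2$ with ${\bf v}_1,{\bf v}_2\in\mathbb R^3$ elliptical orbits. Let $\alpha>0$, $0\le\beta\le\alpha$ and ${\bf X}_0(s)=(\cos_{\alpha\beta}(s),0,0)$. Let $M\subset\mathbb R\setminus\{0\}$ be a set with $0\in\overline M$ (for example $M=\mathbb R\setminus\{0\}$ or $M=(0,\infty)$); all $o(\cdot)$ are meant as $\mu\to0$ in $M$. For $\mu\in M$ let ${\bf X}(\mu,\cdot)\in H^1$ be nonzero almost everywhere,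 with $${\bf X}(\mu,s)={\bf X}_0(s)+\mu{\bf x}_1(s)+\mu^2{\bf x}_2(s)+o(\mu^2)\quad\text{in }H^1,\qquad {\bf x}_1,{\bf x}_2\in H^1 .$$ **Proposition 3.2.** Suppose that the first component of $$\int_0^{2\pi}\frac{{\bf X}(\mu,s)}{|{\bf X}(\mu,s)|}\,ds$$ is $o(\mu^2)$ and that its second and third components are $o(\mu)$. Then there are real numbers $\mathcal L_1,\mathcal L_2$ with $$\mathcal L({\bf X}(\mu,\cdot))=\mathcal L({\bf X}_0)+\mu\mathcal L_1+\mu^2\mathcal L_2+o(\mu^2),$$ and for any such numbers, if $\mathcal L_1=0$, then $\mathcal L_2\ge0$. If moreover the perturbation is transversal, then $\mathcal L_2>0$. Here *transversal* means that ${\bf x}_1$ is not in the linear span of the velocities at ${\bf X}_0$ of differentiable curves through ${\bf X}_0$ of collapsed orbits (with $a,b\in\mathbb R$ and ${\bf v}$ depending differentiably on the curve parameter) and of elliptical orbits (with ${\bf v}_1,{\bf v}_2$ depending differentiably on it; such curves through ${\bf X}_0$ exist only if $\alpha=\beta$). -/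

import Mathlib

open Set Filter Topology MeasureTheory Asymptotics

noncomputable section

namespace OrbitVariation

/-- Euclidean three-space. -/
abbrev E3 := EuclideanSpace ℝ (Fin 3)

/-- `X` is a (continuous representative of a) `2π`-periodic function of Sobolev class `H¹`
with values in `ℝ³`: it is the integral of its almost everywhere defined derivative, and this
derivative is square integrable over a period. -/
structure MemH1 (X : ℝ → E3) : Prop where
  periodic : Function.Periodic X (2 * Real.pi)
  deriv_memLp : MemLp (deriv X) 2 (volume.restrict (Ioc 0 (2 * Real.pi)))
  sub_eq_integral : ∀ a b : ℝ, X b - X a = ∫ s in a..b, deriv X s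

/-- The `H¹`-norm over a period. -/
def h1Norm (X : ℝ → E3) : ℝ :=
  Real.sqrt (∫ s in (0 : ℝ)..(2 * Real.pi), (‖X s‖ ^ 2 + ‖deriv X s‖ ^ 2))

/-- The functional `𝓛(X) = ½ ∫ (|X'|² - |X|²) ds`. -/
def lagrangeFunctional (X : ℝ → E3) : ℝ :=
  1 / 2 * ∫ s in (0 : ℝ)..(2 * Real.pi), (‖deriv X s‖ ^ 2 - ‖X s‖ ^ 2)

/-- The vector `∫ X / |X| ds`, which vanishes exactly when the curve with unit tangent `X / |X|`
is closed. -/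
def closingIntegral (X : ℝ → E3) : E3 :=
  ∫ s in (0 : ℝ)..(2 * Real.pi), ‖X s‖⁻¹ • X s

/-- The `2π`-periodic function that equals `a cos s` on `[-π/2, π/2]` and `b cos s` on
`[π/2, 3π/2]`. -/
def cosTwo (a b s : ℝ) : ℝ :=
  if 0 ≤ Real.cos s then a * Real.cos s else b * Real.cos s

/-- The collapsed orbit with parameters `a`, `b`, running along the line spanned by `v`. -/
def collapsedOrbit (a b : ℝ) (v : E3) (s : ℝ) : E3 :=
  cosTwo a b s • v

/-- The elliptical orbit `cos(s) v₁ + sin(s) v₂`. -/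
def ellipticalOrbit (v₁ v₂ : E3) (s : ℝ) : E3 :=
  Real.cos s • v₁ + Real.sin s • v₂

/-- The collapsed orbit `(cos_{αβ}(s), 0, 0)`. -/
def baseOrbit (α β : ℝ) : ℝ → E3 :=
  collapsedOrbit α β (EuclideanSpace.single 0 1)

/-- `u` is the velocity at `X₀` of a differentiable curve of collapsed orbits through `X₀`.
The scalar parameters are not restricted in sign, so that at `b = 0` one gets the whole linear
tangent space rather than a one-sided cone. -/
def IsCollapsedVelocity (X₀ u : ℝ → E3) : Prop :=
  ∃ (a b : ℝ → ℝ) (v : ℝ → E3),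
    DifferentiableAt ℝ a 0 ∧ DifferentiableAt ℝ b 0 ∧ DifferentiableAt ℝ v 0 ∧
    collapsedOrbit (a 0) (b 0) (v 0) = X₀ ∧
    ∀ s, HasDerivAt (fun t => collapsedOrbit (a t) (b t) (v t) s) (u s) 0

/-- `u` is the velocity at `X₀` of a differentiable curve of elliptical orbits through `X₀`.
There is such a curve only if `X₀` itself has the form `cos(s) v₁ + sin(s) v₂`. -/
def IsEllipticalVelocity (X₀ u : ℝ → E3) : Prop :=
  ∃ v₁ v₂ : ℝ → E3,
    DifferentiableAt ℝ v₁ 0 ∧ DifferentiableAt ℝ v₂ 0 ∧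
    ellipticalOrbit (v₁ 0) (v₂ 0) = X₀ ∧
    ∀ s, HasDerivAt (fun t => ellipticalOrbit (v₁ t) (v₂ t) s) (u s) 0

/-- The directions at `X₀` tangential to the known families of orbits (collapsed orbits and, where
`X₀` belongs to it, the family `cos(s) v₁ + sin(s) v₂`). -/
def tangentialDirections (X₀ : ℝ → E3) : Submodule ℝ (ℝ → E3) :=
  Submodule.span ℝ {u | IsCollapsedVelocity X₀ u ∨ IsEllipticalVelocity X₀ u}

/-- `𝓛(X(μ)) = 𝓛(X₀) + μ L₁ + μ² L₂ + o(μ²)` as `μ → 0` in `M`. -/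
def HasSecondOrderExpansion (M : Set ℝ) (X₀ : ℝ → E3) (X : ℝ → ℝ → E3) (L₁ L₂ : ℝ) : Prop :=
  (fun μ : ℝ => lagrangeFunctional (X μ) -
      (lagrangeFunctional X₀ + μ * L₁ + μ ^ 2 * L₂)) =o[𝓝[M] 0] (fun μ : ℝ => μ ^ 2)

end OrbitVariation

end

open OrbitVariation

/-!
Write `L₁`, `L₂` for the coefficients of the expansion. Since the functional is quadratic, they are
explicit (`hasSecondOrderExpansion`), and an integration by parts on the two arcs on which the base
orbit is a multiple of the cosine (`bilinearForm_baseOrbit`) gives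
`L₁ = -(α - β) P` and `L₂ = -(α - β) S + 𝓛(x₁)`, where `P` and `S` are the sums of the first
components of `x₁` and of `x₂` at the kinks `±π/2`. It remains to bound `S` from above and `𝓛(x₁)`
from below.

*What the closing condition says.* Let `e` be the direction of the base orbit. Its component along
`e` compares the deficits `1 - cos θ` of the perturbed front and back arcs, `θ` being the angle to
`±e`. A half arc `t ↦ γ sin t • e`, perturbed by `μ z₁ + μ² z₂`, leaves the direction `e` by angles
of order one only where the perturbation is not small compared with `t`. The mass of the deficit at
order `μ` lies in a boundary layer of width `μ` and equals `(‖z₁(0)‖ - ⟨e, z₁(0)⟩) / γ`; if `z₁(0) =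
0`, then the mass at order `μ²` is that of a layer of width `μ²`, given by `z₂(0)`, plus the
interior contribution `∫ |z₁^⊥|² / (2 γ² sin²)`. These are
`HalfExpansion.tendsto_integral_deficit_div` and `HalfExpansion.tendsto_integral_deficit_div_sq`,
consequences of a dominated convergence theorem on two scales (`tendsto_integral_two_scale`). The
components transversal to `e` diverge like `log (1 / μ)` unless the transversal parts of `x₁` at the
two kinks are opposite (`PerturbedOrbits.transversal_ends`); if so, their limits relate the
integrals of `x₁ / sin` over the two arcs (`PerturbedOrbits.sinMean_back_eq`,
`PerturbedOrbits.sinMean_add_eq_zero_of_eq`).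

*The spectral gap.* For `u ∈ H¹₀(0, π)` the integral `∫ u'² - u²` is at least a quarter of the
variance `∫ (u / sin)² - (∫ u / sin)² / π` (`variance_div_sin_le`, from Hardy's inequality), and the
variance vanishes only for multiples of the sine (`eq_mul_sin_of_variance_le`).

*The three cases,* under the assumption `L₁ = 0`.
* `α = β`: the values of `x₁` at the kinks are `±w`, so that `x₁ - sin • w` vanishes there. This
  subtraction does not change the energy, and the gap gives `L₂ = 𝓛(x₁) ≥ 0`.
* `0 < β < α`: now `P = 0`, and the condition at order `μ` forces `x₁ = 0` at the kinks. The
  condition at order `μ²` expresses `S` by integrals of `|x₁^⊥|² / sin²`. Splitting these into means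
  and variances, the means cancel by the transversal conditions; the only negative term left is a
  multiple of the front variances by a constant smaller than the one provided by the gap.
* `β = 0`: on the back arc, `x₁` must point in direction `-e` to balance the front arc; as `P = 0`,
  it vanishes at the kinks; as the deficit of the back arc is `O(μ²)`, the boundary layer forces `S ≤ 0`.

If `L₂ = 0`, all variances vanish, so `x₁` consists of multiples of the cosine on the two arcs (up to
the term `sin • w` if `α = β`). Together with the relation of the means this says that `x₁` is a
velocity of collapsed orbits plus, for `α = β`, one of elliptical orbits
(`mem_tangentialDirections`).

The argument uses only a sequence of parameters of one sign; negative parameters are reduced to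
positive ones by reversing the sign of `x₁` (`PerturbedOrbits.of_isLittleO`).
-/

namespace OrbitVariation

/-! ### Functions with square integrable derivative -/

section Density

variable {E : Type*} [NormedAddCommGroup E] [NormedSpace ℝ E]

/-- `u` is a primitive of the locally square integrable function `g`. In contrast to `MemH1`, the
density `g` is any representative of the weak derivative, and `u` need not be periodic. -/
structure HasL2Density (u g : ℝ → E) : Prop where
  meas : StronglyMeasurable g
  sq : ∀ a b : ℝ, IntervalIntegrable (fun s => ‖g s‖ ^ 2) volume a b
  sub_eq : ∀ a b : ℝ, u b - u a = ∫ s in a..b, g s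

namespace HasL2Density

variable {u v g h : ℝ → E}

theorem intervalIntegrable (H : HasL2Density u g) (a b : ℝ) :
    IntervalIntegrable g volume a b := by
  refine IntervalIntegrable.mono_fun
    ((intervalIntegrable_const (c := (1 : ℝ))).add (H.sq a b)) H.meas.aestronglyMeasurable
    (Eventually.of_forall fun s => ?_)
  simp only [Real.norm_eq_abs]
  rw [abs_of_nonneg (by positivity)]
  nlinarith [sq_nonneg (‖g s‖ - 1)]

theorem locallyIntegrable (H : HasL2Density u g) : LocallyIntegrable g volume := by
  intro x
  refine ⟨Icc (x - 1) (x + 1), Icc_mem_nhds (by linarith) (by linarith), ?_⟩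
  rw [integrableOn_Icc_iff_integrableOn_Ioc,
    ← intervalIntegrable_iff_integrableOn_Ioc_of_le (by linarith)]
  exact H.intervalIntegrable _ _

theorem eq_add_integral (H : HasL2Density u g) (a s : ℝ) : u s = u a + ∫ r in a..s, g r := by
  rw [← H.sub_eq a s]; abel

theorem add (H : HasL2Density u g) (K : HasL2Density v h) :
    HasL2Density (fun s => u s + v s) (fun s => g s + h s) where
  meas := H.meas.add K.meas
  sq a b := by
    refine IntervalIntegrable.mono_fun (((H.sq a b).const_mul 2).add ((K.sq a b).const_mul 2))
      ((H.meas.add K.meas).norm.pow 2).aestronglyMeasurable (Eventually.of_forall fun s => ?_)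
    simp only [Real.norm_eq_abs]
    rw [abs_of_nonneg (by positivity), abs_of_nonneg (by positivity)]
    have := norm_add_le (g s) (h s)
    nlinarith [sq_nonneg (‖g s‖ - ‖h s‖), norm_nonneg (g s + h s)]
  sub_eq a b := by
    rw [intervalIntegral.integral_add (H.intervalIntegrable a b) (K.intervalIntegrable a b),
      ← H.sub_eq, ← K.sub_eq]; abel

theorem const_smul (H : HasL2Density u g) (c : ℝ) :
    HasL2Density (fun s => c • u s) (fun s => c • g s) where
  meas := H.meas.const_smul c
  sq a b := by
    simp only [norm_smul, mul_pow]
    exact (H.sq a b).const_mul _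
  sub_eq a b := by
    rw [intervalIntegral.integral_smul, ← H.sub_eq, smul_sub]

theorem sub (H : HasL2Density u g) (K : HasL2Density v h) :
    HasL2Density (fun s => u s - v s) (fun s => g s - h s) := by
  simpa [sub_eq_add_neg] using H.add (K.const_smul (-1))

theorem comp_affine (H : HasL2Density u g) (c : ℝ) {η : ℝ} (hη : η ≠ 0) :
    HasL2Density (fun t => u (c + η * t)) (fun t => η • g (c + η * t)) where
  meas := (H.meas.comp_measurable (by fun_prop : Measurable fun t : ℝ => c + η * t)).const_smul η
  sq a b := by
    simp only [norm_smul, mul_pow]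
    refine IntervalIntegrable.const_mul ?_ _
    have h1 := (H.sq (c + η * a) (c + η * b)).comp_add_left c
    have h2 := h1.comp_mul_left (c := η)
    simpa [hη] using h2
  sub_eq a b := by
    rw [intervalIntegral.integral_smul, intervalIntegral.smul_integral_comp_add_mul, H.sub_eq]

/-- Cauchy–Schwarz: primitives of square integrable functions are Hölder continuous with exponent
`1/2`. -/
theorem norm_sub_sq_le (H : HasL2Density u g) {a b : ℝ} (hab : a ≤ b) :
    ‖u b - u a‖ ^ 2 ≤ (b - a) * ∫ s in a..b, ‖g s‖ ^ 2 := by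
  rcases hab.eq_or_lt with rfl | hlt
  · simp
  set I := ∫ s in a..b, ‖g s‖ with hI
  have h1 : ‖u b - u a‖ ≤ I := by
    rw [H.sub_eq a b]; exact intervalIntegral.norm_integral_le_integral_norm hab
  have hd : 0 < b - a := sub_pos.2 hlt
  set c := I / (b - a) with hc
  have h2 : 0 ≤ ∫ s in a..b, (‖g s‖ - c) ^ 2 :=
    intervalIntegral.integral_nonneg hab fun s _ => sq_nonneg _
  have h3 : ∫ s in a..b, (‖g s‖ - c) ^ 2 = (∫ s in a..b, ‖g s‖ ^ 2) - 2 * c * I + (b - a) * c ^ 2 := by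
    have : ∀ s, (‖g s‖ - c) ^ 2 = ‖g s‖ ^ 2 - 2 * c * ‖g s‖ + c ^ 2 := fun s => by ring
    simp only [this]
    have i1 := H.sq a b
    have i2 := ((H.intervalIntegrable a b).norm).const_mul (2 * c)
    rw [intervalIntegral.integral_add (i1.sub i2) intervalIntegrable_const,
      intervalIntegral.integral_sub i1 i2, intervalIntegral.integral_const_mul,
      intervalIntegral.integral_const, smul_eq_mul]
  have h4 : I = c * (b - a) := by rw [hc]; field_simp
  have h5 : ‖u b - u a‖ ^ 2 ≤ I ^ 2 := by gcongr
  rw [h3] at h2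
  nlinarith

theorem ae_hasDerivAt [CompleteSpace E] (H : HasL2Density u g) : ∀ᵐ s : ℝ, HasDerivAt u (g s) s := by
  filter_upwards [LocallyIntegrable.ae_hasDerivAt_integral H.locallyIntegrable] with s hs
  have : u = fun x => u 0 + ∫ t in (0 : ℝ)..x, g t := funext fun x => H.eq_add_integral 0 x
  rw [this]
  exact (hs 0).const_add _

theorem deriv_ae [CompleteSpace E] (H : HasL2Density u g) : deriv u =ᵐ[volume] g := by
  filter_upwards [H.ae_hasDerivAt] with s hs using hs.deriv

theorem continuous (H : HasL2Density u g) : Continuous u := by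
  have : u = fun x => u 0 + ∫ t in (0 : ℝ)..x, g t := funext fun x => H.eq_add_integral 0 x
  rw [this]
  exact continuous_const.add (intervalIntegral.continuous_primitive H.intervalIntegrable 0)

theorem clm_comp [CompleteSpace E] {F : Type*} [NormedAddCommGroup F] [NormedSpace ℝ F] [CompleteSpace F]
    (H : HasL2Density u g) (L : E →L[ℝ] F) :
    HasL2Density (fun s => L (u s)) (fun s => L (g s)) where
  meas := L.continuous.comp_stronglyMeasurable H.meas
  sq a b := by
    refine IntervalIntegrable.mono_fun ((H.sq a b).const_mul (‖L‖ ^ 2))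
      ((L.continuous.comp_stronglyMeasurable H.meas).norm.pow 2).aestronglyMeasurable
      (Eventually.of_forall fun s => ?_)
    simp only [norm_mul, norm_pow, norm_norm]
    rw [← mul_pow]
    gcongr
    exact L.le_opNorm _
  sub_eq a b := by
    rw [← map_sub, H.sub_eq, L.intervalIntegral_comp_comm (H.intervalIntegrable a b)]

theorem absolutelyContinuous {u g : ℝ → ℝ} (H : HasL2Density u g) (a b : ℝ) :
    AbsolutelyContinuousOnInterval u a b := by
  have h1 := (H.intervalIntegrable a b).absolutelyContinuousOnInterval_intervalIntegral
    (c := a) left_mem_uIcc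
  have h2 : AbsolutelyContinuousOnInterval (fun _ : ℝ => u a) a b :=
    (LipschitzWith.const (u a)).lipschitzOnWith.absolutelyContinuousOnInterval
  have := h2.add h1
  convert! this using 1
  exact funext fun x => H.eq_add_integral a x

/-- The increment `u (a + t) - u a` is `o(√t)` as `t` decreases to zero, and not just `O(√t)` as by Hölder
continuity, since the integral of `‖g‖²` over `[a, a + t]` tends to zero. -/
theorem tendsto_norm_sq_div (H : HasL2Density u g) (a : ℝ) :
    Tendsto (fun t => ‖u (a + t) - u a‖ ^ 2 / t) (𝓝[>] 0) (𝓝 0) := by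
  have h1 : Continuous fun t => ∫ s in a..(a + t), ‖g s‖ ^ 2 :=
    (intervalIntegral.continuous_primitive H.sq a).comp (continuous_const.add continuous_id)
  have h2 : Tendsto (fun t => ∫ s in a..(a + t), ‖g s‖ ^ 2) (𝓝[>] 0) (𝓝 0) := by
    have := h1.tendsto 0
    simp only [add_zero, intervalIntegral.integral_same] at this
    exact this.mono_left nhdsWithin_le_nhds
  refine squeeze_zero' ?_ ?_ h2
  · filter_upwards [self_mem_nhdsWithin] with t ht
    have : (0 : ℝ) < t := ht
    positivity
  · filter_upwards [self_mem_nhdsWithin] with t ht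
    have ht : (0 : ℝ) < t := ht
    rw [div_le_iff₀ ht]
    have := H.norm_sub_sq_le (a := a) (b := a + t) (by linarith)
    linarith

end HasL2Density

end Density

/-- The fundamental theorem of calculus for absolutely continuous functions, with the derivative
prescribed almost everywhere. -/
theorem integral_eq_sub_of_ae_hasDerivAt {F f : ℝ → ℝ} {a b : ℝ}
    (hF : AbsolutelyContinuousOnInterval F a b)
    (hd : ∀ᵐ x, x ∈ uIcc a b → HasDerivAt F (f x) x) :
    ∫ x in a..b, f x = F b - F a := by
  rw [← hF.integral_deriv_eq_sub]
  refine intervalIntegral.integral_congr_ae ?_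
  filter_upwards [hd] with x hx hxab
  exact (hx (uIoc_subset_uIcc hxab)).deriv.symm

theorem intervalIntegrable_of_ae_hasDerivAt {F f : ℝ → ℝ} {a b : ℝ}
    (hF : AbsolutelyContinuousOnInterval F a b)
    (hd : ∀ᵐ x, x ∈ uIcc a b → HasDerivAt F (f x) x) :
    IntervalIntegrable f volume a b := by
  refine hF.intervalIntegrable_deriv.congr_ae ?_
  rw [Filter.EventuallyEq, ae_restrict_iff' measurableSet_uIoc]
  filter_upwards [hd] with x hx hxab
  exact (hx (uIoc_subset_uIcc hxab)).deriv

theorem absolutelyContinuousOnInterval_of_contDiffOn {F : ℝ → ℝ} {a b : ℝ}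
    (hF : ContDiffOn ℝ 1 F (uIcc a b)) : AbsolutelyContinuousOnInterval F a b := by
  obtain ⟨K, hK⟩ := hF.exists_lipschitzOnWith one_ne_zero (convex_uIcc a b) isCompact_uIcc
  exact hK.absolutelyContinuousOnInterval

namespace MemH1

variable {x : ℝ → E3}

theorem hasL2Density (H : MemH1 x) : HasL2Density x (deriv x) where
  meas := stronglyMeasurable_deriv x
  sq a b := by
    have hp : Function.Periodic (fun s => ‖deriv x s‖ ^ 2) (2 * Real.pi) := by
      intro s
      have h1 : (fun s => x (s + 2 * Real.pi)) = x := funext H.periodic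
      have h2 := deriv_comp_add_const x (2 * Real.pi) s
      rw [h1] at h2
      simp only [← h2]
    refine hp.intervalIntegrable₀ (by positivity) ?_ a b
    rw [intervalIntegrable_iff_integrableOn_Ioc_of_le (by positivity)]
    exact (memLp_two_iff_integrable_sq_norm H.deriv_memLp.1).1 H.deriv_memLp
  sub_eq := H.sub_eq_integral

end MemH1

/-! ### Hardy and Poincaré inequalities on an arc -/

/-- The endpoints of intervals that exhaust `(0, π)`. -/
theorem tendsto_one_div_add_one_nhdsGT :
    Tendsto (fun n : ℕ => 1 / ((n : ℝ) + 1)) atTop (𝓝[>] 0) :=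
  tendsto_nhdsWithin_iff.2 ⟨tendsto_one_div_add_atTop_nhds_zero_nat,
    Eventually.of_forall fun n => by simp only [mem_Ioi]; positivity⟩

theorem one_div_add_one_le_one (n : ℕ) : 1 / ((n : ℝ) + 1) ≤ 1 := by
  rw [div_le_one (by positivity)]; linarith [(Nat.cast_nonneg n : (0 : ℝ) ≤ n)]

theorem tendsto_intervalIntegral_exhaust {f : ℝ → ℝ}
    (hf : IntervalIntegrable f volume 0 Real.pi) :
    Tendsto (fun n : ℕ => ∫ t in (1 / ((n : ℝ) + 1))..(Real.pi - 1 / ((n : ℝ) + 1)), f t) atTop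
      (𝓝 (∫ t in (0 : ℝ)..Real.pi, f t)) := by
  have h0 := tendsto_one_div_add_one_nhdsGT.mono_right (nhdsWithin_le_nhds)
  have hpi := Real.pi_gt_three
  have h1 : Tendsto (fun n : ℕ => Real.pi - 1 / ((n : ℝ) + 1)) atTop (𝓝 Real.pi) := by
    simpa using tendsto_const_nhds.sub h0
  rw [intervalIntegral.integral_of_le Real.pi_pos.le]
  rw [intervalIntegrable_iff_integrableOn_Ioc_of_le Real.pi_pos.le] at hf
  have := (aecover_Ioc_of_Ioc (μ := volume) h0 h1).integral_tendsto_of_countably_generated hf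
  refine this.congr fun n => ?_
  have hn := one_div_add_one_le_one n
  have hn0 : 0 < 1 / ((n : ℝ) + 1) := by positivity
  rw [intervalIntegral.integral_of_le (by linarith), Measure.restrict_restrict measurableSet_Ioc,
    inter_eq_left.2 (Ioc_subset_Ioc hn0.le (by linarith))]

/-- By this and its mirror image at `π`, the boundary terms in the integrations by parts below
vanish. -/
theorem tendsto_mul_div_sin_nhdsGT {u g v h : ℝ → ℝ} (H : HasL2Density u g)
    (K : HasL2Density v h) (hu : u 0 = 0) (hv : v 0 = 0) :
    Tendsto (fun t => u t * v t / Real.sin t) (𝓝[>] 0) (𝓝 0) := by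
  have h1 := H.tendsto_norm_sq_div 0
  have h2 := K.tendsto_norm_sq_div 0
  simp only [zero_add, hu, hv, sub_zero, Real.norm_eq_abs, sq_abs] at h1 h2
  have h3 := (h1.add h2).const_mul (Real.pi / 4)
  simp only [add_zero, mul_zero] at h3
  refine squeeze_zero_norm' ?_ h3
  have hpi := Real.pi_gt_three
  have hmem : Ioo (0 : ℝ) 1 ∈ 𝓝[>] (0 : ℝ) := Ioo_mem_nhdsGT one_pos
  filter_upwards [hmem] with t ht
  have hs := Real.mul_le_sin ht.1.le (by linarith [ht.2] : t ≤ Real.pi / 2)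
  have ht0 := ht.1
  have hs0 : 0 < Real.sin t := lt_of_lt_of_le (by positivity) hs
  rw [Real.norm_eq_abs, abs_div, abs_of_pos hs0, div_le_iff₀ hs0, abs_mul]
  have h4 : |u t| * |v t| ≤ (u t ^ 2 + v t ^ 2) / 2 := by
    nlinarith [sq_nonneg (|u t| - |v t|), sq_abs (u t), sq_abs (v t)]
  refine h4.trans ?_
  have h5 : Real.pi / 4 * (u t ^ 2 / t + v t ^ 2 / t) * (2 / Real.pi * t)
      = (u t ^ 2 + v t ^ 2) / 2 := by
    field_simp; ring
  rw [← h5]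
  gcongr

theorem tendsto_mul_div_sin_reflect {u g v h : ℝ → ℝ} (H : HasL2Density u g)
    (K : HasL2Density v h) (hu : u Real.pi = 0) (hv : v Real.pi = 0) :
    Tendsto (fun t => u (Real.pi - t) * v (Real.pi - t) / Real.sin (Real.pi - t))
      (𝓝[>] 0) (𝓝 0) := by
  have h1 := tendsto_mul_div_sin_nhdsGT (H.comp_affine Real.pi (η := -1) (by norm_num))
    (K.comp_affine Real.pi (η := -1) (by norm_num)) (by simpa using hu) (by simpa using hv)
  refine h1.congr fun t => ?_
  rw [Real.sin_pi_sub]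
  ring_nf

theorem sin_pos_of_mem_uIcc {a b t : ℝ} (ha : 0 < a) (hab : a ≤ b) (hb : b < Real.pi)
    (ht : t ∈ uIcc a b) : 0 < Real.sin t := by
  rw [uIcc_of_le hab] at ht
  exact Real.sin_pos_of_pos_of_lt_pi (ha.trans_le ht.1) (ht.2.trans_lt hb)

theorem absolutelyContinuousOnInterval_cot {a b : ℝ} (ha : 0 < a) (hab : a ≤ b)
    (hb : b < Real.pi) :
    AbsolutelyContinuousOnInterval (fun t => Real.cos t / Real.sin t) a b :=
  absolutelyContinuousOnInterval_of_contDiffOn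
    (Real.contDiff_cos.contDiffOn.div Real.contDiff_sin.contDiffOn
      fun _ ht => (sin_pos_of_mem_uIcc ha hab hb ht).ne')

theorem absolutelyContinuousOnInterval_inv_sin {a b : ℝ} (ha : 0 < a) (hab : a ≤ b)
    (hb : b < Real.pi) :
    AbsolutelyContinuousOnInterval (fun t => 1 / Real.sin t) a b :=
  absolutelyContinuousOnInterval_of_contDiffOn
    (contDiffOn_const.div Real.contDiff_sin.contDiffOn
      fun _ ht => (sin_pos_of_mem_uIcc ha hab hb ht).ne')

theorem hasDerivAt_cot {t : ℝ} (ht : Real.sin t ≠ 0) :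
    HasDerivAt (fun t => Real.cos t / Real.sin t) (-1 / Real.sin t ^ 2) t := by
  convert! (Real.hasDerivAt_cos t).div (Real.hasDerivAt_sin t) ht using 1
  congr 1
  linarith [Real.sin_sq_add_cos_sq t, sq (Real.sin t), sq (Real.cos t)]

theorem hasDerivAt_inv_sin {t : ℝ} (ht : Real.sin t ≠ 0) :
    HasDerivAt (fun t => 1 / Real.sin t) (-Real.cos t / Real.sin t ^ 2) t := by
  simpa only [one_div] using (Real.hasDerivAt_sin t).fun_inv ht

theorem intervalIntegrable_div_sin_sq {u : ℝ → ℝ} (hu : Continuous u) {a b : ℝ} (ha : 0 < a)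
    (hab : a ≤ b) (hb : b < Real.pi) :
    IntervalIntegrable (fun t => (u t / Real.sin t) ^ 2) volume a b := by
  refine ContinuousOn.intervalIntegrable fun t ht => ?_
  exact ((hu.continuousAt.div Real.continuous_sin.continuousAt
    (sin_pos_of_mem_uIcc ha hab hb ht).ne').pow 2).continuousWithinAt

theorem HasL2Density.intervalIntegrable_sq {u g : ℝ → ℝ} (H : HasL2Density u g) (a b : ℝ) :
    IntervalIntegrable (fun t => g t ^ 2) volume a b := by
  simpa [sq_abs] using H.sq a b

/-- Hardy's inequality on a compact part of `(0, π)`, with boundary terms. It is the integrated form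
of `(g - u cot / 2)² ≥ 0`. -/
theorem integral_div_sin_sq_le_of_Icc {u g : ℝ → ℝ} (H : HasL2Density u g) {a b : ℝ} (ha : 0 < a)
    (hab : a ≤ b) (hb : b < Real.pi) :
    ∫ t in a..b, (u t / Real.sin t) ^ 2 ≤ 4 * (∫ t in a..b, g t ^ 2)
      - 2 * (u b ^ 2 * (Real.cos b / Real.sin b) - u a ^ 2 * (Real.cos a / Real.sin a)) := by
  have hac : AbsolutelyContinuousOnInterval (fun t => u t * u t * (Real.cos t / Real.sin t)) a b :=
    ((H.absolutelyContinuous a b).fun_mul (H.absolutelyContinuous a b)).fun_mul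
      (absolutelyContinuousOnInterval_cot ha hab hb)
  have hd : ∀ᵐ t, t ∈ uIcc a b → HasDerivAt (fun t => u t * u t * (Real.cos t / Real.sin t))
      ((g t * u t + u t * g t) * (Real.cos t / Real.sin t)
        + u t * u t * (-1 / Real.sin t ^ 2)) t := by
    filter_upwards [H.ae_hasDerivAt] with t ht htab
    exact (ht.mul ht).mul (hasDerivAt_cot (sin_pos_of_mem_uIcc ha hab hb htab).ne')
  have e1 := integral_eq_sub_of_ae_hasDerivAt hac hd
  have i1 := intervalIntegrable_of_ae_hasDerivAt hac hd
  have i2 := (H.intervalIntegrable_sq a b).const_mul 4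
  have i3 := intervalIntegrable_div_sin_sq H.continuous ha hab hb
  have key : ∫ t in a..b, (u t / Real.sin t) ^ 2 ≤
      ∫ t in a..b, (4 * g t ^ 2 - 2 * ((g t * u t + u t * g t) * (Real.cos t / Real.sin t)
        + u t * u t * (-1 / Real.sin t ^ 2))) := by
    refine intervalIntegral.integral_mono_on hab i3 (i2.sub (i1.const_mul 2)) fun t ht => ?_
    have hs := sin_pos_of_mem_uIcc ha hab hb (Icc_subset_uIcc ht)
    have e2 : 4 * g t ^ 2 - 2 * ((g t * u t + u t * g t) * (Real.cos t / Real.sin t)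
        + u t * u t * (-1 / Real.sin t ^ 2)) - (u t / Real.sin t) ^ 2
        = 4 * (g t - u t * Real.cos t / (2 * Real.sin t)) ^ 2
          + u t ^ 2 * ((1 - Real.cos t ^ 2) / Real.sin t ^ 2) := by
      field_simp
      ring
    have e3 : (1 - Real.cos t ^ 2) / Real.sin t ^ 2 = 1 := by
      rw [← Real.sin_sq, div_self (by positivity)]
    rw [e3] at e2
    nlinarith [sq_nonneg (g t - u t * Real.cos t / (2 * Real.sin t)), sq_nonneg (u t)]
  refine key.trans (le_of_eq ?_)
  rw [intervalIntegral.integral_sub i2 (i1.const_mul 2), intervalIntegral.integral_const_mul,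
    intervalIntegral.integral_const_mul, e1]
  ring

theorem tendsto_exhaust_left {F : ℝ → ℝ} {l : ℝ} (h : Tendsto F (𝓝[>] 0) (𝓝 l)) :
    Tendsto (fun n : ℕ => F (1 / ((n : ℝ) + 1))) atTop (𝓝 l) :=
  h.comp tendsto_one_div_add_one_nhdsGT

/-- For functions vanishing at both ends of `[0, π]`, the boundary terms `u v cot` tend to zero. -/
theorem tendsto_boundary_cot {u g : ℝ → ℝ} (H : HasL2Density u g) (h0 : u 0 = 0)
    (hpi : u Real.pi = 0) :
    Tendsto (fun n : ℕ =>
      u (Real.pi - 1 / ((n : ℝ) + 1)) ^ 2 * (Real.cos (Real.pi - 1 / ((n : ℝ) + 1)) /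
        Real.sin (Real.pi - 1 / ((n : ℝ) + 1)))
      - u (1 / ((n : ℝ) + 1)) ^ 2 * (Real.cos (1 / ((n : ℝ) + 1)) /
        Real.sin (1 / ((n : ℝ) + 1)))) atTop (𝓝 0) := by
  have c1 : Tendsto Real.cos (𝓝[>] 0) (𝓝 1) := by
    simpa using (Real.continuous_cos.tendsto 0).mono_left nhdsWithin_le_nhds
  have a := (tendsto_mul_div_sin_nhdsGT H H h0 h0).mul c1
  have b := (tendsto_mul_div_sin_reflect H H hpi hpi).mul c1
  have := (tendsto_exhaust_left b).neg.sub (tendsto_exhaust_left a)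
  simp only [zero_mul, neg_zero, sub_zero] at this
  refine this.congr fun n => ?_
  rw [Real.cos_pi_sub]
  ring

/-- Hardy's inequality for functions in `H¹₀(0, π)`. -/
theorem intervalIntegrable_and_integral_div_sin_sq_le {u g : ℝ → ℝ} (H : HasL2Density u g)
    (h0 : u 0 = 0) (hpi : u Real.pi = 0) :
    IntervalIntegrable (fun t => (u t / Real.sin t) ^ 2) volume 0 Real.pi ∧
      ∫ t in (0 : ℝ)..Real.pi, (u t / Real.sin t) ^ 2 ≤ 4 * ∫ t in (0 : ℝ)..Real.pi, g t ^ 2 := by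
  have hpi3 := Real.pi_gt_three
  have hb : ∀ n : ℕ, 0 < 1 / ((n : ℝ) + 1) ∧ 1 / ((n : ℝ) + 1) ≤ Real.pi - 1 / ((n : ℝ) + 1) ∧
      Real.pi - 1 / ((n : ℝ) + 1) < Real.pi := fun n => by
    have := one_div_add_one_le_one n
    have : 0 < 1 / ((n : ℝ) + 1) := by positivity
    refine ⟨this, by linarith, by linarith⟩
  have hle := fun n : ℕ => integral_div_sin_sq_le_of_Icc H (hb n).1 (hb n).2.1 (hb n).2.2
  have hlim := ((tendsto_intervalIntegral_exhaust (H.intervalIntegrable_sq 0 Real.pi)).const_mul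
    4).sub ((tendsto_boundary_cot H h0 hpi).const_mul 2)
  simp only [mul_zero, sub_zero] at hlim
  have hint : IntervalIntegrable (fun t => (u t / Real.sin t) ^ 2) volume 0 Real.pi := by
    rw [intervalIntegrable_iff_integrableOn_Ioc_of_le Real.pi_pos.le]
    have t0 := tendsto_one_div_add_one_nhdsGT.mono_right nhdsWithin_le_nhds
    have t1 : Tendsto (fun n : ℕ => Real.pi - 1 / ((n : ℝ) + 1)) atTop (𝓝 Real.pi) := by
      simpa using tendsto_const_nhds.sub t0
    refine integrableOn_Ioc_of_intervalIntegral_norm_bounded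
      (I := 4 * (∫ t in (0 : ℝ)..Real.pi, g t ^ 2) + 1) (fun n => ?_) t0 t1 ?_
    · rw [← intervalIntegrable_iff_integrableOn_Ioc_of_le (hb n).2.1]
      exact intervalIntegrable_div_sin_sq H.continuous (hb n).1 (hb n).2.1 (hb n).2.2
    · filter_upwards [hlim.eventually_le_const (lt_add_one _)] with n hn
      rw [← intervalIntegral.integral_of_le (hb n).2.1]
      simp only [norm_pow, Real.norm_eq_abs, sq_abs]
      exact (hle n).trans hn
  exact ⟨hint, le_of_tendsto_of_tendsto' (tendsto_intervalIntegral_exhaust hint) hlim hle⟩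

theorem intervalIntegrable_of_sq {w : ℝ → ℝ} {a b : ℝ} (hw : Measurable w)
    (h : IntervalIntegrable (fun t => w t ^ 2) volume a b) : IntervalIntegrable w volume a b := by
  refine IntervalIntegrable.mono_fun
    ((intervalIntegrable_const (c := (1 : ℝ))).add h) hw.aestronglyMeasurable
    (Eventually.of_forall fun s => ?_)
  simp only [Real.norm_eq_abs]
  rw [abs_of_nonneg (by positivity : 0 ≤ 1 + w s ^ 2)]
  nlinarith [sq_nonneg (|w s| - 1), sq_abs (w s)]

/-- The expansion of the variance over `[0, π]`. -/
theorem integral_sub_average_sq {w : ℝ → ℝ} (h1 : IntervalIntegrable w volume 0 Real.pi)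
    (h2 : IntervalIntegrable (fun t => w t ^ 2) volume 0 Real.pi) :
    ∫ t in (0 : ℝ)..Real.pi, (w t - (∫ r in (0 : ℝ)..Real.pi, w r) / Real.pi) ^ 2
      = (∫ t in (0 : ℝ)..Real.pi, w t ^ 2)
        - (∫ t in (0 : ℝ)..Real.pi, w t) ^ 2 / Real.pi := by
  set J := ∫ r in (0 : ℝ)..Real.pi, w r with hJ
  have : ∀ t, (w t - J / Real.pi) ^ 2 = w t ^ 2 - 2 * (J / Real.pi) * w t + (J / Real.pi) ^ 2 :=
    fun t => by ring
  simp only [this]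
  rw [intervalIntegral.integral_add (h2.sub (h1.const_mul _)) intervalIntegrable_const,
    intervalIntegral.integral_sub h2 (h1.const_mul _), intervalIntegral.integral_const_mul,
    intervalIntegral.integral_const, ← hJ, smul_eq_mul]
  field_simp
  ring

/-- The spectral gap: for `u ∈ H¹₀(0, π)` and `w = u / sin`, the form `∫ u'² - u² = ∫ sin² w'²`
dominates a quarter of the variance of `w`. With `W` the primitive of `w` minus its mean, this
is `∫ (sin w' + W / (4 sin))² ≥ 0` combined with Hardy's inequality for `W`. -/
theorem variance_div_sin_le {u g : ℝ → ℝ} (H : HasL2Density u g)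
    (h0 : u 0 = 0) (hpi : u Real.pi = 0) :
    (∫ t in (0 : ℝ)..Real.pi, (u t / Real.sin t) ^ 2)
      - (∫ t in (0 : ℝ)..Real.pi, u t / Real.sin t) ^ 2 / Real.pi
      ≤ 4 * ∫ t in (0 : ℝ)..Real.pi, (g t ^ 2 - u t ^ 2) := by
  have hpi3 := Real.pi_gt_three
  set w : ℝ → ℝ := fun t => u t / Real.sin t with hw
  have hwm : Measurable w := H.continuous.measurable.div Real.measurable_sin
  have hw2 : IntervalIntegrable (fun t => w t ^ 2) volume 0 Real.pi :=
    (intervalIntegrable_and_integral_div_sin_sq_le H h0 hpi).1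
  have hw1 : IntervalIntegrable w volume 0 Real.pi := intervalIntegrable_of_sq hwm hw2
  set m := (∫ r in (0 : ℝ)..Real.pi, w r) / Real.pi with hm
  have hvar := integral_sub_average_sq hw1 hw2
  rw [← hm] at hvar
  rw [← hvar]
  -- `h` is `w` minus its mean, extended by zero to be square integrable on the whole line; its
  -- primitive `W` vanishes at both ends
  set h : ℝ → ℝ := (Ioc 0 Real.pi).indicator fun t => w t - m with hh
  have hhm : Measurable h := (hwm.sub_const m).indicator measurableSet_Ioc
  have hwm2 : IntervalIntegrable (fun t => (w t - m) ^ 2) volume 0 Real.pi := by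
    have : ∀ t, (w t - m) ^ 2 = w t ^ 2 - 2 * m * w t + m ^ 2 := fun t => by ring
    simp only [this]
    exact (hw2.sub (hw1.const_mul _)).add intervalIntegrable_const
  have hh2 : Integrable fun t => h t ^ 2 := by
    have : (fun t => h t ^ 2) = (Ioc 0 Real.pi).indicator fun t => (w t - m) ^ 2 := by
      funext t
      by_cases ht : t ∈ Ioc 0 Real.pi <;> simp [hh, ht]
    rw [this, integrable_indicator_iff measurableSet_Ioc,
      ← intervalIntegrable_iff_integrableOn_Ioc_of_le Real.pi_pos.le]
    exact hwm2
  set W : ℝ → ℝ := fun t => ∫ r in (0 : ℝ)..t, h r with hW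
  have hhi : ∀ a b, IntervalIntegrable h volume a b := fun a b =>
    intervalIntegrable_of_sq hhm hh2.intervalIntegrable
  have HW : HasL2Density W h :=
    { meas := hhm.stronglyMeasurable
      sq := fun a b => by
        simp only [Real.norm_eq_abs, sq_abs]
        exact hh2.intervalIntegrable
      sub_eq := fun a b => by
        rw [hW]
        exact intervalIntegral.integral_interval_sub_left (hhi _ _) (hhi _ _) }
  have hheq : ∀ t ∈ uIoc 0 Real.pi, h t = w t - m := fun t ht => by
    rw [uIoc_of_le Real.pi_pos.le] at ht
    simp [hh, ht]
  have hW0 : W 0 = 0 := by simp [hW]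
  have hWint : ∫ t in (0 : ℝ)..Real.pi, h t = 0 := by
    rw [intervalIntegral.integral_congr_ae (g := fun t => w t - m) (ae_of_all _ hheq),
      intervalIntegral.integral_sub hw1 intervalIntegrable_const, intervalIntegral.integral_const,
      hm, smul_eq_mul]
    field_simp
    ring
  have hWpi : W Real.pi = 0 := hWint
  obtain ⟨iW, hHardy⟩ := intervalIntegrable_and_integral_div_sin_sq_le HW hW0 hWpi
  have hN : ∫ t in (0 : ℝ)..Real.pi, h t ^ 2 = ∫ t in (0 : ℝ)..Real.pi, (w t - m) ^ 2 :=
    intervalIntegral.integral_congr_ae (ae_of_all _ fun t ht => by simp only [hheq t ht])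
  rw [hN] at hHardy
  have iwh : IntervalIntegrable (fun t => w t * h t) volume 0 Real.pi := by
    refine IntervalIntegrable.mono_fun (hw2.add hh2.intervalIntegrable)
      (hwm.mul hhm).aestronglyMeasurable (Eventually.of_forall fun t => ?_)
    simp only [Real.norm_eq_abs]
    rw [abs_of_nonneg (by positivity : 0 ≤ w t ^ 2 + h t ^ 2), abs_mul]
    nlinarith [sq_nonneg (|w t| - |h t|), sq_abs (w t), sq_abs (h t)]
  have hNwh : ∫ t in (0 : ℝ)..Real.pi, w t * h t = ∫ t in (0 : ℝ)..Real.pi, (w t - m) ^ 2 := by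
    rw [← hN, ← sub_eq_zero, ← intervalIntegral.integral_sub iwh hh2.intervalIntegrable]
    have : ∫ t in (0 : ℝ)..Real.pi, (w t * h t - h t ^ 2) = ∫ t in (0 : ℝ)..Real.pi, m * h t :=
      intervalIntegral.integral_congr_ae (ae_of_all _ fun t ht => by
        simp only [hheq t ht]; ring)
    rw [this, intervalIntegral.integral_const_mul, hWint, mul_zero]
  set N := ∫ t in (0 : ℝ)..Real.pi, (w t - m) ^ 2 with hNdef
  have iE : ∀ a b, IntervalIntegrable (fun t => g t ^ 2 - u t ^ 2) volume a b := fun a b =>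
    (H.intervalIntegrable_sq a b).sub ((H.continuous.pow 2).intervalIntegrable a b)
  -- the inequality on `[a, b] ⊂ (0, π)`, with boundary terms
  have hcpt : ∀ a b : ℝ, 0 < a → a ≤ b → b < Real.pi →
      0 ≤ (∫ t in a..b, (g t ^ 2 - u t ^ 2))
        - ((u b ^ 2 * (Real.cos b / Real.sin b) - u a ^ 2 * (Real.cos a / Real.sin a))
          - (u b * W b / Real.sin b - u a * W a / Real.sin a) / 2)
        - (∫ t in a..b, w t * h t) / 2 + (∫ t in a..b, (W t / Real.sin t) ^ 2) / 16 := by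
    intro a b ha hab hb
    have hu := H.absolutelyContinuous a b
    have hac : AbsolutelyContinuousOnInterval (fun t => u t * u t * (Real.cos t / Real.sin t)
        - (1 / 2) * (u t * W t * (1 / Real.sin t))) a b :=
      ((hu.fun_mul hu).fun_mul (absolutelyContinuousOnInterval_cot ha hab hb)).fun_sub
        (((hu.fun_mul (HW.absolutelyContinuous a b)).fun_mul
          (absolutelyContinuousOnInterval_inv_sin ha hab hb)).const_mul (1 / 2))
    have hd : ∀ᵐ t, t ∈ uIcc a b → HasDerivAt (fun t => u t * u t * (Real.cos t / Real.sin t)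
        - (1 / 2) * (u t * W t * (1 / Real.sin t)))
        (((g t * u t + u t * g t) * (Real.cos t / Real.sin t)
        + u t * u t * (-1 / Real.sin t ^ 2))
        - (1 / 2) * ((g t * W t + u t * h t) * (1 / Real.sin t)
          + u t * W t * (-Real.cos t / Real.sin t ^ 2))) t := by
      filter_upwards [H.ae_hasDerivAt, HW.ae_hasDerivAt] with t ht htW htab
      have hs := (sin_pos_of_mem_uIcc ha hab hb htab).ne'
      exact ((ht.mul ht).mul (hasDerivAt_cot hs)).sub
        (((ht.mul htW).mul (hasDerivAt_inv_sin hs)).const_mul (1 / 2))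
    have e1 := integral_eq_sub_of_ae_hasDerivAt hac hd
    have i1 := intervalIntegrable_of_ae_hasDerivAt hac hd
    have hsub : uIcc a b ⊆ uIcc 0 Real.pi := by
      rw [uIcc_of_le hab, uIcc_of_le Real.pi_pos.le]
      exact Icc_subset_Icc ha.le hb.le
    have i2 := iwh.mono_set hsub
    have i3 := iW.mono_set hsub
    have key : 0 ≤ ∫ t in a..b, (g t ^ 2 - u t ^ 2
        - (((g t * u t + u t * g t) * (Real.cos t / Real.sin t)
        + u t * u t * (-1 / Real.sin t ^ 2))
        - (1 / 2) * ((g t * W t + u t * h t) * (1 / Real.sin t)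
          + u t * W t * (-Real.cos t / Real.sin t ^ 2)))
        - (1 / 2) * (w t * h t) + (1 / 16) * (W t / Real.sin t) ^ 2) := by
      refine intervalIntegral.integral_nonneg hab fun t ht => ?_
      have hs := sin_pos_of_mem_uIcc ha hab hb (Icc_subset_uIcc ht)
      have hc : Real.cos t ^ 2 = 1 - Real.sin t ^ 2 := Real.cos_sq' t
      -- since `sin w' = u' - u cos / sin`
      have e2 : g t ^ 2 - u t ^ 2
        - (((g t * u t + u t * g t) * (Real.cos t / Real.sin t)
        + u t * u t * (-1 / Real.sin t ^ 2))
        - (1 / 2) * ((g t * W t + u t * h t) * (1 / Real.sin t)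
          + u t * W t * (-Real.cos t / Real.sin t ^ 2)))
        - (1 / 2) * (w t * h t) + (1 / 16) * (W t / Real.sin t) ^ 2
          = (g t - u t * Real.cos t / Real.sin t + W t / (4 * Real.sin t)) ^ 2 := by
        simp only [hw]
        field_simp
        ring_nf
        rw [hc]
        ring
      rw [e2]
      positivity
    rw [intervalIntegral.integral_add (((iE a b).sub i1).sub (i2.const_mul _)) (i3.const_mul _),
      intervalIntegral.integral_sub ((iE a b).sub i1) (i2.const_mul _),
      intervalIntegral.integral_sub (iE a b) i1, intervalIntegral.integral_const_mul,
      intervalIntegral.integral_const_mul, e1] at key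
    refine key.trans (le_of_eq ?_)
    ring
  have hlim := (((tendsto_intervalIntegral_exhaust (iE 0 Real.pi)).sub
    ((tendsto_boundary_cot H h0 hpi).sub
      (((tendsto_exhaust_left (tendsto_mul_div_sin_reflect H HW hpi hWpi)).sub
        (tendsto_exhaust_left (tendsto_mul_div_sin_nhdsGT H HW h0 hW0))).div_const 2))).sub
    ((tendsto_intervalIntegral_exhaust iwh).div_const 2)).add
    ((tendsto_intervalIntegral_exhaust iW).div_const 16)
  have hfin := ge_of_tendsto' hlim fun n => by
    have := one_div_add_one_le_one n
    have h' : 0 < 1 / ((n : ℝ) + 1) := by positivity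
    exact hcpt _ _ h' (by linarith) (by linarith)
  rw [hNwh] at hfin
  linarith

/-- Only multiples of the sine have vanishing variance of `u / sin`. -/
theorem eq_mul_sin_of_variance_le {u g : ℝ → ℝ} (H : HasL2Density u g)
    (h0 : u 0 = 0) (hpi : u Real.pi = 0)
    (hv : (∫ t in (0 : ℝ)..Real.pi, (u t / Real.sin t) ^ 2)
      - (∫ t in (0 : ℝ)..Real.pi, u t / Real.sin t) ^ 2 / Real.pi ≤ 0) :
    ∀ t ∈ Icc 0 Real.pi,
      u t = (∫ t in (0 : ℝ)..Real.pi, u t / Real.sin t) / Real.pi * Real.sin t := by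
  set w : ℝ → ℝ := fun t => u t / Real.sin t with hw
  have hwm : Measurable w := H.continuous.measurable.div Real.measurable_sin
  have hw2 : IntervalIntegrable (fun t => w t ^ 2) volume 0 Real.pi :=
    (intervalIntegrable_and_integral_div_sin_sq_le H h0 hpi).1
  have hw1 : IntervalIntegrable w volume 0 Real.pi := intervalIntegrable_of_sq hwm hw2
  have hvar := integral_sub_average_sq hw1 hw2
  set m := (∫ r in (0 : ℝ)..Real.pi, w r) / Real.pi with hm
  have hwm2 : IntervalIntegrable (fun t => (w t - m) ^ 2) volume 0 Real.pi := by
    have : ∀ t, (w t - m) ^ 2 = w t ^ 2 - 2 * m * w t + m ^ 2 := fun t => by ring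
    simp only [this]
    exact (hw2.sub (hw1.const_mul _)).add intervalIntegrable_const
  have hz : ∫ t in (0 : ℝ)..Real.pi, (w t - m) ^ 2 = 0 :=
    le_antisymm (hvar.le.trans hv)
      (intervalIntegral.integral_nonneg Real.pi_pos.le fun t _ => sq_nonneg _)
  rw [intervalIntegral.integral_of_le Real.pi_pos.le, integral_eq_zero_iff_of_nonneg
    (fun t => sq_nonneg _)
    ((intervalIntegrable_iff_integrableOn_Ioc_of_le Real.pi_pos.le).1 hwm2)] at hz
  have hae : u =ᵐ[volume.restrict (Ioo 0 Real.pi)] fun t => m * Real.sin t := by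
    have hz' := ae_restrict_of_ae_restrict_of_subset (Ioo_subset_Ioc_self) hz
    filter_upwards [hz', ae_restrict_mem measurableSet_Ioo] with t ht htm
    have hs : Real.sin t ≠ 0 := (Real.sin_pos_of_mem_Ioo htm).ne'
    have : w t - m = 0 := by simpa using ht
    rw [← sub_eq_zero.1 this, hw]
    field_simp
  have heq := Measure.eqOn_open_of_ae_eq hae isOpen_Ioo H.continuous.continuousOn
    (by fun_prop : Continuous fun t => m * Real.sin t).continuousOn
  intro t ht
  rcases eq_or_lt_of_le ht.1 with rfl | h1
  · simp [h0]
  rcases eq_or_lt_of_le ht.2 with rfl | h2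
  · simp [hpi]
  exact heq ⟨h1, h2⟩

/-- Adding a multiple of the cosine does not change `∫ u'² - u²` over
`[0, π]`, since the cosine solves `φ'' + φ = 0` and `φ' = 0` at the ends. -/
theorem integral_sq_sub_sq_add_cos {u g : ℝ → ℝ} (H : HasL2Density u g) (c : ℝ) :
    ∫ t in (0 : ℝ)..Real.pi, ((g t - c * Real.sin t) ^ 2 - (u t + c * Real.cos t) ^ 2)
      = ∫ t in (0 : ℝ)..Real.pi, (g t ^ 2 - u t ^ 2) := by
  have hac : AbsolutelyContinuousOnInterval (fun t => -2 * c * (u t * Real.sin t)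
      - c ^ 2 * (Real.sin t * Real.cos t)) 0 Real.pi := by
    have hs : AbsolutelyContinuousOnInterval Real.sin 0 Real.pi :=
      absolutelyContinuousOnInterval_of_contDiffOn Real.contDiff_sin.contDiffOn
    have hc : AbsolutelyContinuousOnInterval Real.cos 0 Real.pi :=
      absolutelyContinuousOnInterval_of_contDiffOn Real.contDiff_cos.contDiffOn
    exact (((H.absolutelyContinuous 0 Real.pi).fun_mul hs).const_mul _).fun_sub
      ((hs.fun_mul hc).const_mul _)
  have hd : ∀ᵐ t, t ∈ uIcc 0 Real.pi → HasDerivAt (fun t => -2 * c * (u t * Real.sin t)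
      - c ^ 2 * (Real.sin t * Real.cos t))
      (-2 * c * (g t * Real.sin t + u t * Real.cos t)
        - c ^ 2 * (Real.cos t * Real.cos t + Real.sin t * (-Real.sin t))) t := by
    filter_upwards [H.ae_hasDerivAt] with t ht _
    exact ((ht.mul (Real.hasDerivAt_sin t)).const_mul _).sub
      (((Real.hasDerivAt_sin t).mul (Real.hasDerivAt_cos t)).const_mul _)
  have e1 := integral_eq_sub_of_ae_hasDerivAt hac hd
  have i1 := intervalIntegrable_of_ae_hasDerivAt hac hd
  have iE : IntervalIntegrable (fun t => g t ^ 2 - u t ^ 2) volume 0 Real.pi :=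
    (H.intervalIntegrable_sq 0 Real.pi).sub ((H.continuous.pow 2).intervalIntegrable 0 Real.pi)
  have : ∀ t, (g t - c * Real.sin t) ^ 2 - (u t + c * Real.cos t) ^ 2
      = (g t ^ 2 - u t ^ 2) + (-2 * c * (g t * Real.sin t + u t * Real.cos t)
        - c ^ 2 * (Real.cos t * Real.cos t + Real.sin t * (-Real.sin t))) := fun t => by ring
  simp only [this]
  rw [intervalIntegral.integral_add iE i1, e1]
  simp

/-- The first variation of the collapsed orbit on one arc, where it is a multiple of the sine, comes
from the boundary only. -/
theorem integral_cos_mul_sub_sin_mul {u g : ℝ → ℝ} (H : HasL2Density u g) :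
    ∫ t in (0 : ℝ)..Real.pi, (Real.cos t * g t - Real.sin t * u t) = -(u Real.pi + u 0) := by
  have hc : AbsolutelyContinuousOnInterval Real.cos 0 Real.pi :=
    absolutelyContinuousOnInterval_of_contDiffOn Real.contDiff_cos.contDiffOn
  have hd : ∀ᵐ t, t ∈ uIcc 0 Real.pi → HasDerivAt (fun t => Real.cos t * u t)
      (Real.cos t * g t - Real.sin t * u t) t := by
    filter_upwards [H.ae_hasDerivAt] with t ht _
    convert! (Real.hasDerivAt_cos t).mul ht using 1
    ring
  rw [integral_eq_sub_of_ae_hasDerivAt (hc.fun_mul (H.absolutelyContinuous 0 Real.pi)) hd]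
  simp
  ring

/-! ### Two-scale limits of integrals -/

theorem integral_mul_inv_sq_le {C δ a T : ℝ} (hC : 0 ≤ C) (hδ : 0 < δ) (ha : 0 < a) (haT : a ≤ T) :
    IntervalIntegrable (fun t => C * δ / t ^ 2) volume a T ∧
      ∫ t in a..T, C * δ / t ^ 2 ≤ C * δ / a := by
  have hpos : ∀ t ∈ uIcc a T, t ≠ 0 := fun t ht => by
    rw [uIcc_of_le haT] at ht; exact (ha.trans_le ht.1).ne'
  have hd : ∀ t ∈ uIcc a T, HasDerivAt (fun t : ℝ => -(C * δ) * t⁻¹) (C * δ / t ^ 2) t :=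
    fun t ht => by
      convert! (hasDerivAt_inv (hpos t ht)).const_mul (-(C * δ)) using 1
      field_simp
  have hi : IntervalIntegrable (fun t => C * δ / t ^ 2) volume a T :=
    ContinuousOn.intervalIntegrable (continuousOn_const.div (continuousOn_id.pow 2)
      fun t ht => pow_ne_zero 2 (hpos t ht))
  refine ⟨hi, ?_⟩
  rw [intervalIntegral.integral_eq_sub_of_hasDerivAt hd hi]
  have : 0 ≤ C * δ * T⁻¹ := by
    have := ha.trans_le haT
    positivity
  rw [div_eq_mul_inv]
  linarith

/-- A two-scale version of dominated convergence. The functions `f n` converge to `G` on `(0, T]`,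
but concentrate additional mass in a boundary layer of width `δ n`, where they converge to the
profile `φ` after rescaling. The tails `C δ / t²` are not dominated by a fixed integrable function,
but contribute at most `C / K` outside the layer `t < K δ`. -/
theorem tendsto_integral_two_scale {T : ℝ} (hT : 0 < T) {δ : ℕ → ℝ} (hδ : ∀ n, 0 < δ n)
    (hδ0 : Tendsto δ atTop (𝓝 0)) {f : ℕ → ℝ → ℝ} (hfm : ∀ n, Measurable (f n)) {C K₀ : ℝ}
    (hC : 0 ≤ C) (hb : ∀ n t, |f n t| ≤ C / δ n) {g : ℝ → ℝ}
    (hg : IntervalIntegrable g volume 0 T) (hg0 : ∀ t, 0 ≤ g t)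
    (hdom : ∀ᶠ n in atTop, ∀ t ∈ Ioc 0 T, K₀ * δ n ≤ t → |f n t| ≤ g t + C * δ n / t ^ 2)
    {G : ℝ → ℝ} (hG : ∀ᵐ t : ℝ, t ∈ Ioc 0 T → Tendsto (fun n => f n t) atTop (𝓝 (G t)))
    {φ : ℝ → ℝ} (hφ : ∀ᵐ τ : ℝ, 0 < τ →
      Tendsto (fun n => δ n * f n (δ n * τ)) atTop (𝓝 (φ τ)))
    {Φ : ℝ} (hΦ : Tendsto (fun K => ∫ τ in (0 : ℝ)..K, φ τ) atTop (𝓝 Φ)) :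
    Tendsto (fun n => ∫ t in (0 : ℝ)..T, f n t) atTop (𝓝 ((∫ t in (0 : ℝ)..T, G t) + Φ)) := by
  have hfi : ∀ n a b, IntervalIntegrable (f n) volume a b := fun n a b => by
    refine IntervalIntegrable.mono_fun (intervalIntegrable_const (c := C / δ n))
      (hfm n).aestronglyMeasurable (Eventually.of_forall fun t => ?_)
    exact (hb n t).trans (le_abs_self _)
  -- the truncation of `f n` to the range of `g`, outside the boundary layer
  set F : ℝ → ℕ → ℝ → ℝ := fun K n t =>
    if K * δ n ≤ t then max (-g t) (min (g t) (f n t)) else 0 with hF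
  have hFm : ∀ K n, AEStronglyMeasurable (F K n) (volume.restrict (uIoc 0 T)) := fun K n => by
    have h1 : AEStronglyMeasurable g (volume.restrict (uIoc 0 T)) := hg.def'.aestronglyMeasurable
    have h2 := (h1.neg).sup (h1.inf (hfm n).aestronglyMeasurable)
    exact (h2.indicator (s := Ici (K * δ n)) measurableSet_Ici).congr (ae_of_all _ fun t => by
      simp only [hF, indicator, mem_Ici]; rfl)
  have hFg : ∀ K n t, |F K n t| ≤ g t := fun K n t => by
    simp only [hF]
    split_ifs
    · exact abs_le.2 ⟨le_max_left _ _, max_le (by linarith [hg0 t]) (min_le_left _ _)⟩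
    · simpa using hg0 t
  have hFi : ∀ K n, IntervalIntegrable (F K n) volume 0 T := fun K n =>
    IntervalIntegrable.mono_fun hg (hFm K n) (Eventually.of_forall fun t =>
      (hFg K n t).trans (le_abs_self _))
  have hlay : ∀ K : ℝ, ∀ t : ℝ, 0 < t → ∀ᶠ n in atTop, K * δ n ≤ t := fun K t ht => by
    have := hδ0.const_mul K
    rw [mul_zero] at this
    exact this.eventually_le_const ht
  have hbulk : ∀ K, Tendsto (fun n => ∫ t in (0 : ℝ)..T, F K n t) atTop
      (𝓝 (∫ t in (0 : ℝ)..T, G t)) := fun K => by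
    refine intervalIntegral.tendsto_integral_filter_of_dominated_convergence g
      (Eventually.of_forall (hFm K)) (Eventually.of_forall fun n => ae_of_all _ fun t _ =>
        hFg K n t) hg ?_
    filter_upwards [hG] with t htG ht
    rw [uIoc_of_le hT.le] at ht
    have hGt := htG ht
    have hGg : |G t| ≤ g t := by
      have h1 : Tendsto (fun n => g t + C * δ n / t ^ 2) atTop (𝓝 (g t)) := by
        have := ((hδ0.const_mul C).div_const (t ^ 2)).const_add (g t)
        simpa using this
      refine le_of_tendsto_of_tendsto hGt.abs h1 ?_
      filter_upwards [hdom, hlay K₀ t ht.1] with n hn hn' using hn t ht hn'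
    have h2 : max (-g t) (min (g t) (G t)) = G t := by
      rw [abs_le] at hGg
      rw [min_eq_right hGg.2, max_eq_right hGg.1]
    have h3 := (tendsto_const_nhds (x := -g t)).max ((tendsto_const_nhds (x := g t)).min hGt)
    rw [h2] at h3
    refine h3.congr' ?_
    filter_upwards [hlay K t ht.1] with n hn
    simp [hF, hn]
  have hlayer : ∀ K, 0 < K → Tendsto (fun n => ∫ t in (0 : ℝ)..(K * δ n), f n t) atTop
      (𝓝 (∫ τ in (0 : ℝ)..K, φ τ)) := fun K hK => by
    have h1 : ∀ n, ∫ t in (0 : ℝ)..(K * δ n), f n t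
        = ∫ τ in (0 : ℝ)..K, δ n * f n (δ n * τ) := fun n => by
      rw [intervalIntegral.integral_const_mul, intervalIntegral.mul_integral_comp_mul_left,
        mul_zero, mul_comm K]
    simp only [h1]
    refine intervalIntegral.tendsto_integral_filter_of_dominated_convergence (fun _ => C)
      (Eventually.of_forall fun n => ((hfm n).comp (measurable_const_mul (δ n))
        |>.const_mul (δ n)).aestronglyMeasurable)
      (Eventually.of_forall fun n => ae_of_all _ fun τ _ => ?_) intervalIntegrable_const ?_
    · rw [Real.norm_eq_abs, abs_mul, abs_of_pos (hδ n)]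
      calc δ n * |f n (δ n * τ)| ≤ δ n * (C / δ n) := by
            gcongr
            · exact (hδ n).le
            · exact hb n _
        _ = C := by field_simp [(hδ n).ne']
    · filter_upwards [hφ] with τ h hτ
      rw [uIoc_of_le hK.le] at hτ
      exact h hτ.1
  have herr : ∀ K, 0 < K → K₀ ≤ K → ∀ᶠ n in atTop,
      |(∫ t in (0 : ℝ)..T, f n t) - ((∫ t in (0 : ℝ)..T, F K n t)
        + ∫ t in (0 : ℝ)..(K * δ n), f n t)| ≤ C / K := fun K hK hK₀ => by
    filter_upwards [hdom, hlay K T hT] with n hn hKT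
    have ha : 0 < K * δ n := mul_pos hK (hδ n)
    obtain ⟨hi, hle⟩ := integral_mul_inv_sq_le hC (hδ n) ha hKT
    have h1 := intervalIntegral.integral_add_adjacent_intervals (hfi n 0 (K * δ n))
      (hfi n (K * δ n) T)
    have hsub1 : uIcc 0 (K * δ n) ⊆ uIcc 0 T := by
      rw [uIcc_of_le ha.le, uIcc_of_le hT.le]; exact Icc_subset_Icc le_rfl hKT
    have hsub2 : uIcc (K * δ n) T ⊆ uIcc 0 T := by
      rw [uIcc_of_le hKT, uIcc_of_le hT.le]; exact Icc_subset_Icc ha.le le_rfl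
    have h2 := intervalIntegral.integral_add_adjacent_intervals ((hFi K n).mono_set hsub1)
      ((hFi K n).mono_set hsub2)
    have h3 : ∫ t in (0 : ℝ)..(K * δ n), F K n t = 0 := by
      rw [intervalIntegral.integral_of_le ha.le, integral_Ioc_eq_integral_Ioo]
      refine setIntegral_eq_zero_of_forall_eq_zero fun t ht => ?_
      simp [hF, not_le.2 ht.2]
    have h4 : (∫ t in (0 : ℝ)..T, f n t) - ((∫ t in (0 : ℝ)..T, F K n t)
        + ∫ t in (0 : ℝ)..(K * δ n), f n t) = ∫ t in (K * δ n)..T, (f n t - F K n t) := by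
      rw [intervalIntegral.integral_sub (hfi n _ _) ((hFi K n).mono_set hsub2), ← h1, ← h2, h3]
      ring
    rw [h4, ← Real.norm_eq_abs]
    refine (intervalIntegral.norm_integral_le_of_norm_le hKT (ae_of_all _ fun t ht => ?_) hi).trans
      (hle.trans (le_of_eq ?_))
    · have htT : t ∈ Ioc 0 T := ⟨ha.trans ht.1, ht.2⟩
      have h5 := hn t htT ((mul_le_mul_of_nonneg_right hK₀ (hδ n).le).trans ht.1.le)
      have h6 : 0 ≤ C * δ n / t ^ 2 := by have := (hδ n).le; positivity
      rw [abs_le] at h5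
      simp only [hF, if_pos ht.1.le, Real.norm_eq_abs]
      have h7 := hg0 t
      rw [abs_le]
      rcases le_total (g t) (f n t) with h8 | h8
      · rw [min_eq_left h8, max_eq_right (by linarith)]
        constructor <;> linarith
      · rw [min_eq_right h8]
        rcases le_total (-g t) (f n t) with h9 | h9
        · rw [max_eq_right h9]; constructor <;> linarith
        · rw [max_eq_left h9]; constructor <;> linarith
    · field_simp [(hδ n).ne']
  rw [Metric.tendsto_atTop]
  intro ε hε
  obtain ⟨K, hK1, hK2, hK3, hK4⟩ : ∃ K : ℝ, 0 < K ∧ K₀ ≤ K ∧ C / K < ε / 3 ∧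
      |(∫ τ in (0 : ℝ)..K, φ τ) - Φ| < ε / 3 := by
    have h1 : ∀ᶠ K : ℝ in atTop, C / K < ε / 3 :=
      (tendsto_const_nhds.div_atTop tendsto_id).eventually_lt_const (by positivity)
    have h2 : ∀ᶠ K : ℝ in atTop, |(∫ τ in (0 : ℝ)..K, φ τ) - Φ| < ε / 3 := by
      simpa [Real.dist_eq] using (Metric.tendsto_nhds.1 hΦ) (ε / 3) (by positivity)
    exact ((eventually_gt_atTop 0).and ((eventually_ge_atTop K₀).and (h1.and h2))).exists
  have h1 := (Metric.tendsto_nhds.1 ((hbulk K).add (hlayer K hK1))) (ε / 3) (by positivity)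
  have h2 := h1.and (herr K hK1 hK2)
  obtain ⟨N, hN⟩ := eventually_atTop.1 h2
  refine ⟨N, fun n hn => ?_⟩
  obtain ⟨h3, h4⟩ := hN n hn
  rw [Real.dist_eq, abs_lt] at *
  rw [abs_le] at h4
  constructor <;> linarith

/-! ### The tangent deficit of a perturbed segment -/

section Deficit

variable {E : Type*} [NormedAddCommGroup E] [InnerProductSpace ℝ E]

/-- The deficit `1 - cos θ`, where `θ` is the angle between `v` and the unit vector `e`. At `v = 0` the value is
`1`, in accordance with the convention `0⁻¹ • 0 = 0` in the closing integral. -/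
noncomputable def deficit (e v : E) : ℝ := 1 - inner ℝ e v / ‖v‖

theorem abs_inner_div_norm_le (f v : E) : |inner ℝ f v / ‖v‖| ≤ ‖f‖ := by
  rw [abs_div, abs_norm]
  exact div_le_of_le_mul₀ (norm_nonneg _) (norm_nonneg _) (abs_real_inner_le_norm f v)

theorem deficit_nonneg {e : E} (he : ‖e‖ = 1) (v : E) : 0 ≤ deficit e v := by
  have := abs_inner_div_norm_le e v
  rw [he, abs_le] at this
  rw [deficit]; linarith

theorem deficit_le_two {e : E} (he : ‖e‖ = 1) (v : E) : deficit e v ≤ 2 := by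
  have := abs_inner_div_norm_le e v
  rw [he, abs_le] at this
  rw [deficit]; linarith

theorem inner_div_norm_smul {c : ℝ} (hc : 0 < c) (f v : E) :
    inner ℝ f (c • v) / ‖c • v‖ = inner ℝ f v / ‖v‖ := by
  rw [inner_smul_right, norm_smul, Real.norm_of_nonneg hc.le, mul_div_mul_left _ _ hc.ne']

theorem deficit_eq {e v : E} (he : ‖e‖ = 1) (hv : 0 < inner ℝ e v) :
    deficit e v = (‖v‖ ^ 2 - inner ℝ e v ^ 2) / (‖v‖ * (‖v‖ + inner ℝ e v)) := by
  have h1 := real_inner_le_norm e v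
  rw [he, one_mul] at h1
  have h2 : 0 < ‖v‖ := hv.trans_le h1
  rw [deficit]
  field_simp
  ring

theorem inner_sq_le_norm_sq {e : E} (he : ‖e‖ = 1) (v : E) : inner ℝ e v ^ 2 ≤ ‖v‖ ^ 2 := by
  rw [sq_le_sq, abs_norm]
  simpa [he] using abs_real_inner_le_norm e v

theorem deficit_le {e v : E} (he : ‖e‖ = 1) {a : ℝ} (ha : 0 < a) (hv : a ≤ inner ℝ e v) :
    deficit e v ≤ (‖v‖ ^ 2 - inner ℝ e v ^ 2) / (2 * a ^ 2) := by
  have h0 : 0 < inner ℝ e v := ha.trans_le hv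
  have h1 := real_inner_le_norm e v
  rw [he, one_mul] at h1
  rw [deficit_eq he h0]
  have h2 := inner_sq_le_norm_sq he v
  refine div_le_div_of_nonneg_left (by linarith) (by positivity) ?_
  nlinarith

theorem linear_ne_zero_ae {γ : ℝ} (hγ : 0 < γ) {e : E} (he : ‖e‖ = 1) (z : E) :
    {τ : ℝ | (γ * τ) • e + z = 0}.Countable := by
  refine Set.Subsingleton.countable fun a ha b hb => ?_
  have h1 : (γ * a) • e = (γ * b) • e := add_right_cancel (ha.trans hb.symm)
  have h2 : e ≠ 0 := fun h => by simp [h] at he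
  exact mul_left_cancel₀ hγ.ne' (smul_left_injective ℝ h2 h1)

theorem tendsto_norm_linear_sub {γ : ℝ} (hγ : 0 < γ) {e : E} (he : ‖e‖ = 1) (z : E) :
    Tendsto (fun K : ℝ => ‖(γ * K) • e + z‖ - γ * K) atTop (𝓝 (inner ℝ e z)) := by
  set p := inner ℝ e z with hp
  have hee : inner ℝ e e = 1 := by rw [real_inner_self_eq_norm_sq, he]; norm_num
  have hin : ∀ K : ℝ, inner ℝ e ((γ * K) • e + z) = γ * K + p := fun K => by
    rw [inner_add_right, inner_smul_right, hee, mul_one]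
  have hsq : ∀ K : ℝ, ‖(γ * K) • e + z‖ ^ 2 = (γ * K + p) ^ 2 + (‖z‖ ^ 2 - p ^ 2) := fun K => by
    rw [norm_add_sq_real, norm_smul, he, inner_smul_left, mul_one, Real.norm_eq_abs, sq_abs,
      ← hp]
    simp only [conj_trivial]
    ring
  have hlin : Tendsto (fun K : ℝ => γ * K + p) atTop atTop :=
    tendsto_atTop_add_const_right _ _ (tendsto_id.const_mul_atTop hγ)
  have h1 : Tendsto (fun K : ℝ => p + (‖z‖ ^ 2 - p ^ 2) / (γ * K + p)) atTop (𝓝 p) := by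
    simpa using (tendsto_const_nhds (x := ‖z‖ ^ 2 - p ^ 2)).div_atTop hlin |>.const_add p
  refine tendsto_of_tendsto_of_tendsto_of_le_of_le' tendsto_const_nhds h1 ?_ ?_
  · refine Eventually.of_forall fun K => ?_
    have := real_inner_le_norm e ((γ * K) • e + z)
    rw [hin, he, one_mul] at this
    linarith
  · filter_upwards [hlin.eventually_gt_atTop 0] with K hK
    have h2 := inner_sq_le_norm_sq he z
    have h3 : 0 ≤ (‖z‖ ^ 2 - p ^ 2) / (γ * K + p) := div_nonneg (by linarith) hK.le
    have h4 : ‖(γ * K) • e + z‖ ≤ (γ * K + p) + (‖z‖ ^ 2 - p ^ 2) / (γ * K + p) := by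
      refine abs_le_of_sq_le_sq' ?_ (by positivity) |>.2
      rw [hsq]
      have h5 : (‖z‖ ^ 2 - p ^ 2) / (γ * K + p) * (γ * K + p) = ‖z‖ ^ 2 - p ^ 2 := by
        field_simp
      nlinarith
    linarith

/-- The deficit of the blown-up profile `τ ↦ γ τ e + z`: the integrand is, up to constants, the
derivative of the norm. -/
theorem tendsto_integral_deficit_linear {γ : ℝ} (hγ : 0 < γ) {e : E} (he : ‖e‖ = 1) (z : E) :
    Tendsto (fun K : ℝ => ∫ τ in (0 : ℝ)..K, deficit e ((γ * τ) • e + z)) atTop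
      (𝓝 ((‖z‖ - inner ℝ e z) / γ)) := by
  have hint : ∀ K : ℝ, 0 ≤ K → ∫ τ in (0 : ℝ)..K, deficit e ((γ * τ) • e + z)
      = (‖z‖ - (‖(γ * K) • e + z‖ - γ * K)) / γ := fun K hK => by
    have hcont : Continuous fun τ : ℝ => τ - ‖(γ * τ) • e + z‖ / γ := by fun_prop
    have hd : ∀ τ ∈ Ioo 0 K \ {τ : ℝ | (γ * τ) • e + z = 0},
        HasDerivAt (fun τ : ℝ => τ - ‖(γ * τ) • e + z‖ / γ) (deficit e ((γ * τ) • e + z)) τ := by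
      intro τ hτ
      have hne : ‖(γ * τ) • e + z‖ ^ 2 ≠ 0 := by
        have : (γ * τ) • e + z ≠ 0 := hτ.2
        positivity
      have h1 : HasDerivAt (fun τ : ℝ => (γ * τ) • e + z) (γ • e) τ := by
        have := ((hasDerivAt_id τ).const_mul γ).smul_const e |>.add_const z
        simpa using this
      have h2 := (h1.norm_sq).sqrt hne
      simp only [Real.sqrt_sq (norm_nonneg _)] at h2
      convert! (hasDerivAt_id τ).sub (h2.div_const γ) using 1
      rw [deficit, inner_smul_right, real_inner_comm]
      field_simp
    have hi : IntervalIntegrable (fun τ => deficit e ((γ * τ) • e + z)) volume 0 K := by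
      refine IntervalIntegrable.mono_fun (intervalIntegrable_const (c := (2 : ℝ))) ?_
        (Eventually.of_forall fun τ => ?_)
      · have m1 : Measurable fun τ : ℝ => inner ℝ e ((γ * τ) • e + z) :=
          (by fun_prop : Continuous fun τ : ℝ => inner ℝ e ((γ * τ) • e + z)).measurable
        have m2 : Measurable fun τ : ℝ => ‖(γ * τ) • e + z‖ :=
          (by fun_prop : Continuous fun τ : ℝ => ‖(γ * τ) • e + z‖).measurable
        exact ((m1.div m2).const_sub 1).aestronglyMeasurable
      · simp only [Real.norm_eq_abs]
        rw [abs_of_nonneg (deficit_nonneg he _)]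
        exact (deficit_le_two he _).trans (le_abs_self _)
    rw [integral_eq_of_hasDerivAt_off_countable_of_le _ _ hK (linear_ne_zero_ae hγ he z)
      hcont.continuousOn hd hi]
    simp
    field_simp
    ring
  have h1 := ((tendsto_norm_linear_sub hγ he z).const_sub ‖z‖).div_const γ
  refine h1.congr' ?_
  filter_upwards [eventually_ge_atTop 0] with K hK using (hint K hK).symm

theorem tendsto_inner_div_norm {ι : Type*} {l : Filter ι} {Y : ι → E} {y : E} (f : E)
    (h : Tendsto Y l (𝓝 y)) (hy : y ≠ 0) :
    Tendsto (fun i => inner ℝ f (Y i) / ‖Y i‖) l (𝓝 (inner ℝ f y / ‖y‖)) :=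
  ((tendsto_const_nhds (x := f)).inner h).div h.norm (norm_ne_zero_iff.2 hy)

/-- The limit of the integrated deficit of curves `Z n` that start in direction `e` with a boundary
layer of width `δ n`. -/
theorem tendsto_integral_deficit {T : ℝ} (hT : 0 < T) {δ : ℕ → ℝ} (hδ : ∀ n, 0 < δ n)
    (hδ0 : Tendsto δ atTop (𝓝 0)) {γ : ℝ} (hγ : 0 < γ) {e : E} (he : ‖e‖ = 1)
    {Z : ℕ → ℝ → E} (hZ : ∀ n, Continuous (Z n)) {z₀ : E}
    (hz₀ : ∀ τ, 0 < τ → Tendsto (fun n => (δ n)⁻¹ • Z n (δ n * τ)) atTop (𝓝 ((γ * τ) • e + z₀)))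
    {c K₀ C : ℝ} (hc : 0 < c) (hC : 0 ≤ C) {g : ℝ → ℝ}
    (hg : IntervalIntegrable g volume 0 T) (hg0 : ∀ t, 0 ≤ g t)
    (hdom : ∀ᶠ n in atTop, ∀ t ∈ Ioc 0 T, K₀ * δ n ≤ t → c * t ≤ inner ℝ e (Z n t) ∧
      ‖Z n t‖ ^ 2 - inner ℝ e (Z n t) ^ 2 ≤ δ n * (g t * t ^ 2) + C * δ n ^ 2)
    {G : ℝ → ℝ} (hG : ∀ t ∈ Ioc 0 T, Tendsto (fun n => deficit e (Z n t) / δ n) atTop (𝓝 (G t))) :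
    Tendsto (fun n => ∫ t in (0 : ℝ)..T, deficit e (Z n t) / δ n) atTop
      (𝓝 ((∫ t in (0 : ℝ)..T, G t) + (‖z₀‖ - inner ℝ e z₀) / γ)) := by
  have hm : ∀ n, Measurable fun t => deficit e (Z n t) / δ n := fun n => by
    have hZn := hZ n
    have m1 : Measurable fun t => inner ℝ e (Z n t) :=
      (by fun_prop : Continuous fun t => inner ℝ e (Z n t)).measurable
    exact ((m1.div hZn.norm.measurable).const_sub 1).div_const _
  refine tendsto_integral_two_scale hT hδ hδ0 hm (C := 2 + C / (2 * c ^ 2)) (K₀ := K₀)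
    (by positivity) (fun n t => ?_) (hg.div_const (2 * c ^ 2)) (fun t => by
      have := hg0 t; positivity) ?_ (ae_of_all _ hG) ?_ (tendsto_integral_deficit_linear hγ he z₀)
  · rw [abs_div, abs_of_pos (hδ n), abs_of_nonneg (deficit_nonneg he _)]
    have := deficit_le_two he (Z n t)
    have := (hδ n)
    gcongr
    have : 0 ≤ C / (2 * c ^ 2) := by positivity
    linarith
  · filter_upwards [hdom] with n hn t ht htK
    obtain ⟨h1, h2⟩ := hn t ht htK
    have ht0 := ht.1
    have hδn := hδ n
    rw [abs_div, abs_of_pos (hδ n), abs_of_nonneg (deficit_nonneg he _)]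
    have h3 := deficit_le he (mul_pos hc ht.1) h1
    rw [div_le_iff₀ (hδ n)]
    refine h3.trans ?_
    rw [div_le_iff₀ (by positivity)]
    refine h2.trans ?_
    have h4 : (g t / (2 * c ^ 2) + (2 + C / (2 * c ^ 2)) * δ n / t ^ 2) * δ n * (2 * (c * t) ^ 2)
        = δ n * (g t * t ^ 2) + C * δ n ^ 2 + 4 * c ^ 2 * δ n ^ 2 := by
      field_simp
      ring
    rw [h4]
    have : 0 ≤ 4 * c ^ 2 * δ n ^ 2 := by positivity
    linarith
  · have := (linear_ne_zero_ae hγ he z₀).ae_notMem volume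
    filter_upwards [this] with τ hτ hτ0
    have h1 := (tendsto_inner_div_norm e (hz₀ τ hτ0) hτ).const_sub 1
    refine h1.congr fun n => ?_
    rw [inner_div_norm_smul (inv_pos.2 (hδ n)), ← deficit, mul_div_cancel₀ _ (hδ n).ne']

end Deficit

/-! ### Perturbations of a half arc -/

section HalfArc

variable {E : Type*} [NormedAddCommGroup E] [InnerProductSpace ℝ E]

/-- The curves `Z n` are second order perturbations, on the interval `[0, π/2]`, of the half arc
`t ↦ γ sin t • e`, which leaves the origin with speed `γ` in direction `e`. The first order
perturbation `z₁` is assumed to have the regularity at `0` of an `H¹`-function. -/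
structure HalfExpansion (γ : ℝ) (e : E) (μ : ℕ → ℝ) (Z : ℕ → ℝ → E) (z₁ z₂ : ℝ → E) : Prop where
  cont : ∀ n, Continuous (Z n)
  cont₁ : Continuous z₁
  cont₂ : Continuous z₂
  holder : ∃ A : ℝ, 0 ≤ A ∧ ∀ t ∈ Icc 0 (Real.pi / 2), ‖z₁ t - z₁ 0‖ ≤ A * √t
  little : Tendsto (fun t => ‖z₁ t - z₁ 0‖ ^ 2 / t) (𝓝[>] 0) (𝓝 0)
  rem : ∃ ε : ℕ → ℝ, Tendsto ε atTop (𝓝 0) ∧ ∀ n, ∀ t ∈ Icc 0 (Real.pi / 2),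
    ‖Z n t - ((γ * Real.sin t) • e + μ n • z₁ t + μ n ^ 2 • z₂ t)‖ ≤ ε n * μ n ^ 2

/-- The squared norm of the component orthogonal to `e` ignores multiples of `e`. -/
theorem norm_sq_sub_inner_sq_add_smul {e : E} (he : ‖e‖ = 1) (s : ℝ) (v : E) :
    ‖v - s • e‖ ^ 2 - inner ℝ e (v - s • e) ^ 2 = ‖v‖ ^ 2 - inner ℝ e v ^ 2 := by
  have hee : inner ℝ e e = 1 := by rw [real_inner_self_eq_norm_sq, he]; norm_num
  rw [norm_sub_sq_real, inner_sub_right, inner_smul_right, inner_smul_right, norm_smul, he, hee,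
    mul_one, Real.norm_eq_abs, sq_abs, real_inner_comm]
  ring

theorem norm_sq_sub_inner_sq_le {e : E} (he : ‖e‖ = 1) (s : ℝ) (v : E) :
    ‖v‖ ^ 2 - inner ℝ e v ^ 2 ≤ ‖v - s • e‖ ^ 2 := by
  rw [← norm_sq_sub_inner_sq_add_smul he s v]
  linarith [sq_nonneg (inner ℝ e (v - s • e))]

theorem tendsto_inv_mul_sin {δ : ℕ → ℝ} (hδ : ∀ n, 0 < δ n) (hδ0 : Tendsto δ atTop (𝓝 0))
    (τ : ℝ) : Tendsto (fun n => (δ n)⁻¹ * Real.sin (δ n * τ)) atTop (𝓝 τ) := by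
  have h1 : HasDerivAt (fun x : ℝ => Real.sin (x * τ)) τ 0 := by
    have := (hasDerivAt_mul_const (x := (0 : ℝ)) τ).sin
    simpa using this
  have h2 := h1.tendsto_slope_zero
  simp only [zero_add, zero_mul, Real.sin_zero, sub_zero, smul_eq_mul] at h2
  exact h2.comp (tendsto_nhdsWithin_iff.2 ⟨hδ0, Eventually.of_forall fun n => (hδ n).ne'⟩)

theorem intervalIntegrable_inv_sqrt {T : ℝ} (hT : 0 ≤ T) :
    IntervalIntegrable (fun t => 1 / √t) volume 0 T := by
  have := intervalIntegral.intervalIntegrable_rpow' (a := 0) (b := T) (r := -(1 / 2 : ℝ))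
    (by norm_num)
  refine this.congr fun t ht => ?_
  rw [uIoc_of_le hT] at ht
  rw [Real.rpow_neg ht.1.le, Real.sqrt_eq_rpow, ← one_div]

theorem mul_inv_pi_le_mul_sin {γ : ℝ} (hγ : 0 ≤ γ) {t : ℝ} (ht : t ∈ Icc 0 (Real.pi / 2)) :
    2 * (γ / Real.pi * t) ≤ γ * Real.sin t := by
  have := mul_le_mul_of_nonneg_left (Real.mul_le_sin ht.1 ht.2) hγ
  calc 2 * (γ / Real.pi * t) = γ * (2 / Real.pi * t) := by ring
    _ ≤ _ := this

theorem le_inner_of_norm_sub_le {γ : ℝ} (hγ : 0 ≤ γ) {e : E} (he : ‖e‖ = 1) {t : ℝ}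
    (ht : t ∈ Icc 0 (Real.pi / 2)) {v : E}
    (hv : ‖v - (γ * Real.sin t) • e‖ ≤ γ / Real.pi * t) : γ / Real.pi * t ≤ inner ℝ e v := by
  have hee : inner ℝ e e = 1 := by rw [real_inner_self_eq_norm_sq, he]; norm_num
  have h1 := mul_inv_pi_le_mul_sin hγ ht
  have h2 := abs_real_inner_le_norm e (v - (γ * Real.sin t) • e)
  rw [inner_sub_right, inner_smul_right, hee, he, mul_one, one_mul, abs_le] at h2
  linarith [h2.1]

theorem le_norm_of_norm_sub_le {γ : ℝ} (hγ : 0 ≤ γ) {e : E} (he : ‖e‖ = 1) {t : ℝ}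
    (ht : t ∈ Icc 0 (Real.pi / 2)) {v : E}
    (hv : ‖v - (γ * Real.sin t) • e‖ ≤ γ / Real.pi * t) : γ / Real.pi * t ≤ ‖v‖ := by
  have := real_inner_le_norm e v
  rw [he, one_mul] at this
  exact (le_inner_of_norm_sub_le hγ he ht hv).trans this

theorem abs_inner_div_norm_sub_le (f : E) {v w : E} (hv : 0 < ‖v‖) :
    |inner ℝ f v / ‖v‖ - inner ℝ f w / ‖w‖| ≤ 2 * ‖f‖ * ‖v - w‖ / ‖v‖ := by
  have h1 : inner ℝ f v / ‖v‖ - inner ℝ f w / ‖w‖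
      = (inner ℝ f (v - w) + inner ℝ f w / ‖w‖ * (‖w‖ - ‖v‖)) / ‖v‖ := by
    rcases eq_or_ne w 0 with rfl | hw
    · simp
    · have : ‖w‖ ≠ 0 := norm_ne_zero_iff.2 hw
      rw [inner_sub_right]
      field_simp
      ring
  rw [h1, abs_div, abs_norm]
  gcongr
  have h2 := abs_real_inner_le_norm f (v - w)
  have h3 : |inner ℝ f w / ‖w‖ * (‖w‖ - ‖v‖)| ≤ ‖f‖ * ‖v - w‖ := by
    rw [abs_mul]
    gcongr
    · exact abs_inner_div_norm_le f w
    · rw [abs_sub_comm]; exact abs_norm_sub_norm_le v w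
  calc _ ≤ |inner ℝ f (v - w)| + |inner ℝ f w / ‖w‖ * (‖w‖ - ‖v‖)| := abs_add_le _ _
    _ ≤ _ := by linarith

namespace HalfExpansion

variable {γ : ℝ} {e : E} {μ : ℕ → ℝ} {Z Z' : ℕ → ℝ → E} {z₁ z₂ z₁' z₂' : ℝ → E}

/-- The first order expansion, uniformly up to the end of the arc. -/
theorem bound_two (H : HalfExpansion γ e μ Z z₁ z₂) : ∃ C : ℝ, 0 ≤ C ∧
    ∀ n, ∀ t ∈ Icc 0 (Real.pi / 2), ‖Z n t - (γ * Real.sin t) • e - μ n • z₁ t‖ ≤ C * μ n ^ 2 := by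
  obtain ⟨ε, hε, hrem⟩ := H.rem
  obtain ⟨B, hB⟩ := hε.bddAbove_range
  obtain ⟨B', hB'⟩ := (isCompact_Icc (a := (0 : ℝ)) (b := Real.pi / 2)).exists_bound_of_continuousOn
    H.cont₂.continuousOn
  refine ⟨|B| + |B'|, by positivity, fun n t ht => ?_⟩
  have h1 : ε n ≤ |B| := (hB (mem_range_self n)).trans (le_abs_self B)
  have h2 : ‖z₂ t‖ ≤ |B'| := (hB' t ht).trans (le_abs_self B')
  have h3 := hrem n t ht
  calc ‖Z n t - (γ * Real.sin t) • e - μ n • z₁ t‖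
      = ‖(Z n t - ((γ * Real.sin t) • e + μ n • z₁ t + μ n ^ 2 • z₂ t)) + μ n ^ 2 • z₂ t‖ := by
        congr 1; abel
    _ ≤ ε n * μ n ^ 2 + μ n ^ 2 * ‖z₂ t‖ := by
        refine (norm_add_le _ _).trans (add_le_add h3 (le_of_eq ?_))
        rw [norm_smul, Real.norm_of_nonneg (sq_nonneg _)]
    _ ≤ |B| * μ n ^ 2 + μ n ^ 2 * |B'| := by gcongr
    _ = _ := by ring

/-- The constants of the uniform estimates, together with the first order expansion with `z₁` frozen
at the end of the arc. -/
theorem bound_holder (H : HalfExpansion γ e μ Z z₁ z₂) (hμ : ∀ n, 0 < μ n) :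
    ∃ A C : ℝ, 0 ≤ A ∧ 0 ≤ C ∧
      (∀ t ∈ Icc 0 (Real.pi / 2), ‖z₁ t - z₁ 0‖ ≤ A * √t) ∧
      (∀ n, ∀ t ∈ Icc 0 (Real.pi / 2),
        ‖Z n t - (γ * Real.sin t) • e - μ n • z₁ t‖ ≤ C * μ n ^ 2) ∧
      ∀ n, ∀ t ∈ Icc 0 (Real.pi / 2),
        ‖Z n t - (γ * Real.sin t) • e - μ n • z₁ 0‖ ≤ A * √t * μ n + C * μ n ^ 2 := by
  obtain ⟨A, hA, hAt⟩ := H.holder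
  obtain ⟨C, hC, hCt⟩ := H.bound_two
  refine ⟨A, C, hA, hC, hAt, hCt, fun n t ht => ?_⟩
  calc _ = ‖μ n • (z₁ t - z₁ 0) + (Z n t - (γ * Real.sin t) • e - μ n • z₁ t)‖ := by
        congr 1; rw [smul_sub]; abel
    _ ≤ μ n * (A * √t) + C * μ n ^ 2 := by
        refine (norm_add_le _ _).trans (add_le_add ?_ (hCt n t ht))
        rw [norm_smul, Real.norm_of_nonneg (hμ n).le]
        exact mul_le_mul_of_nonneg_left (hAt t ht) (hμ n).le
    _ = _ := by ring

theorem bound_one (H : HalfExpansion γ e μ Z z₁ z₂) (hμ : ∀ n, 0 < μ n)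
    (hμ0 : Tendsto μ atTop (𝓝 0)) : ∃ C : ℝ, 0 ≤ C ∧
    ∀ n, ∀ t ∈ Icc 0 (Real.pi / 2), ‖Z n t - (γ * Real.sin t) • e‖ ≤ C * μ n := by
  obtain ⟨C, hC, hCt⟩ := H.bound_two
  obtain ⟨B, hB⟩ := hμ0.bddAbove_range
  obtain ⟨B', hB'⟩ := (isCompact_Icc (a := (0 : ℝ)) (b := Real.pi / 2)).exists_bound_of_continuousOn
    H.cont₁.continuousOn
  refine ⟨C * |B| + |B'|, by positivity, fun n t ht => ?_⟩
  have h1 : μ n ≤ |B| := (hB (mem_range_self n)).trans (le_abs_self B)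
  have h2 : ‖z₁ t‖ ≤ |B'| := (hB' t ht).trans (le_abs_self B')
  have h0 := (hμ n).le
  calc ‖Z n t - (γ * Real.sin t) • e‖
      = ‖(Z n t - (γ * Real.sin t) • e - μ n • z₁ t) + μ n • z₁ t‖ := by congr 1; abel
    _ ≤ C * μ n ^ 2 + μ n * ‖z₁ t‖ := by
        refine (norm_add_le _ _).trans (add_le_add (hCt n t ht) (le_of_eq ?_))
        rw [norm_smul, Real.norm_of_nonneg h0]
    _ ≤ C * (|B| * μ n) + μ n * |B'| := by
        rw [sq]; gcongr
    _ = _ := by ring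

/-- Outside a boundary layer of width `O(μ)` the curves are close to the half arc. -/
theorem far_one (H : HalfExpansion γ e μ Z z₁ z₂) (hγ : 0 < γ) (hμ : ∀ n, 0 < μ n)
    (hμ0 : Tendsto μ atTop (𝓝 0)) : ∃ K : ℝ, 0 < K ∧ ∀ n, ∀ t ∈ Icc 0 (Real.pi / 2), K * μ n ≤ t →
      ‖Z n t - (γ * Real.sin t) • e‖ ≤ γ / Real.pi * t := by
  obtain ⟨C, hC, hCt⟩ := H.bound_one hμ hμ0
  have hc : 0 < γ / Real.pi := div_pos hγ Real.pi_pos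
  refine ⟨C / (γ / Real.pi) + 1, by positivity, fun n t ht htK => (hCt n t ht).trans ?_⟩
  have h1 : γ / Real.pi * ((C / (γ / Real.pi) + 1) * μ n) = C * μ n + γ / Real.pi * μ n := by
    field_simp
  have h2 := mul_le_mul_of_nonneg_left htK hc.le
  rw [h1] at h2
  have : 0 < γ / Real.pi * μ n := mul_pos hc (hμ n)
  linarith

/-- If the first order perturbation vanishes at `0`, the boundary layer has width `O(μ²)`. -/
theorem far_two (H : HalfExpansion γ e μ Z z₁ z₂) (hγ : 0 < γ) (hμ : ∀ n, 0 < μ n)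
    (h0 : z₁ 0 = 0) : ∃ R : ℝ, 0 < R ∧ ∀ n, ∀ t ∈ Icc 0 (Real.pi / 2), R * μ n ≤ √t →
      ‖Z n t - (γ * Real.sin t) • e‖ ≤ γ / Real.pi * t := by
  obtain ⟨A, C, hA, hC, -, -, hbd⟩ := H.bound_holder hμ
  have hc : 0 < γ / Real.pi := div_pos hγ Real.pi_pos
  set c := γ / Real.pi
  refine ⟨A / c + C / c + 1, by positivity, fun n t ht htR => ?_⟩
  have h1 := hbd n t ht
  rw [h0, smul_zero, sub_zero] at h1
  refine h1.trans ?_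
  have hm := hμ n
  have hs := Real.sqrt_nonneg t
  have hst : √t * √t = t := Real.mul_self_sqrt ht.1
  set s := √t
  have h2 : c * ((A / c + C / c + 1) * μ n) = (A + C + c) * μ n := by field_simp
  have h3 := mul_le_mul_of_nonneg_left htR hc.le
  rw [h2] at h3
  have h4 : μ n ≤ s := by
    refine le_trans ?_ htR
    have : 0 ≤ (A / c + C / c) * μ n := by positivity
    linarith
  have h5 : (A + C + c) * μ n * s ≤ c * s * s := mul_le_mul_of_nonneg_right h3 hs
  have h6 : C * μ n * μ n ≤ C * μ n * s := mul_le_mul_of_nonneg_left h4 (by positivity)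
  have h7 : 0 ≤ c * μ n * s := by positivity
  have h8 : c * t = c * s * s := by rw [mul_assoc, hst]
  rw [h8]
  linarith

theorem tendsto_scaled (H : HalfExpansion γ e μ Z z₁ z₂) (hμ : ∀ n, 0 < μ n)
    (hμ0 : Tendsto μ atTop (𝓝 0)) {t : ℝ} (ht : t ∈ Icc 0 (Real.pi / 2)) :
    Tendsto (fun n => (μ n)⁻¹ • (Z n t - (γ * Real.sin t) • e)) atTop (𝓝 (z₁ t)) := by
  obtain ⟨C, hC, hCt⟩ := H.bound_two
  rw [tendsto_iff_norm_sub_tendsto_zero]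
  have h1 : Tendsto (fun n => C * μ n) atTop (𝓝 0) := by simpa using hμ0.const_mul C
  refine squeeze_zero (fun n => norm_nonneg _) (fun n => ?_) h1
  have hm := hμ n
  have : (μ n)⁻¹ • (Z n t - (γ * Real.sin t) • e) - z₁ t
      = (μ n)⁻¹ • (Z n t - (γ * Real.sin t) • e - μ n • z₁ t) := by
    rw [smul_sub _ _ (μ n • z₁ t), smul_smul, inv_mul_cancel₀ hm.ne', one_smul]
  rw [this, norm_smul, Real.norm_of_nonneg (inv_nonneg.2 hm.le)]
  calc (μ n)⁻¹ * _ ≤ (μ n)⁻¹ * (C * μ n ^ 2) :=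
        mul_le_mul_of_nonneg_left (hCt n t ht) (inv_nonneg.2 hm.le)
    _ = C * μ n := by field_simp

theorem tendsto_pointwise (H : HalfExpansion γ e μ Z z₁ z₂) (hμ : ∀ n, 0 < μ n)
    (hμ0 : Tendsto μ atTop (𝓝 0)) {t : ℝ} (ht : t ∈ Icc 0 (Real.pi / 2)) :
    Tendsto (fun n => Z n t) atTop (𝓝 ((γ * Real.sin t) • e)) := by
  have h1 := (hμ0.smul (H.tendsto_scaled hμ hμ0 ht)).add_const ((γ * Real.sin t) • e)
  rw [zero_smul, zero_add] at h1
  refine h1.congr fun n => ?_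
  rw [smul_smul, mul_inv_cancel₀ (hμ n).ne', one_smul, sub_add_cancel]

theorem mem_Ioc_pi_div_two {t : ℝ} (ht : t ∈ Ioc 0 (Real.pi / 2)) :
    t ∈ Icc 0 (Real.pi / 2) ∧ 0 < Real.sin t :=
  ⟨⟨ht.1.le, ht.2⟩, Real.sin_pos_of_pos_of_lt_pi ht.1 (by linarith [ht.2, Real.pi_pos])⟩

theorem eventually_mul_mem {δ : ℕ → ℝ} (hδ : ∀ n, 0 < δ n) (hδ0 : Tendsto δ atTop (𝓝 0)) {τ : ℝ}
    (hτ : 0 < τ) : ∀ᶠ n in atTop, δ n * τ ∈ Icc 0 (Real.pi / 2) := by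
  have h1 := hδ0.mul_const τ
  rw [zero_mul] at h1
  filter_upwards [h1.eventually_le_const (by positivity : 0 < Real.pi / 2)] with n hn
  exact ⟨(mul_pos (hδ n) hτ).le, hn⟩

/-- In the boundary layer of width `μ` the curves look like the line `τ ↦ γ τ e + z₁(0)`. -/
theorem tendsto_blowup_one (H : HalfExpansion γ e μ Z z₁ z₂) (hμ : ∀ n, 0 < μ n)
    (hμ0 : Tendsto μ atTop (𝓝 0)) {τ : ℝ} (hτ : 0 < τ) :
    Tendsto (fun n => (μ n)⁻¹ • Z n (μ n * τ)) atTop (𝓝 ((γ * τ) • e + z₁ 0)) := by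
  obtain ⟨C, hC, hCt⟩ := H.bound_two
  have hz : Tendsto (fun n => z₁ (μ n * τ)) atTop (𝓝 (z₁ 0)) := by
    have := hμ0.mul_const τ
    rw [zero_mul] at this
    exact (H.cont₁.tendsto 0).comp this
  have h1 := (((tendsto_inv_mul_sin hμ hμ0 τ).const_mul γ).smul_const e).add hz
  refine tendsto_of_tendsto_of_dist h1 ?_
  have h2 : Tendsto (fun n => C * μ n) atTop (𝓝 0) := by simpa using hμ0.const_mul C
  refine squeeze_zero' (Eventually.of_forall fun n => dist_nonneg) ?_ h2
  filter_upwards [eventually_mul_mem hμ hμ0 hτ] with n hn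
  have hm := hμ n
  rw [dist_comm, dist_eq_norm]
  have : (μ n)⁻¹ • Z n (μ n * τ) - ((γ * ((μ n)⁻¹ * Real.sin (μ n * τ))) • e + z₁ (μ n * τ))
      = (μ n)⁻¹ • (Z n (μ n * τ) - (γ * Real.sin (μ n * τ)) • e - μ n • z₁ (μ n * τ)) := by
    rw [smul_sub, smul_sub, smul_smul, smul_smul, inv_mul_cancel₀ hm.ne', one_smul,
      show γ * ((μ n)⁻¹ * Real.sin (μ n * τ)) = (μ n)⁻¹ * (γ * Real.sin (μ n * τ)) by ring]
    abel
  rw [this, norm_smul, Real.norm_of_nonneg (inv_nonneg.2 hm.le)]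
  calc (μ n)⁻¹ * _ ≤ (μ n)⁻¹ * (C * μ n ^ 2) :=
        mul_le_mul_of_nonneg_left (hCt n _ hn) (inv_nonneg.2 hm.le)
    _ = C * μ n := by field_simp

theorem tendsto_sq_zero (hμ0 : Tendsto μ atTop (𝓝 0)) : Tendsto (fun n => μ n ^ 2) atTop (𝓝 0) := by
  simpa using hμ0.pow 2

/-- If `z₁(0) = 0`, the curves look like the line `τ ↦ γ τ e + z₂(0)` in the boundary layer of width
`μ²`. -/
theorem tendsto_blowup_two (H : HalfExpansion γ e μ Z z₁ z₂) (hμ : ∀ n, 0 < μ n)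
    (hμ0 : Tendsto μ atTop (𝓝 0)) (h0 : z₁ 0 = 0) {τ : ℝ} (hτ : 0 < τ) :
    Tendsto (fun n => (μ n ^ 2)⁻¹ • Z n (μ n ^ 2 * τ)) atTop (𝓝 ((γ * τ) • e + z₂ 0)) := by
  obtain ⟨ε, hε, hrem⟩ := H.rem
  have hμ2 : ∀ n, 0 < μ n ^ 2 := fun n => pow_pos (hμ n) 2
  have hμ20 := tendsto_sq_zero hμ0
  have ht0 : Tendsto (fun n => μ n ^ 2 * τ) atTop (𝓝 0) := by simpa using hμ20.mul_const τ
  have hz2 : Tendsto (fun n => z₂ (μ n ^ 2 * τ)) atTop (𝓝 (z₂ 0)) := (H.cont₂.tendsto 0).comp ht0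
  -- here `z₁ = o(√t)` is needed, as the layer has width `μ²`
  have hz1 : Tendsto (fun n => (μ n)⁻¹ • z₁ (μ n ^ 2 * τ)) atTop (𝓝 0) := by
    have h1 := (H.little.comp (tendsto_nhdsWithin_iff.2
      ⟨ht0, Eventually.of_forall fun n => mul_pos (hμ2 n) hτ⟩)).mul_const τ
    rw [zero_mul] at h1
    have h2 := (Real.continuous_sqrt.tendsto _).comp h1
    rw [Real.sqrt_zero] at h2
    refine tendsto_zero_iff_norm_tendsto_zero.2 (h2.congr fun n => ?_)
    have hm := hμ n
    simp only [Function.comp, h0, sub_zero]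
    rw [norm_smul, Real.norm_of_nonneg (inv_nonneg.2 hm.le),
      show ‖z₁ (μ n ^ 2 * τ)‖ ^ 2 / (μ n ^ 2 * τ) * τ = ((μ n)⁻¹ * ‖z₁ (μ n ^ 2 * τ)‖) ^ 2 by
        field_simp]
    exact Real.sqrt_sq (by positivity)
  have h1 := ((((tendsto_inv_mul_sin hμ2 hμ20 τ).const_mul γ).smul_const e).add hz1).add hz2
  rw [add_zero] at h1
  refine tendsto_of_tendsto_of_dist h1 ?_
  refine squeeze_zero' (Eventually.of_forall fun n => dist_nonneg) ?_ hε
  filter_upwards [eventually_mul_mem hμ2 hμ20 hτ] with n hn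
  have hm := hμ n
  have hm2 := hμ2 n
  rw [dist_comm, dist_eq_norm]
  have : (μ n ^ 2)⁻¹ • Z n (μ n ^ 2 * τ) - ((γ * ((μ n ^ 2)⁻¹ * Real.sin (μ n ^ 2 * τ))) • e
      + (μ n)⁻¹ • z₁ (μ n ^ 2 * τ) + z₂ (μ n ^ 2 * τ))
      = (μ n ^ 2)⁻¹ • (Z n (μ n ^ 2 * τ) - ((γ * Real.sin (μ n ^ 2 * τ)) • e
        + μ n • z₁ (μ n ^ 2 * τ) + μ n ^ 2 • z₂ (μ n ^ 2 * τ))) := by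
    rw [smul_sub, smul_add, smul_add, smul_smul, smul_smul, smul_smul, inv_mul_cancel₀ hm2.ne',
      one_smul, show γ * ((μ n ^ 2)⁻¹ * Real.sin (μ n ^ 2 * τ))
        = (μ n ^ 2)⁻¹ * (γ * Real.sin (μ n ^ 2 * τ)) by ring,
      show (μ n ^ 2)⁻¹ * μ n = (μ n)⁻¹ by field_simp]
  rw [this, norm_smul, Real.norm_of_nonneg (inv_nonneg.2 hm2.le)]
  calc (μ n ^ 2)⁻¹ * _ ≤ (μ n ^ 2)⁻¹ * (ε n * μ n ^ 2) :=
        mul_le_mul_of_nonneg_left (hrem n _ hn) (inv_nonneg.2 hm2.le)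
    _ = ε n := by field_simp

/-- In the interior of the arc, the deficit is of second order. -/
theorem tendsto_deficit_div_sq (H : HalfExpansion γ e μ Z z₁ z₂) (hγ : 0 < γ) (he : ‖e‖ = 1)
    (hμ : ∀ n, 0 < μ n) (hμ0 : Tendsto μ atTop (𝓝 0)) {t : ℝ} (ht : t ∈ Ioc 0 (Real.pi / 2)) :
    Tendsto (fun n => deficit e (Z n t) / μ n ^ 2) atTop
      (𝓝 ((‖z₁ t‖ ^ 2 - inner ℝ e (z₁ t) ^ 2) / (2 * (γ * Real.sin t) ^ 2))) := by
  obtain ⟨htI, hs⟩ := mem_Ioc_pi_div_two ht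
  have hee : inner ℝ e e = 1 := by rw [real_inner_self_eq_norm_sq, he]; norm_num
  have ha : 0 < γ * Real.sin t := mul_pos hγ hs
  have h1 := H.tendsto_scaled hμ hμ0 htI
  have h2 := H.tendsto_pointwise hμ hμ0 htI
  have h3 : Tendsto (fun n => ‖Z n t‖) atTop (𝓝 (γ * Real.sin t)) := by
    have := h2.norm
    rwa [norm_smul, he, mul_one, Real.norm_of_nonneg ha.le] at this
  have h4 : Tendsto (fun n => inner ℝ e (Z n t)) atTop (𝓝 (γ * Real.sin t)) := by
    have := (tendsto_const_nhds (x := e)).inner (𝕜 := ℝ) h2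
    rwa [inner_smul_right, hee, mul_one] at this
  have h5 := ((h1.norm.pow 2).sub (((tendsto_const_nhds (x := e)).inner (𝕜 := ℝ) h1).pow 2)).div
    (h3.mul (h3.add h4)) (by positivity)
  rw [show γ * Real.sin t * (γ * Real.sin t + γ * Real.sin t) = 2 * (γ * Real.sin t) ^ 2 by
    ring] at h5
  refine h5.congr' ?_
  filter_upwards [h4.eventually_const_lt ha] with n hn
  have hm := hμ n
  simp only [Pi.div_apply]
  rw [deficit_eq he hn, ← norm_sq_sub_inner_sq_add_smul he (γ * Real.sin t) (Z n t), norm_smul,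
    inner_smul_right, Real.norm_of_nonneg (inv_nonneg.2 hm.le)]
  field_simp

/-- The integrated deficit to first order; it stems from the boundary layer only. -/
theorem tendsto_integral_deficit_div (H : HalfExpansion γ e μ Z z₁ z₂) (hγ : 0 < γ) (he : ‖e‖ = 1)
    (hμ : ∀ n, 0 < μ n) (hμ0 : Tendsto μ atTop (𝓝 0)) :
    Tendsto (fun n => ∫ t in (0 : ℝ)..(Real.pi / 2), deficit e (Z n t) / μ n) atTop
      (𝓝 ((‖z₁ 0‖ - inner ℝ e (z₁ 0)) / γ)) := by
  obtain ⟨K, hK, hfar⟩ := H.far_one hγ hμ hμ0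
  obtain ⟨C, hC, hCt⟩ := H.bound_one hμ hμ0
  have := tendsto_integral_deficit (T := Real.pi / 2) (by positivity) hμ hμ0 hγ he H.cont
    (fun τ hτ => H.tendsto_blowup_one hμ hμ0 hτ) (c := γ / Real.pi) (K₀ := K) (C := C ^ 2)
    (div_pos hγ Real.pi_pos) (by positivity) (g := fun _ => 0) intervalIntegrable_const
    (fun _ => le_rfl) (Eventually.of_forall fun n t ht htK => ?_) (G := fun _ => 0)
    (fun t ht => ?_)
  · simpa using this
  · have htI : t ∈ Icc 0 (Real.pi / 2) := ⟨ht.1.le, ht.2⟩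
    refine ⟨le_inner_of_norm_sub_le hγ.le he htI (hfar n t htI htK), ?_⟩
    refine (norm_sq_sub_inner_sq_le he (γ * Real.sin t) _).trans ?_
    rw [zero_mul, mul_zero, zero_add, ← mul_pow]
    exact pow_le_pow_left₀ (norm_nonneg _) (hCt n t htI) 2
  · have h1 := (H.tendsto_deficit_div_sq hγ he hμ hμ0 ht).mul hμ0
    rw [mul_zero] at h1
    refine h1.congr fun n => ?_
    have hm := hμ n
    field_simp

/-- The integrated deficit to second order, if the first order perturbation vanishes at `0`. Now the
boundary layer, of width `μ²`, and the interior contribute to the same order. -/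
theorem tendsto_integral_deficit_div_sq (H : HalfExpansion γ e μ Z z₁ z₂) (hγ : 0 < γ)
    (he : ‖e‖ = 1) (hμ : ∀ n, 0 < μ n) (hμ0 : Tendsto μ atTop (𝓝 0)) (h0 : z₁ 0 = 0)
    (hH : IntervalIntegrable (fun t => ‖z₁ t‖ ^ 2 / t ^ 2) volume 0 (Real.pi / 2)) :
    Tendsto (fun n => ∫ t in (0 : ℝ)..(Real.pi / 2), deficit e (Z n t) / μ n ^ 2) atTop
      (𝓝 ((∫ t in (0 : ℝ)..(Real.pi / 2),
          (‖z₁ t‖ ^ 2 - inner ℝ e (z₁ t) ^ 2) / (2 * (γ * Real.sin t) ^ 2))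
        + (‖z₂ 0‖ - inner ℝ e (z₂ 0)) / γ)) := by
  obtain ⟨R, hR, hfar⟩ := H.far_two hγ hμ h0
  obtain ⟨C, hC, hCt⟩ := H.bound_two
  refine tendsto_integral_deficit (T := Real.pi / 2) (by positivity) (fun n => pow_pos (hμ n) 2)
    (tendsto_sq_zero hμ0) hγ he H.cont
    (fun τ hτ => H.tendsto_blowup_two hμ hμ0 h0 hτ) (c := γ / Real.pi) (K₀ := R ^ 2)
    (C := 2 * C ^ 2) (div_pos hγ Real.pi_pos) (by positivity)
    (g := fun t => 2 * (‖z₁ t‖ ^ 2 / t ^ 2)) (hH.const_mul 2)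
    (fun _ => by positivity) (Eventually.of_forall fun n t ht htK => ?_)
    (fun t ht => H.tendsto_deficit_div_sq hγ he hμ hμ0 ht)
  have htI : t ∈ Icc 0 (Real.pi / 2) := ⟨ht.1.le, ht.2⟩
  have hm := hμ n
  have hR' : R * μ n ≤ √t := Real.le_sqrt_of_sq_le (by rw [mul_pow]; exact htK)
  refine ⟨le_inner_of_norm_sub_le hγ.le he htI (hfar n t htI hR'), ?_⟩
  refine (norm_sq_sub_inner_sq_le he (γ * Real.sin t) _).trans ?_
  have ht0 := ht.1
  have h1 : ‖Z n t - (γ * Real.sin t) • e‖ ≤ μ n * ‖z₁ t‖ + C * μ n ^ 2 := by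
    calc _ = ‖μ n • z₁ t + (Z n t - (γ * Real.sin t) • e - μ n • z₁ t)‖ := by congr 1; abel
      _ ≤ _ := by
        refine (norm_add_le _ _).trans (add_le_add (le_of_eq ?_) (hCt n t htI))
        rw [norm_smul, Real.norm_of_nonneg hm.le]
  calc _ ≤ (μ n * ‖z₁ t‖ + C * μ n ^ 2) ^ 2 := pow_le_pow_left₀ (norm_nonneg _) h1 2
    _ ≤ 2 * (μ n * ‖z₁ t‖) ^ 2 + 2 * (C * μ n ^ 2) ^ 2 := by
        nlinarith [sq_nonneg (μ n * ‖z₁ t‖ - C * μ n ^ 2)]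
    _ = _ := by field_simp

theorem tendsto_inner_div_norm_div (H : HalfExpansion γ e μ Z z₁ z₂) (hγ : 0 < γ) (he : ‖e‖ = 1)
    (hμ : ∀ n, 0 < μ n) (hμ0 : Tendsto μ atTop (𝓝 0)) {f : E} (hf : inner ℝ f e = 0) {t : ℝ}
    (ht : t ∈ Ioc 0 (Real.pi / 2)) :
    Tendsto (fun n => inner ℝ f (Z n t) / ‖Z n t‖ / μ n) atTop
      (𝓝 (inner ℝ f (z₁ t) / (γ * Real.sin t))) := by
  obtain ⟨htI, hs⟩ := mem_Ioc_pi_div_two ht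
  have ha : 0 < γ * Real.sin t := mul_pos hγ hs
  have h1 := (tendsto_const_nhds (x := f)).inner (𝕜 := ℝ) (H.tendsto_scaled hμ hμ0 htI)
  have h3 : Tendsto (fun n => ‖Z n t‖) atTop (𝓝 (γ * Real.sin t)) := by
    have := (H.tendsto_pointwise hμ hμ0 htI).norm
    rwa [norm_smul, he, mul_one, Real.norm_of_nonneg ha.le] at this
  refine (h1.div h3 ha.ne').congr fun n => ?_
  simp only [Pi.div_apply]
  rw [inner_smul_right, inner_sub_right, inner_smul_right, hf]
  ring

theorem measurable_inner_div (H : HalfExpansion γ e μ Z z₁ z₂) (f : E) (n : ℕ) :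
    Measurable fun t => inner ℝ f (Z n t) / ‖Z n t‖ := by
  have hZn := H.cont n
  exact (by fun_prop : Continuous fun t => inner ℝ f (Z n t)).measurable.div hZn.norm.measurable

/-- The transversal components of the closing integral, if the first order perturbation vanishes at
the end of the arc. The boundary layer is negligible. -/
theorem tendsto_integral_inner (H : HalfExpansion γ e μ Z z₁ z₂) (hγ : 0 < γ) (he : ‖e‖ = 1)
    (hμ : ∀ n, 0 < μ n) (hμ0 : Tendsto μ atTop (𝓝 0)) (h0 : z₁ 0 = 0) {f : E}
    (hf : inner ℝ f e = 0) :
    Tendsto (fun n => ∫ t in (0 : ℝ)..(Real.pi / 2), inner ℝ f (Z n t) / ‖Z n t‖ / μ n) atTop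
      (𝓝 (∫ t in (0 : ℝ)..(Real.pi / 2), inner ℝ f (z₁ t) / (γ * Real.sin t))) := by
  obtain ⟨R, hR, hfar⟩ := H.far_two hγ hμ h0
  obtain ⟨A, C, hA, hC, -, -, hbd⟩ := H.bound_holder hμ
  have hc : 0 < γ / Real.pi := div_pos hγ Real.pi_pos
  set c := γ / Real.pi with hcdef
  have hpi2 : (0 : ℝ) ≤ Real.pi / 2 := by positivity
  refine intervalIntegral.tendsto_integral_filter_of_dominated_convergence
    (fun t => (‖f‖ * ((A + C / R) / c) + ‖f‖ * R) * (1 / √t))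
    (Eventually.of_forall fun n => ((H.measurable_inner_div f n).div_const _).aestronglyMeasurable)
    (Eventually.of_forall fun n => ae_of_all _ fun t ht => ?_)
    ((intervalIntegrable_inv_sqrt hpi2).const_mul _)
    (ae_of_all _ fun t ht => ?_)
  -- the integrand is dominated by a multiple of `1 / √t`: outside the layer `√t < R μ` by the Hölder
  -- estimate, and inside it because `1 / μ` is at most `R / √t`
  · rw [uIoc_of_le hpi2] at ht
    have htI : t ∈ Icc 0 (Real.pi / 2) := ⟨ht.1.le, ht.2⟩
    have hm := hμ n
    have hs : 0 < √t := Real.sqrt_pos.2 ht.1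
    have hst : √t * √t = t := Real.mul_self_sqrt ht.1.le
    have h1 : 0 ≤ ‖f‖ * ((A + C / R) / c) * (1 / √t) := by positivity
    have h2 : 0 ≤ ‖f‖ * R * (1 / √t) := by positivity
    rw [Real.norm_eq_abs, add_mul]
    rcases le_total (R * μ n) (√t) with hRt | hRt
    · refine le_trans ?_ (le_add_of_nonneg_right h2)
      have h3 := le_norm_of_norm_sub_le hγ.le he htI (hfar n t htI hRt)
      have h4 := hbd n t htI
      rw [h0, smul_zero, sub_zero] at h4
      have h5 : |inner ℝ f (Z n t)| ≤ ‖f‖ * (A * √t * μ n + C * μ n ^ 2) := by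
        have h6 : inner ℝ f (Z n t) = inner ℝ f (Z n t - (γ * Real.sin t) • e) := by
          rw [inner_sub_right, inner_smul_right, hf]; ring
        rw [h6]
        exact (abs_real_inner_le_norm _ _).trans (mul_le_mul_of_nonneg_left h4 (norm_nonneg _))
      have h7 : 0 < c * t := mul_pos hc ht.1
      have h8 : μ n ≤ √t / R := by rw [le_div_iff₀ hR]; linarith
      rw [abs_div, abs_div, abs_norm, abs_of_pos hm, div_le_iff₀ hm]
      calc |inner ℝ f (Z n t)| / ‖Z n t‖ ≤ ‖f‖ * (A * √t * μ n + C * μ n ^ 2) / (c * t) := by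
            gcongr
        _ ≤ ‖f‖ * (A * √t * μ n + C * (√t / R * μ n)) / (c * t) := by
            rw [sq]; gcongr
        _ = ‖f‖ * ((A + C / R) / c) * (1 / √t) * μ n := by
            rw [show c * t = c * (√t * √t) by rw [hst]]; field_simp
    · refine le_trans ?_ (le_add_of_nonneg_left h1)
      rw [abs_div, abs_of_pos hm, div_le_iff₀ hm]
      refine (abs_inner_div_norm_le f _).trans ?_
      calc ‖f‖ = ‖f‖ * (√t * (1 / √t)) := by field_simp
        _ ≤ ‖f‖ * (R * μ n * (1 / √t)) := by gcongr
        _ = _ := by ring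
  · rw [uIoc_of_le hpi2] at ht
    exact H.tendsto_inner_div_norm_div hγ he hμ hμ0 hf ht

theorem abs_sin_sub_le_sq {t : ℝ} (ht : 0 ≤ t) : |Real.sin t - t| ≤ t ^ 2 := by
  have h1 := Real.sin_le ht
  rw [abs_sub_comm, abs_of_nonneg (by linarith)]
  rcases eq_or_lt_of_le ht with rfl | h0
  · simp
  rcases le_total t 1 with h | h
  · have := Real.sin_gt_sub_cube h0
    nlinarith [pow_pos h0 2]
  · nlinarith [Real.neg_one_le_sin t, Real.sin_nonneg_of_nonneg_of_le_pi ht, sq_nonneg (t - 1),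
      Real.neg_one_le_sin t, Real.sin_gt_sub_cube h0]

/-- If the first order perturbation does not vanish at the end of the arc, its transversal part causes
a logarithmic divergence in the transversal components of the closing integral. -/
theorem exists_abs_integral_inner_sub_log_le (H : HalfExpansion γ e μ Z z₁ z₂) (hγ : 0 < γ)
    (he : ‖e‖ = 1) (hμ : ∀ n, 0 < μ n) (hμ0 : Tendsto μ atTop (𝓝 0)) {f : E}
    (hf : inner ℝ f e = 0) : ∃ B : ℝ, ∀ᶠ n in atTop,
    |(∫ t in (0 : ℝ)..(Real.pi / 2), inner ℝ f (Z n t) / ‖Z n t‖ / μ n)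
      - inner ℝ f (z₁ 0) / γ * Real.log (1 / μ n)| ≤ B := by
  obtain ⟨K, hK, hfar⟩ := H.far_one hγ hμ hμ0
  obtain ⟨A, C, hA, hC, -, -, hbd⟩ := H.bound_holder hμ
  obtain ⟨C₁, hC₁, hbd₁⟩ := H.bound_one hμ hμ0
  have hc : 0 < γ / Real.pi := div_pos hγ Real.pi_pos
  set c := γ / Real.pi with hcdef
  set q := inner ℝ f (z₁ 0) with hq
  have hpi2 : (0 : ℝ) < Real.pi / 2 := by positivity
  -- Outside the layer `t < K μ`, whose contribution is bounded, the integrand differs from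
  -- `(q / γ) t⁻¹` by at most `D₁ + D₂ / √t + D₃ μ / t²`, which has a bounded integral there.
  set D₁ := ‖f‖ * C / (c * K) + |q| / c with hD₁
  set D₂ := ‖f‖ * A / c with hD₂
  set D₃ := |q| * C₁ / (γ * c) with hD₃
  have hD₃0 : 0 ≤ D₃ := by positivity
  set I := ∫ t in (0 : ℝ)..(Real.pi / 2), (D₁ + D₂ * (1 / √t)) with hI
  have iI : IntervalIntegrable (fun t => D₁ + D₂ * (1 / √t)) volume 0 (Real.pi / 2) :=
    intervalIntegrable_const.add ((intervalIntegrable_inv_sqrt hpi2.le).const_mul _)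
  refine ⟨‖f‖ * K + (I + D₃ / K) + |q / γ * (Real.log (Real.pi / 2) - Real.log K)|, ?_⟩
  have hlay : ∀ᶠ n in atTop, K * μ n ≤ Real.pi / 2 := by
    have := hμ0.const_mul K
    rw [mul_zero] at this
    exact this.eventually_le_const hpi2
  filter_upwards [hlay] with n hn
  have hm := hμ n
  have ha : 0 < K * μ n := mul_pos hK hm
  set F : ℝ → ℝ := fun t => inner ℝ f (Z n t) / ‖Z n t‖ / μ n with hF
  have hFb : ∀ t, |F t| ≤ ‖f‖ / μ n := fun t => by
    simp only [hF]
    rw [abs_div _ (μ n), abs_of_pos hm]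
    gcongr
    exact abs_inner_div_norm_le f _
  have hFi : ∀ a b, IntervalIntegrable F volume a b := fun a b => by
    refine IntervalIntegrable.mono_fun (intervalIntegrable_const (c := ‖f‖ / μ n))
      ((H.measurable_inner_div f n).div_const _).aestronglyMeasurable
      (Eventually.of_forall fun t => ?_)
    exact (hFb t).trans (le_abs_self _)
  have h1 : |∫ t in (0 : ℝ)..(K * μ n), F t| ≤ ‖f‖ * K := by
    have := intervalIntegral.norm_integral_le_of_norm_le_const (a := 0) (b := K * μ n) (f := F)
      (C := ‖f‖ / μ n) fun t _ => hFb t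
    rw [Real.norm_eq_abs, sub_zero, abs_of_pos ha] at this
    refine this.trans (le_of_eq ?_)
    field_simp
  have hpos : ∀ t ∈ uIcc (K * μ n) (Real.pi / 2), t ≠ 0 := fun t ht => by
    rw [uIcc_of_le hn] at ht; exact (ha.trans_le ht.1).ne'
  have hqi : IntervalIntegrable (fun t => q / γ * t⁻¹) volume (K * μ n) (Real.pi / 2) :=
    ContinuousOn.intervalIntegrable (continuousOn_const.mul (continuousOn_id.inv₀ hpos))
  have h2 : ∫ t in (K * μ n)..(Real.pi / 2), q / γ * t⁻¹
      = q / γ * Real.log (1 / μ n) + q / γ * (Real.log (Real.pi / 2) - Real.log K) := by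
    rw [intervalIntegral.integral_const_mul, integral_inv_of_pos ha hpi2,
      Real.log_div hpi2.ne' ha.ne', Real.log_mul hK.ne' hm.ne', one_div, Real.log_inv]
    ring
  have hsub : uIcc (K * μ n) (Real.pi / 2) ⊆ uIcc 0 (Real.pi / 2) := by
    rw [uIcc_of_le hn, uIcc_of_le hpi2.le]; exact Icc_subset_Icc ha.le le_rfl
  obtain ⟨i3, hle3⟩ := integral_mul_inv_sq_le hD₃0 hm ha hn
  have h3 : |∫ t in (K * μ n)..(Real.pi / 2), (F t - q / γ * t⁻¹)| ≤ I + D₃ / K := by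
    rw [← Real.norm_eq_abs]
    refine (intervalIntegral.norm_integral_le_of_norm_le hn (ae_of_all _ fun t ht => ?_)
      ((iI.mono_set hsub).add i3)).trans ?_
    · have ht0 : 0 < t := ha.trans ht.1
      have htI : t ∈ Icc 0 (Real.pi / 2) := ⟨ht0.le, ht.2⟩
      have h4 := le_norm_of_norm_sub_le hγ.le he htI (hfar n t htI ht.1.le)
      have h7 : 0 < c * t := mul_pos hc ht0
      have hZ : 0 < ‖Z n t‖ := h7.trans_le h4
      have hs : 0 < √t := Real.sqrt_pos.2 ht0
      have hst : √t * √t = t := Real.mul_self_sqrt ht0.le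
      have h8 : μ n ≤ t / K := by rw [le_div_iff₀ hK]; linarith [ht.1]
      have h5 : |inner ℝ f (Z n t) - μ n * q| ≤ ‖f‖ * (A * √t * μ n + C * μ n ^ 2) := by
        have h6 : inner ℝ f (Z n t) - μ n * q
            = inner ℝ f (Z n t - (γ * Real.sin t) • e - μ n • z₁ 0) := by
          rw [inner_sub_right, inner_sub_right, inner_smul_right, inner_smul_right, hf]; ring
        rw [h6]
        exact (abs_real_inner_le_norm _ _).trans
          (mul_le_mul_of_nonneg_left (hbd n t htI) (norm_nonneg _))
      have h6 : |γ * t - ‖Z n t‖| ≤ C₁ * μ n + γ * t ^ 2 := by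
        have e1 : ‖(γ * t) • e‖ = γ * t := by
          rw [norm_smul, he, mul_one, Real.norm_of_nonneg (by positivity)]
        have e2 := abs_norm_sub_norm_le (Z n t) ((γ * t) • e)
        rw [e1, abs_sub_comm] at e2
        refine e2.trans ?_
        have e3 : Z n t - (γ * t) • e
            = (Z n t - (γ * Real.sin t) • e) + (γ * (Real.sin t - t)) • e := by
          rw [mul_sub, sub_smul]; abel
        rw [e3]
        refine (norm_add_le _ _).trans (add_le_add (hbd₁ n t htI) ?_)
        rw [norm_smul, he, mul_one, Real.norm_eq_abs, abs_mul, abs_of_pos hγ]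
        exact mul_le_mul_of_nonneg_left (abs_sin_sub_le_sq ht0.le) hγ.le
      have e4 : F t - q / γ * t⁻¹ = (inner ℝ f (Z n t) - μ n * q) / (μ n * ‖Z n t‖)
          + q * (γ * t - ‖Z n t‖) / (γ * t * ‖Z n t‖) := by
        simp only [hF]
        field_simp
        ring
      have e5 : |(inner ℝ f (Z n t) - μ n * q) / (μ n * ‖Z n t‖)|
          ≤ ‖f‖ * C / (c * K) + D₂ * (1 / √t) := by
        rw [abs_div, abs_of_pos (mul_pos hm hZ)]
        calc _ ≤ ‖f‖ * (A * √t * μ n + C * μ n ^ 2) / (μ n * (c * t)) := by gcongr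
          _ = ‖f‖ * A * √t / (c * t) + ‖f‖ * C * μ n / (c * t) := by field_simp
          _ ≤ ‖f‖ * A * √t / (c * t) + ‖f‖ * C * (t / K) / (c * t) := by gcongr
          _ = ‖f‖ * A * √t / (c * (√t * √t)) + ‖f‖ * C * (t / K) / (c * t) := by rw [hst]
          _ = _ := by
              simp only [hD₂]
              field_simp
              ring
      have e6 : |q * (γ * t - ‖Z n t‖) / (γ * t * ‖Z n t‖)| ≤ |q| / c + D₃ * μ n / t ^ 2 := by
        rw [abs_div, abs_mul, abs_of_pos (by positivity : 0 < γ * t * ‖Z n t‖)]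
        calc _ ≤ |q| * (C₁ * μ n + γ * t ^ 2) / (γ * t * (c * t)) := by gcongr
          _ = _ := by
              simp only [hD₃]
              field_simp
              ring
      rw [Real.norm_eq_abs, e4]
      refine (abs_add_le _ _).trans ?_
      simp only [hD₁]
      linarith
    · rw [intervalIntegral.integral_add (iI.mono_set hsub) i3]
      refine add_le_add ?_ (hle3.trans (le_of_eq (by field_simp)))
      have hsub' : uIcc 0 (K * μ n) ⊆ uIcc 0 (Real.pi / 2) := by
        rw [uIcc_of_le ha.le, uIcc_of_le hpi2.le]; exact Icc_subset_Icc le_rfl hn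
      rw [hI, ← intervalIntegral.integral_add_adjacent_intervals (iI.mono_set hsub')
        (iI.mono_set hsub)]
      refine le_add_of_nonneg_left (intervalIntegral.integral_nonneg ha.le fun t _ => ?_)
      positivity
  rw [intervalIntegral.integral_sub (hFi _ _) hqi, h2] at h3
  have h9 := intervalIntegral.integral_add_adjacent_intervals (hFi 0 (K * μ n))
    (hFi (K * μ n) (Real.pi / 2))
  have e7 : (∫ t in (0 : ℝ)..(Real.pi / 2), F t) - q / γ * Real.log (1 / μ n)
      = (∫ t in (0 : ℝ)..(K * μ n), F t) + ((∫ t in (K * μ n)..(Real.pi / 2), F t)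
        - (q / γ * Real.log (1 / μ n) + q / γ * (Real.log (Real.pi / 2) - Real.log K)))
        + q / γ * (Real.log (Real.pi / 2) - Real.log K) := by
    rw [← h9]; ring
  rw [e7]
  exact (abs_add_le _ _).trans (add_le_add ((abs_add_le _ _).trans (add_le_add h1 h3)) le_rfl)

/-- For two perturbations of the same half arc with the same first order perturbation at the end of
the arc, the logarithmic contributions cancel. In the boundary layer both curves have the same
profile, so the layer contributes nothing to the limit. -/
theorem tendsto_integral_inner_sub (H : HalfExpansion γ e μ Z z₁ z₂)
    (H' : HalfExpansion γ e μ Z' z₁' z₂') (hγ : 0 < γ) (he : ‖e‖ = 1)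
    (hμ : ∀ n, 0 < μ n) (hμ0 : Tendsto μ atTop (𝓝 0)) (h0 : z₁ 0 = z₁' 0) {f : E}
    (hf : inner ℝ f e = 0) :
    Tendsto (fun n => ∫ t in (0 : ℝ)..(Real.pi / 2),
        (inner ℝ f (Z n t) / ‖Z n t‖ - inner ℝ f (Z' n t) / ‖Z' n t‖) / μ n) atTop
      (𝓝 (∫ t in (0 : ℝ)..(Real.pi / 2), inner ℝ f (z₁ t - z₁' t) / (γ * Real.sin t))) := by
  obtain ⟨K, hK, hfar⟩ := H.far_one hγ hμ hμ0
  obtain ⟨A, C, hA, hC, -, -, hbd⟩ := H.bound_holder hμ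
  obtain ⟨A', C', hA', hC', -, -, hbd'⟩ := H'.bound_holder hμ
  have hc : 0 < γ / Real.pi := div_pos hγ Real.pi_pos
  set c := γ / Real.pi with hcdef
  have hpi2 : (0 : ℝ) < Real.pi / 2 := by positivity
  set D₁ := 2 * ‖f‖ * (A + A') / c with hD₁
  set D₂ := 2 * ‖f‖ * (C + C') / (c * K) with hD₂
  have key := tendsto_integral_two_scale (T := Real.pi / 2) hpi2 hμ hμ0
    (f := fun n t => (inner ℝ f (Z n t) / ‖Z n t‖ - inner ℝ f (Z' n t) / ‖Z' n t‖) / μ n)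
    (fun n => ((H.measurable_inner_div f n).sub (H'.measurable_inner_div f n)).div_const _)
    (C := 2 * ‖f‖) (K₀ := K) (by positivity) (fun n t => ?_) (g := fun t => D₁ * (1 / √t) + D₂)
    (((intervalIntegrable_inv_sqrt hpi2.le).const_mul _).add intervalIntegrable_const)
    (fun t => by positivity) (Eventually.of_forall fun n t ht htK => ?_)
    (G := fun t => inner ℝ f (z₁ t - z₁' t) / (γ * Real.sin t)) (ae_of_all _ fun t ht => ?_)
    (φ := fun _ => 0) ?_ (Φ := 0) (by simp)
  · simpa using key
  · rw [abs_div, abs_of_pos (hμ n)]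
    have := (hμ n)
    gcongr
    have h1 := abs_inner_div_norm_le f (Z n t)
    have h2 := abs_inner_div_norm_le f (Z' n t)
    rw [abs_le] at *
    constructor <;> linarith
  · have hm := hμ n
    have htI : t ∈ Icc 0 (Real.pi / 2) := ⟨ht.1.le, ht.2⟩
    have h4 := le_norm_of_norm_sub_le hγ.le he htI (hfar n t htI htK)
    have ht0 := ht.1
    have h7 : 0 < c * t := mul_pos hc ht.1
    have hZ : 0 < ‖Z n t‖ := h7.trans_le h4
    have hs : 0 < √t := Real.sqrt_pos.2 ht.1
    have hst : √t * √t = t := Real.mul_self_sqrt ht.1.le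
    have h8 : μ n ≤ t / K := by rw [le_div_iff₀ hK]; linarith
    have h5 : ‖Z n t - Z' n t‖ ≤ (A + A') * √t * μ n + (C + C') * μ n ^ 2 := by
      have e1 : Z n t - Z' n t = (Z n t - (γ * Real.sin t) • e - μ n • z₁ 0)
          - (Z' n t - (γ * Real.sin t) • e - μ n • z₁' 0) := by rw [h0]; abel
      rw [e1]
      refine (norm_sub_le _ _).trans ((add_le_add (hbd n t htI) (hbd' n t htI)).trans
        (le_of_eq (by ring)))
    refine le_trans ?_ (le_add_of_nonneg_right (by positivity))
    rw [abs_div, abs_of_pos hm, div_le_iff₀ hm]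
    refine (abs_inner_div_norm_sub_le f hZ).trans ?_
    calc 2 * ‖f‖ * ‖Z n t - Z' n t‖ / ‖Z n t‖
        ≤ 2 * ‖f‖ * ((A + A') * √t * μ n + (C + C') * μ n ^ 2) / (c * t) := by gcongr
      _ = (2 * ‖f‖ * (A + A') * √t / (c * t) + 2 * ‖f‖ * (C + C') * μ n / (c * t)) * μ n := by
          field_simp
      _ ≤ (2 * ‖f‖ * (A + A') * √t / (c * t) + 2 * ‖f‖ * (C + C') * (t / K) / (c * t)) * μ n := by
          gcongr
      _ = (2 * ‖f‖ * (A + A') * √t / (c * (√t * √t))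
            + 2 * ‖f‖ * (C + C') * (t / K) / (c * t)) * μ n := by rw [hst]
      _ = _ := by
          simp only [hD₁, hD₂]
          field_simp
  · have h1 := (H.tendsto_inner_div_norm_div hγ he hμ hμ0 hf ht).sub
      (H'.tendsto_inner_div_norm_div hγ he hμ hμ0 hf ht)
    rw [← sub_div, ← inner_sub_right] at h1
    refine h1.congr fun n => ?_
    rw [sub_div]
  · have := (linear_ne_zero_ae hγ he (z₁ 0)).ae_notMem volume
    filter_upwards [this] with τ hτ hτ0
    have h1 := H'.tendsto_blowup_one hμ hμ0 hτ0
    rw [← h0] at h1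
    have h2 := (tendsto_inner_div_norm f (H.tendsto_blowup_one hμ hμ0 hτ0) hτ).sub
      (tendsto_inner_div_norm f h1 hτ)
    rw [sub_self] at h2
    refine h2.congr fun n => ?_
    have hm := hμ n
    rw [inner_div_norm_smul (inv_pos.2 hm), inner_div_norm_smul (inv_pos.2 hm)]
    field_simp

end HalfExpansion

end HalfArc

/-! ### Sobolev embedding and the expansion of the functional -/

section Sobolev

variable {E : Type*} [NormedAddCommGroup E] [NormedSpace ℝ E]

/-- The Sobolev embedding `H¹ ⊂ C⁰` over one period. -/
theorem HasL2Density.norm_sq_le [CompleteSpace E] {u g : ℝ → E} (H : HasL2Density u g) {s : ℝ}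
    (hs : s ∈ Icc 0 (2 * Real.pi)) :
    ‖u s‖ ^ 2 ≤ 16 * ∫ t in (0 : ℝ)..(2 * Real.pi), (‖u t‖ ^ 2 + ‖g t‖ ^ 2) := by
  have hpi := Real.pi_gt_three
  have hpi4 := Real.pi_le_four
  have h2pi : (0 : ℝ) ≤ 2 * Real.pi := by positivity
  have iu : ∀ a b, IntervalIntegrable (fun t => ‖u t‖ ^ 2) volume a b := fun a b =>
    (H.continuous.norm.pow 2).intervalIntegrable a b
  set G := ∫ t in (0 : ℝ)..(2 * Real.pi), ‖g t‖ ^ 2 with hG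
  have hG0 : 0 ≤ G := intervalIntegral.integral_nonneg h2pi fun t _ => by positivity
  have hmono : ∀ a b : ℝ, 0 ≤ a → a ≤ b → b ≤ 2 * Real.pi → ∫ t in a..b, ‖g t‖ ^ 2 ≤ G :=
    fun a b ha hab hb => intervalIntegral.integral_mono_interval ha hab hb
      (ae_of_all _ fun t => by positivity) (H.sq _ _)
  have hdiff : ∀ t ∈ Icc 0 (2 * Real.pi), ‖u s - u t‖ ^ 2 ≤ 2 * Real.pi * G := fun t ht => by
    rcases le_total t s with h | h
    · refine (H.norm_sub_sq_le h).trans ?_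
      have := hmono t s ht.1 h hs.2
      have h0 : 0 ≤ ∫ r in t..s, ‖g r‖ ^ 2 :=
        intervalIntegral.integral_nonneg h fun t _ => by positivity
      have h1 : s - t ≤ 2 * Real.pi := by linarith [hs.2, ht.1]
      exact mul_le_mul h1 this h0 h2pi
    · rw [norm_sub_rev]
      refine (H.norm_sub_sq_le h).trans ?_
      have := hmono s t hs.1 h ht.2
      have h0 : 0 ≤ ∫ r in s..t, ‖g r‖ ^ 2 :=
        intervalIntegral.integral_nonneg h fun t _ => by positivity
      have h1 : t - s ≤ 2 * Real.pi := by linarith [hs.1, ht.2]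
      exact mul_le_mul h1 this h0 h2pi
  have hpt : ∀ t ∈ Icc 0 (2 * Real.pi), ‖u s‖ ^ 2 ≤ 2 * ‖u t‖ ^ 2 + 4 * Real.pi * G := fun t ht => by
    have h1 : ‖u s‖ ≤ ‖u t‖ + ‖u s - u t‖ := by
      calc ‖u s‖ = ‖u t + (u s - u t)‖ := by congr 1; abel
        _ ≤ _ := norm_add_le _ _
    have h2 := hdiff t ht
    have h3 := norm_nonneg (u s)
    nlinarith [sq_nonneg (‖u t‖ - ‖u s - u t‖)]
  have h1 := intervalIntegral.integral_mono_on h2pi (intervalIntegrable_const (μ := volume))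
    (((iu _ _).const_mul 2).add intervalIntegrable_const) hpt
  rw [intervalIntegral.integral_add ((iu _ _).const_mul 2) intervalIntegrable_const,
    intervalIntegral.integral_const_mul, intervalIntegral.integral_const,
    intervalIntegral.integral_const, smul_eq_mul, smul_eq_mul, sub_zero] at h1
  rw [intervalIntegral.integral_add (iu _ _) (H.sq _ _), ← hG]
  set U := ∫ t in (0 : ℝ)..(2 * Real.pi), ‖u t‖ ^ 2
  have hU0 : 0 ≤ U := intervalIntegral.integral_nonneg h2pi fun t _ => by positivity
  have h4 : 2 * Real.pi * ‖u s‖ ^ 2 ≤ 2 * Real.pi * (16 * (U + G)) := by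
    refine h1.trans ?_
    nlinarith [mul_nonneg (sub_nonneg.2 hpi4) hG0, mul_nonneg Real.pi_pos.le hG0,
      mul_nonneg Real.pi_pos.le (mul_nonneg (sub_nonneg.2 hpi4) hG0), mul_nonneg (by linarith :
        0 ≤ Real.pi - 3) hU0]
  exact le_of_mul_le_mul_left h4 (by positivity)

theorem h1Norm_nonneg (u : ℝ → E3) : 0 ≤ h1Norm u := Real.sqrt_nonneg _

theorem HasL2Density.h1Norm_sq {u g : ℝ → E3} (H : HasL2Density u g) :
    h1Norm u ^ 2 = ∫ t in (0 : ℝ)..(2 * Real.pi), (‖u t‖ ^ 2 + ‖g t‖ ^ 2) := by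
  rw [h1Norm, Real.sq_sqrt]
  · refine intervalIntegral.integral_congr_ae ?_
    filter_upwards [H.deriv_ae] with t ht _
    rw [ht]
  · exact intervalIntegral.integral_nonneg (by positivity) fun t _ => by positivity

theorem HasL2Density.norm_le_h1Norm {u g : ℝ → E3} (H : HasL2Density u g)
    (hp : Function.Periodic u (2 * Real.pi)) (s : ℝ) : ‖u s‖ ≤ 4 * h1Norm u := by
  obtain ⟨t, ht, hst⟩ := hp.exists_mem_Ico₀ (by positivity) s
  rw [hst]
  have h1 := H.norm_sq_le (Ico_subset_Icc_self ht)
  rw [← H.h1Norm_sq] at h1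
  refine abs_le_of_sq_le_sq' ?_ (mul_nonneg (by norm_num) (h1Norm_nonneg u)) |>.2
  rw [mul_pow]
  linarith

end Sobolev

/-- The second order expansion of the squared norm in a Hilbert space. -/
theorem isLittleO_norm_sq_expansion {H : Type*} [NormedAddCommGroup H] [InnerProductSpace ℝ H]
    {l : Filter ℝ} (hl : l ≤ 𝓝 0) {v ρ : ℝ → H} {v₀ v₁ v₂ : H}
    (hv : ∀ᶠ μ in l, v μ = v₀ + μ • v₁ + μ ^ 2 • v₂ + ρ μ)
    (hρ : (fun μ => ‖ρ μ‖) =o[l] fun μ : ℝ => μ ^ 2) :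
    (fun μ => ‖v μ‖ ^ 2 - (‖v₀‖ ^ 2 + μ * (2 * inner ℝ v₀ v₁)
      + μ ^ 2 * (2 * inner ℝ v₀ v₂ + ‖v₁‖ ^ 2))) =o[l] fun μ : ℝ => μ ^ 2 := by
  have hid : Tendsto (fun μ : ℝ => μ) l (𝓝 0) := hl
  have hsmall : Tendsto (fun μ : ℝ => μ * (2 * inner ℝ v₁ v₂) + μ ^ 2 * ‖v₂‖ ^ 2) l (𝓝 0) := by
    simpa using (hid.mul_const (2 * inner ℝ v₁ v₂)).add ((hid.pow 2).mul_const (‖v₂‖ ^ 2))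
  have hρ0 : Tendsto (fun μ => ‖ρ μ‖) l (𝓝 0) := by
    have : Tendsto (fun μ : ℝ => μ ^ 2) l (𝓝 0) := by simpa using hid.pow 2
    exact hρ.trans_tendsto this
  have hp : Tendsto (fun μ : ℝ => v₀ + μ • v₁ + μ ^ 2 • v₂) l (𝓝 v₀) := by
    simpa using ((hid.smul_const v₁).const_add v₀).add ((hid.pow 2).smul_const v₂)
  have t1 : (fun μ : ℝ => (μ * (2 * inner ℝ v₁ v₂) + μ ^ 2 * ‖v₂‖ ^ 2) * μ ^ 2) =o[l]
      fun μ : ℝ => μ ^ 2 := by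
    simpa using ((isLittleO_one_iff ℝ).2 hsmall).mul_isBigO (isBigO_refl (fun μ : ℝ => μ ^ 2) l)
  have t2 : (fun μ : ℝ => ‖ρ μ‖ * ‖ρ μ‖) =o[l] fun μ : ℝ => μ ^ 2 := by
    simpa using ((isLittleO_one_iff ℝ).2 hρ0).mul hρ
  have t3 : (fun μ : ℝ => inner ℝ (v₀ + μ • v₁ + μ ^ 2 • v₂) (ρ μ)) =o[l] fun μ : ℝ => μ ^ 2 := by
    have h1 : (fun μ : ℝ => inner ℝ (v₀ + μ • v₁ + μ ^ 2 • v₂) (ρ μ)) =O[l]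
        fun μ => ‖v₀ + μ • v₁ + μ ^ 2 • v₂‖ * ‖ρ μ‖ :=
      IsBigO.of_bound 1 (Eventually.of_forall fun μ => by
        rw [one_mul, norm_mul, norm_norm, norm_norm]
        exact abs_real_inner_le_norm _ _)
    have h2 : (fun μ : ℝ => ‖v₀ + μ • v₁ + μ ^ 2 • v₂‖ * ‖ρ μ‖) =o[l]
        fun μ : ℝ => (1 : ℝ) * μ ^ 2 := (hp.norm.isBigO_one ℝ).mul_isLittleO hρ
    simpa using h1.trans_isLittleO h2
  refine ((t1.add t2).add (t3.const_mul_left 2)).congr' ?_ EventuallyEq.rfl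
  filter_upwards [hv] with μ hμ
  rw [hμ, norm_add_sq_real, norm_add_sq_real (v₀ + μ • v₁), norm_add_sq_real v₀]
  simp only [norm_smul, inner_add_left, inner_smul_left, inner_smul_right, conj_trivial,
    Real.norm_eq_abs, mul_pow, sq_abs, abs_pow]
  ring

/-- The bilinear form of the functional, for curves given with their densities. -/
noncomputable def bilinearForm (u g v h : ℝ → E3) : ℝ :=
  ∫ s in (0 : ℝ)..(2 * Real.pi), (inner ℝ (g s) (h s) - inner ℝ (u s) (v s))

section Functional

variable {u g v h : ℝ → E3}

theorem HasL2Density.memLp (H : HasL2Density u g) :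
    MemLp g 2 (volume.restrict (Ioc 0 (2 * Real.pi))) := by
  rw [memLp_two_iff_integrable_sq_norm H.meas.aestronglyMeasurable]
  exact (intervalIntegrable_iff_integrableOn_Ioc_of_le (by positivity)).1 (H.sq 0 (2 * Real.pi))

theorem memLp_of_continuous (hu : Continuous u) :
    MemLp u 2 (volume.restrict (Ioc 0 (2 * Real.pi))) := by
  rw [memLp_two_iff_integrable_sq_norm hu.aestronglyMeasurable]
  exact (intervalIntegrable_iff_integrableOn_Ioc_of_le (by positivity)).1
    ((hu.norm.pow 2).intervalIntegrable 0 (2 * Real.pi))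

theorem inner_toLp {f k : ℝ → E3} (hf : MemLp f 2 (volume.restrict (Ioc 0 (2 * Real.pi))))
    (hk : MemLp k 2 (volume.restrict (Ioc 0 (2 * Real.pi)))) :
    inner ℝ (hf.toLp f) (hk.toLp k) = ∫ s in (0 : ℝ)..(2 * Real.pi), inner ℝ (f s) (k s) := by
  rw [L2.inner_def, intervalIntegral.integral_of_le (by positivity)]
  refine integral_congr_ae ?_
  filter_upwards [hf.coeFn_toLp, hk.coeFn_toLp] with s h1 h2
  rw [h1, h2]

theorem norm_sq_toLp {f : ℝ → E3} (hf : MemLp f 2 (volume.restrict (Ioc 0 (2 * Real.pi)))) :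
    ‖hf.toLp f‖ ^ 2 = ∫ s in (0 : ℝ)..(2 * Real.pi), ‖f s‖ ^ 2 := by
  rw [← real_inner_self_eq_norm_sq, inner_toLp]
  simp only [real_inner_self_eq_norm_sq]

theorem intervalIntegrable_inner {f k : ℝ → E3}
    (hf : MemLp f 2 (volume.restrict (Ioc 0 (2 * Real.pi))))
    (hk : MemLp k 2 (volume.restrict (Ioc 0 (2 * Real.pi)))) :
    IntervalIntegrable (fun s => inner ℝ (f s) (k s)) volume 0 (2 * Real.pi) := by
  rw [intervalIntegrable_iff_integrableOn_Ioc_of_le (by positivity)]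
  refine (L2.integrable_inner (𝕜 := ℝ) (hf.toLp f) (hk.toLp k)).congr ?_
  filter_upwards [hf.coeFn_toLp, hk.coeFn_toLp] with s h1 h2
  rw [h1, h2]

theorem HasL2Density.bilinearForm_eq (H : HasL2Density u g) (K : HasL2Density v h) :
    bilinearForm u g v h = inner ℝ (H.memLp.toLp g) (K.memLp.toLp h)
      - inner ℝ ((memLp_of_continuous H.continuous).toLp u)
        ((memLp_of_continuous K.continuous).toLp v) := by
  rw [inner_toLp, inner_toLp, bilinearForm, intervalIntegral.integral_sub]
  · exact intervalIntegrable_inner H.memLp K.memLp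
  · exact intervalIntegrable_inner (memLp_of_continuous H.continuous)
      (memLp_of_continuous K.continuous)

theorem HasL2Density.lagrangeFunctional_eq (H : HasL2Density u g) :
    lagrangeFunctional u = 1 / 2 * (‖H.memLp.toLp g‖ ^ 2
      - ‖(memLp_of_continuous H.continuous).toLp u‖ ^ 2) := by
  rw [norm_sq_toLp, norm_sq_toLp, lagrangeFunctional, ← intervalIntegral.integral_sub]
  · congr 1
    refine intervalIntegral.integral_congr_ae ?_
    filter_upwards [H.deriv_ae] with t ht _
    rw [ht]
  · exact H.sq _ _
  · exact (H.continuous.norm.pow 2).intervalIntegrable _ _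

theorem HasL2Density.h1Norm_sq_eq (H : HasL2Density u g) :
    h1Norm u ^ 2 = ‖(memLp_of_continuous H.continuous).toLp u‖ ^ 2 + ‖H.memLp.toLp g‖ ^ 2 := by
  rw [norm_sq_toLp, norm_sq_toLp, H.h1Norm_sq, intervalIntegral.integral_add]
  · exact (H.continuous.norm.pow 2).intervalIntegrable _ _
  · exact H.sq _ _

end Functional

/-- The remainder of a second order expansion of curves is again of class `H¹`. -/
theorem HasL2Density.remainder {u₀ g₀ u₁ g₁ u₂ g₂ v h : ℝ → E3} (H₀ : HasL2Density u₀ g₀)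
    (H₁ : HasL2Density u₁ g₁) (H₂ : HasL2Density u₂ g₂) (H : HasL2Density v h) (μ : ℝ) :
    HasL2Density (fun s => v s - (u₀ s + μ • u₁ s + μ ^ 2 • u₂ s))
      (fun s => h s - (g₀ s + μ • g₁ s + μ ^ 2 • g₂ s)) :=
  H.sub ((H₀.add (H₁.const_smul μ)).add (H₂.const_smul (μ ^ 2)))

/-- The functional expands to second order along curves that do so in `H¹`. -/
theorem hasSecondOrderExpansion {M : Set ℝ} {X : ℝ → ℝ → E3} {X₀ g₀ x₁ g₁ x₂ g₂ : ℝ → E3}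
    (hX : ∀ μ ∈ M, MemH1 (X μ)) (H₀ : HasL2Density X₀ g₀) (H₁ : HasL2Density x₁ g₁)
    (H₂ : HasL2Density x₂ g₂)
    (hexp : (fun μ : ℝ => h1Norm (fun s => X μ s - (X₀ s + μ • x₁ s + μ ^ 2 • x₂ s)))
      =o[𝓝[M] 0] (fun μ : ℝ => μ ^ 2)) :
    HasSecondOrderExpansion M X₀ X (bilinearForm X₀ g₀ x₁ g₁)
      (bilinearForm X₀ g₀ x₂ g₂ + lagrangeFunctional x₁) := by
  classical
  have hM : ∀ᶠ μ in 𝓝[M] (0 : ℝ), μ ∈ M := self_mem_nhdsWithin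
  have HR := fun μ (hμ : μ ∈ M) => H₀.remainder H₁ H₂ (hX μ hμ).hasL2Density μ
  -- the curves and their derivatives as elements of `L²`
  set j₀ := (memLp_of_continuous H₀.continuous).toLp X₀
  set j₁ := (memLp_of_continuous H₁.continuous).toLp x₁
  set j₂ := (memLp_of_continuous H₂.continuous).toLp x₂
  set d₀ := H₀.memLp.toLp g₀
  set d₁ := H₁.memLp.toLp g₁
  set d₂ := H₂.memLp.toLp g₂
  set J : ℝ → Lp E3 2 (volume.restrict (Ioc 0 (2 * Real.pi))) := fun μ =>
    if hμ : μ ∈ M then (memLp_of_continuous (hX μ hμ).hasL2Density.continuous).toLp (X μ) else 0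
  set D : ℝ → Lp E3 2 (volume.restrict (Ioc 0 (2 * Real.pi))) := fun μ =>
    if hμ : μ ∈ M then (hX μ hμ).hasL2Density.memLp.toLp (deriv (X μ)) else 0
  set J' : ℝ → Lp E3 2 (volume.restrict (Ioc 0 (2 * Real.pi))) := fun μ =>
    if hμ : μ ∈ M then (memLp_of_continuous (HR μ hμ).continuous).toLp _ else 0
  set D' : ℝ → Lp E3 2 (volume.restrict (Ioc 0 (2 * Real.pi))) := fun μ =>
    if hμ : μ ∈ M then (HR μ hμ).memLp.toLp _ else 0
  have hJ : ∀ᶠ μ in 𝓝[M] (0 : ℝ), J μ = j₀ + μ • j₁ + μ ^ 2 • j₂ + J' μ := by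
    filter_upwards [hM] with μ hμ
    simp only [J, J', hμ, dif_pos, j₀, j₁, j₂, ← MemLp.toLp_const_smul, ← MemLp.toLp_add]
    exact MemLp.toLp_congr _ _ (ae_of_all _ fun s => by simp)
  have hD : ∀ᶠ μ in 𝓝[M] (0 : ℝ), D μ = d₀ + μ • d₁ + μ ^ 2 • d₂ + D' μ := by
    filter_upwards [hM] with μ hμ
    simp only [D, D', hμ, dif_pos, d₀, d₁, d₂, ← MemLp.toLp_const_smul, ← MemLp.toLp_add]
    exact MemLp.toLp_congr _ _ (ae_of_all _ fun s => by simp)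
  have hJ' : (fun μ => ‖J' μ‖) =o[𝓝[M] 0] fun μ : ℝ => μ ^ 2 := by
    refine IsBigO.trans_isLittleO (IsBigO.of_bound 1 ?_) hexp
    filter_upwards [hM] with μ hμ
    have h1 := (HR μ hμ).h1Norm_sq_eq
    simp only [J', hμ, dif_pos]
    rw [norm_norm, one_mul, Real.norm_of_nonneg (h1Norm_nonneg _)]
    refine abs_le_of_sq_le_sq' ?_ (h1Norm_nonneg _) |>.2
    rw [h1]
    exact le_add_of_nonneg_right (by positivity)
  have hD' : (fun μ => ‖D' μ‖) =o[𝓝[M] 0] fun μ : ℝ => μ ^ 2 := by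
    refine IsBigO.trans_isLittleO (IsBigO.of_bound 1 ?_) hexp
    filter_upwards [hM] with μ hμ
    have h1 := (HR μ hμ).h1Norm_sq_eq
    simp only [D', hμ, dif_pos]
    rw [norm_norm, one_mul, Real.norm_of_nonneg (h1Norm_nonneg _)]
    refine abs_le_of_sq_le_sq' ?_ (h1Norm_nonneg _) |>.2
    rw [h1]
    exact le_add_of_nonneg_left (by positivity)
  have e1 := isLittleO_norm_sq_expansion nhdsWithin_le_nhds hD hD'
  have e2 := isLittleO_norm_sq_expansion nhdsWithin_le_nhds hJ hJ'
  refine ((e1.sub e2).const_mul_left (1 / 2)).congr' ?_ EventuallyEq.rfl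
  filter_upwards [hM] with μ hμ
  rw [(hX μ hμ).hasL2Density.lagrangeFunctional_eq, H₀.lagrangeFunctional_eq,
    H₁.lagrangeFunctional_eq, H₀.bilinearForm_eq H₁, H₀.bilinearForm_eq H₂]
  simp only [D, J, hμ, dif_pos]
  ring

/-- The coefficients of a second order expansion are unique. -/
theorem HasSecondOrderExpansion.unique {M : Set ℝ} (hM0 : (0 : ℝ) ∉ M) (hM : (0 : ℝ) ∈ closure M)
    {X₀ : ℝ → E3} {X : ℝ → ℝ → E3} {L₁ L₂ L₁' L₂' : ℝ}
    (h : HasSecondOrderExpansion M X₀ X L₁ L₂) (h' : HasSecondOrderExpansion M X₀ X L₁' L₂') :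
    L₁ = L₁' ∧ L₂ = L₂' := by
  have hne : (𝓝[M] (0 : ℝ)).NeBot := mem_closure_iff_nhdsWithin_neBot.1 hM
  have hM' : ∀ᶠ μ in 𝓝[M] (0 : ℝ), μ ≠ 0 := by
    filter_upwards [self_mem_nhdsWithin] with μ hμ h0
    exact hM0 (h0 ▸ hμ)
  have hid : Tendsto (fun μ : ℝ => μ) (𝓝[M] 0) (𝓝 0) := tendsto_id.mono_left nhdsWithin_le_nhds
  have h1 : (fun μ : ℝ => μ * (L₁' - L₁) + μ ^ 2 * (L₂' - L₂)) =o[𝓝[M] 0] fun μ : ℝ => μ ^ 2 := by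
    refine (h.sub h').congr_left fun μ => ?_
    ring
  have h2 : Tendsto (fun μ : ℝ => (μ * (L₁' - L₁) + μ ^ 2 * (L₂' - L₂)) / μ ^ 2) (𝓝[M] 0) (𝓝 0) :=
    h1.tendsto_div_nhds_zero
  have h3 : L₁' - L₁ = 0 := by
    have h4 := (h2.mul hid).sub (hid.mul_const (L₂' - L₂))
    simp only [zero_mul, sub_zero] at h4
    refine tendsto_nhds_unique (tendsto_const_nhds.congr' ?_) h4
    filter_upwards [hM'] with μ hμ
    field_simp
    ring
  have h5 : L₂' - L₂ = 0 := by
    refine tendsto_nhds_unique (tendsto_const_nhds.congr' ?_) h2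
    filter_upwards [hM'] with μ hμ
    rw [h3]
    field_simp
    ring
  constructor <;> linarith

/-! ### Arcs of the collapsed orbit -/

theorem inner_single_one (i : Fin 3) (v : E3) :
    inner ℝ (EuclideanSpace.single i (1 : ℝ)) v = v i := by
  simp [EuclideanSpace.inner_single_left]

theorem norm_single_one (i : Fin 3) : ‖(EuclideanSpace.single i (1 : ℝ) : E3)‖ = 1 := by
  simp

theorem norm_sq_eq_sum (v : E3) : ‖v‖ ^ 2 = v 0 ^ 2 + v 1 ^ 2 + v 2 ^ 2 := by
  rw [EuclideanSpace.norm_sq_eq, Fin.sum_univ_three]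
  simp only [Real.norm_eq_abs, sq_abs]

theorem cosTwo_sub_pi_div_two (a b : ℝ) {t : ℝ} (ht : t ∈ Icc 0 Real.pi) :
    cosTwo a b (t - Real.pi / 2) = a * Real.sin t := by
  rw [cosTwo, Real.cos_sub_pi_div_two, if_pos (Real.sin_nonneg_of_mem_Icc ht)]

theorem cosTwo_add_pi_div_two (a b : ℝ) {t : ℝ} (ht : t ∈ Icc 0 Real.pi) :
    cosTwo a b (t + Real.pi / 2) = -(b * Real.sin t) := by
  have h := Real.sin_nonneg_of_mem_Icc ht
  rw [cosTwo, Real.cos_add_pi_div_two]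
  split_ifs with h'
  · have : Real.sin t = 0 := by linarith
    simp [this]
  · ring

/-- The derivative of `cosTwo`, away from its kinks. -/
noncomputable def cosTwoDeriv (a b s : ℝ) : ℝ :=
  if 0 ≤ Real.cos s then -(a * Real.sin s) else -(b * Real.sin s)

theorem countable_cos_eq_zero : {s : ℝ | Real.cos s = 0}.Countable := by
  have : {s : ℝ | Real.cos s = 0} ⊆ range fun k : ℤ => (2 * (k : ℝ) + 1) * Real.pi / 2 := by
    intro s hs
    obtain ⟨k, hk⟩ := Real.cos_eq_zero_iff.1 hs
    exact ⟨k, hk.symm⟩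
  exact (countable_range _).mono this

theorem hasL2Density_cosTwo (a b : ℝ) : HasL2Density (cosTwo a b) (cosTwoDeriv a b) := by
  have hcont : Continuous (cosTwo a b) := by
    refine Continuous.if_le (by fun_prop) (by fun_prop) continuous_const Real.continuous_cos ?_
    intro s hs
    rw [← hs]; simp
  have hm : Measurable (cosTwoDeriv a b) :=
    Measurable.ite (measurableSet_le measurable_const Real.measurable_cos)
      (Real.measurable_sin.const_mul a).neg (Real.measurable_sin.const_mul b).neg
  have hb : ∀ s, ‖cosTwoDeriv a b s‖ ≤ |a| + |b| := fun s => by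
    have h1 := Real.abs_sin_le_one s
    rw [cosTwoDeriv]
    split_ifs
    · rw [norm_neg, Real.norm_eq_abs, abs_mul]
      nlinarith [abs_nonneg a, abs_nonneg b]
    · rw [norm_neg, Real.norm_eq_abs, abs_mul]
      nlinarith [abs_nonneg a, abs_nonneg b]
  have hi : ∀ c d, IntervalIntegrable (cosTwoDeriv a b) volume c d := fun c d =>
    IntervalIntegrable.mono_fun (intervalIntegrable_const (c := |a| + |b|)) hm.aestronglyMeasurable
      (Eventually.of_forall fun s => (hb s).trans (le_abs_self _))
  refine ⟨hm.stronglyMeasurable, fun c d => ?_, fun c d => ?_⟩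
  · refine IntervalIntegrable.mono_fun (intervalIntegrable_const (c := (|a| + |b|) ^ 2))
      (hm.norm.pow_const 2).aestronglyMeasurable (Eventually.of_forall fun s => ?_)
    simp only [norm_pow, norm_norm]
    rw [Real.norm_of_nonneg (by positivity : 0 ≤ |a| + |b|)]
    exact pow_le_pow_left₀ (norm_nonneg _) (hb s) 2
  · refine (integral_eq_of_hasDerivAt_off_countable (cosTwo a b) _ countable_cos_eq_zero
      hcont.continuousOn (fun s hs => ?_) (hi c d)).symm
    have hs0 : Real.cos s ≠ 0 := hs.2
    rcases lt_or_gt_of_ne hs0 with h | h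
    · have hev : cosTwo a b =ᶠ[𝓝 s] fun r => b * Real.cos r := by
        filter_upwards [Real.continuous_cos.continuousAt.eventually_lt_const h] with r hr
        rw [cosTwo, if_neg (not_le.2 hr)]
      rw [cosTwoDeriv, if_neg (not_le.2 h), ← mul_neg]
      exact ((Real.hasDerivAt_cos s).const_mul b).congr_of_eventuallyEq hev
    · have hev : cosTwo a b =ᶠ[𝓝 s] fun r => a * Real.cos r := by
        filter_upwards [Real.continuous_cos.continuousAt.eventually_const_lt h] with r hr
        rw [cosTwo, if_pos hr.le]
      rw [cosTwoDeriv, if_pos h.le, ← mul_neg]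
      exact ((Real.hasDerivAt_cos s).const_mul a).congr_of_eventuallyEq hev

theorem hasL2Density_baseOrbit (a b : ℝ) :
    HasL2Density (baseOrbit a b)
      (fun s => cosTwoDeriv a b s • (EuclideanSpace.single 0 (1 : ℝ) : E3)) := by
  have := (hasL2Density_cosTwo a b).clm_comp
    (ContinuousLinearMap.toSpanSingleton ℝ (EuclideanSpace.single 0 (1 : ℝ) : E3))
  simp only [ContinuousLinearMap.toSpanSingleton_apply] at this
  exact this

theorem periodic_cosTwo (a b : ℝ) : Function.Periodic (cosTwo a b) (2 * Real.pi) := fun s => by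
  simp only [cosTwo, Real.cos_add_two_pi]

theorem periodic_cosTwoDeriv (a b : ℝ) : Function.Periodic (cosTwoDeriv a b) (2 * Real.pi) :=
  fun s => by simp only [cosTwoDeriv, Real.cos_add_two_pi, Real.sin_add_two_pi]

theorem HasL2Density.apply {u g : ℝ → E3} (H : HasL2Density u g) (i : Fin 3) :
    HasL2Density (fun s => u s i) (fun s => g s i) :=
  H.clm_comp (EuclideanSpace.proj i : E3 →L[ℝ] ℝ)

theorem HasL2Density.comp_add {u g : ℝ → ℝ} (H : HasL2Density u g) (c : ℝ) :
    HasL2Density (fun t => u (t + c)) (fun t => g (t + c)) := by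
  simpa [add_comm] using H.comp_affine c one_ne_zero

theorem HasL2Density.comp_sub {u g : ℝ → ℝ} (H : HasL2Density u g) (c : ℝ) :
    HasL2Density (fun t => u (t - c)) (fun t => g (t - c)) := by
  simpa [sub_eq_add_neg] using H.comp_add (-c)

theorem MemH1.periodic_deriv {x : ℝ → E3} (H : MemH1 x) :
    Function.Periodic (deriv x) (2 * Real.pi) := fun s => by
  have h1 : (fun s => x (s + 2 * Real.pi)) = x := funext H.periodic
  have h2 := deriv_comp_add_const x (2 * Real.pi) s
  rw [h1] at h2
  exact h2.symm

theorem apply_three_pi_div_two {x : ℝ → E3} (H : Function.Periodic x (2 * Real.pi)) :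
    x (3 * Real.pi / 2) = x (-(Real.pi / 2)) := by
  rw [← H (-(Real.pi / 2))]
  congr 1
  ring

/-- A period consists of the front arc, from `-π/2` to `π/2`, and the back arc, from `π/2` to
`3π/2`. -/
theorem integral_period_eq_arcs {F : ℝ → ℝ} (hp : Function.Periodic F (2 * Real.pi))
    (hi : ∀ a b, IntervalIntegrable F volume a b) :
    ∫ s in (0 : ℝ)..(2 * Real.pi), F s = (∫ t in (0 : ℝ)..Real.pi, F (t - Real.pi / 2))
      + ∫ t in (0 : ℝ)..Real.pi, F (t + Real.pi / 2) := by
  have h1 := hp.intervalIntegral_add_eq 0 (-(Real.pi / 2))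
  rw [zero_add] at h1
  rw [h1, intervalIntegral.integral_comp_sub_right, intervalIntegral.integral_comp_add_right,
    ← intervalIntegral.integral_add_adjacent_intervals (hi _ (Real.pi / 2)) (hi _ _)]
  congr 2 <;> ring

theorem integral_arc_eq_halves {f : ℝ → ℝ}
    (hi : IntervalIntegrable f volume 0 Real.pi) :
    ∫ t in (0 : ℝ)..Real.pi, f t = (∫ t in (0 : ℝ)..(Real.pi / 2), f t)
      + ∫ t in (0 : ℝ)..(Real.pi / 2), f (Real.pi - t) := by
  have hpi := Real.pi_pos
  have h1 : uIcc 0 (Real.pi / 2) ⊆ uIcc 0 Real.pi := by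
    rw [uIcc_of_le (by positivity), uIcc_of_le hpi.le]; exact Icc_subset_Icc le_rfl (by linarith)
  have h2 : uIcc (Real.pi / 2) Real.pi ⊆ uIcc 0 Real.pi := by
    rw [uIcc_of_le (by linarith), uIcc_of_le hpi.le]; exact Icc_subset_Icc (by linarith) le_rfl
  rw [intervalIntegral.integral_comp_sub_left,
    ← intervalIntegral.integral_add_adjacent_intervals (hi.mono_set h1) (hi.mono_set h2)]
  congr 2 <;> ring

/-- The first variation of the functional at the collapsed orbit. -/
theorem bilinearForm_baseOrbit (a b : ℝ) {y : ℝ → E3} (H : MemH1 y) :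
    bilinearForm (baseOrbit a b)
      (fun s => cosTwoDeriv a b s • (EuclideanSpace.single 0 (1 : ℝ) : E3)) y (deriv y)
      = -(a - b) * (y (Real.pi / 2) 0 + y (-(Real.pi / 2)) 0) := by
  have HD := H.hasL2Density.apply 0
  set F : ℝ → ℝ := fun s => cosTwoDeriv a b s * deriv y s 0 - cosTwo a b s * y s 0 with hF
  have hFeq : bilinearForm (baseOrbit a b)
      (fun s => cosTwoDeriv a b s • (EuclideanSpace.single 0 (1 : ℝ) : E3)) y (deriv y)
      = ∫ s in (0 : ℝ)..(2 * Real.pi), F s := by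
    rw [bilinearForm]
    congr 1
    funext s
    simp only [hF, baseOrbit, collapsedOrbit, inner_smul_left, inner_single_one, conj_trivial]
  have hp : Function.Periodic F (2 * Real.pi) := fun s => by
    simp only [hF, periodic_cosTwo a b s, periodic_cosTwoDeriv a b s, H.periodic s,
      H.periodic_deriv s]
  have hprod : ∀ c d, IntervalIntegrable F volume c d := fun c d => by
    have i1 : IntervalIntegrable (fun s => cosTwo a b s * y s 0) volume c d :=
      ((hasL2Density_cosTwo a b).continuous.mul HD.continuous).intervalIntegrable c d
    refine IntervalIntegrable.sub ?_ i1
    refine IntervalIntegrable.mono_fun (((hasL2Density_cosTwo a b).intervalIntegrable_sq c d).add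
      (HD.intervalIntegrable_sq c d))
      ((hasL2Density_cosTwo a b).meas.mul HD.meas).aestronglyMeasurable
      (Eventually.of_forall fun s => ?_)
    simp only [Real.norm_eq_abs]
    rw [abs_of_nonneg (by positivity : 0 ≤ cosTwoDeriv a b s ^ 2 + deriv y s 0 ^ 2), abs_mul]
    nlinarith [sq_nonneg (|cosTwoDeriv a b s| - |deriv y s 0|), sq_abs (cosTwoDeriv a b s),
      sq_abs (deriv y s 0)]
  have hfront : ∫ t in (0 : ℝ)..Real.pi, F (t - Real.pi / 2)
      = a * -(y (Real.pi / 2) 0 + y (-(Real.pi / 2)) 0) := by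
    have h1 := integral_cos_mul_sub_sin_mul (HD.comp_sub (Real.pi / 2))
    rw [show Real.pi - Real.pi / 2 = Real.pi / 2 by ring, zero_sub] at h1
    rw [← h1, ← intervalIntegral.integral_const_mul]
    refine intervalIntegral.integral_congr fun t ht => ?_
    rw [uIcc_of_le Real.pi_pos.le] at ht
    simp only [hF, cosTwo_sub_pi_div_two a b ht]
    rw [cosTwoDeriv, Real.cos_sub_pi_div_two, if_pos (Real.sin_nonneg_of_mem_Icc ht),
      Real.sin_sub_pi_div_two]
    ring
  have hback : ∫ t in (0 : ℝ)..Real.pi, F (t + Real.pi / 2)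
      = -b * -(y (Real.pi / 2) 0 + y (-(Real.pi / 2)) 0) := by
    have h1 := integral_cos_mul_sub_sin_mul (HD.comp_add (Real.pi / 2))
    rw [show Real.pi + Real.pi / 2 = 3 * Real.pi / 2 by ring, zero_add,
      apply_three_pi_div_two H.periodic, add_comm] at h1
    rw [← h1, ← intervalIntegral.integral_const_mul]
    refine intervalIntegral.integral_congr_ae ?_
    have hne : ∀ᵐ t : ℝ, t ≠ Real.pi := by simp [ae_iff, measure_singleton]
    filter_upwards [hne] with t htne ht
    rw [uIoc_of_le Real.pi_pos.le] at ht
    have hs : 0 < Real.sin t := Real.sin_pos_of_mem_Ioo ⟨ht.1, lt_of_le_of_ne ht.2 htne⟩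
    simp only [hF, cosTwo_add_pi_div_two a b (Ioc_subset_Icc_self ht)]
    rw [cosTwoDeriv, Real.cos_add_pi_div_two, if_neg (by linarith),
      Real.sin_add_pi_div_two]
    ring
  rw [hFeq, integral_period_eq_arcs hp hprod, hfront, hback]
  ring

/-- The contribution of the front arc, from `-π/2` to `π/2`, to `2𝓛`, for one component. -/
noncomputable def frontEnergy (x : ℝ → E3) (i : Fin 3) : ℝ :=
  ∫ t in (0 : ℝ)..Real.pi,
    (deriv x (t - Real.pi / 2) i ^ 2 - x (t - Real.pi / 2) i ^ 2)

/-- The contribution of the back arc, from `π/2` to `3π/2`, to `2𝓛`, for one component. -/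
noncomputable def backEnergy (x : ℝ → E3) (i : Fin 3) : ℝ :=
  ∫ t in (0 : ℝ)..Real.pi,
    (deriv x (t + Real.pi / 2) i ^ 2 - x (t + Real.pi / 2) i ^ 2)

theorem MemH1.two_mul_lagrangeFunctional {x : ℝ → E3} (H : MemH1 x) :
    2 * lagrangeFunctional x = (frontEnergy x 0 + backEnergy x 0)
      + (frontEnergy x 1 + backEnergy x 1) + (frontEnergy x 2 + backEnergy x 2) := by
  have hi : ∀ (i : Fin 3) a b,
      IntervalIntegrable (fun s => deriv x s i ^ 2 - x s i ^ 2) volume a b := fun i a b =>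
    ((H.hasL2Density.apply i).intervalIntegrable_sq a b).sub
      (((H.hasL2Density.apply i).continuous.pow 2).intervalIntegrable a b)
  have hE : ∀ i, frontEnergy x i + backEnergy x i
      = ∫ s in (0 : ℝ)..(2 * Real.pi), (deriv x s i ^ 2 - x s i ^ 2) := fun i => by
    have hp : Function.Periodic (fun s => deriv x s i ^ 2 - x s i ^ 2) (2 * Real.pi) := fun s => by
      simp only [H.periodic s, H.periodic_deriv s]
    rw [integral_period_eq_arcs hp (hi i), frontEnergy, backEnergy]
  rw [hE, hE, hE, ← intervalIntegral.integral_add (hi 0 _ _) (hi 1 _ _),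
    ← intervalIntegral.integral_add ((hi 0 _ _).add (hi 1 _ _)) (hi 2 _ _), lagrangeFunctional]
  rw [← mul_assoc, show (2 : ℝ) * (1 / 2) = 1 by norm_num, one_mul]
  congr 1
  funext s
  rw [norm_sq_eq_sum, norm_sq_eq_sum]
  ring

/-! ### The closing integral on the four half arcs -/

theorem inner_div_norm_neg_one_smul (f v : E3) :
    inner ℝ f ((-1 : ℝ) • v) / ‖(-1 : ℝ) • v‖ = -(inner ℝ f v / ‖v‖) := by
  rw [neg_one_smul, inner_neg_right, norm_neg, neg_div]

theorem intervalIntegrable_inner_div_norm {Z : ℝ → E3} (hZ : Continuous Z) (f : E3) (a b : ℝ) :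
    IntervalIntegrable (fun t => inner ℝ f (Z t) / ‖Z t‖) volume a b := by
  refine IntervalIntegrable.mono_fun (intervalIntegrable_const (c := ‖f‖))
    ((by fun_prop : Continuous fun t => inner ℝ f (Z t)).measurable.div
      hZ.norm.measurable).aestronglyMeasurable (Eventually.of_forall fun t => ?_)
  exact (abs_inner_div_norm_le f (Z t)).trans (le_abs_self _)

theorem closingIntegral_apply {X : ℝ → E3} (hX : Continuous X) (i : Fin 3) :
    closingIntegral X i = ∫ s in (0 : ℝ)..(2 * Real.pi),
      inner ℝ (EuclideanSpace.single i (1 : ℝ)) (X s) / ‖X s‖ := by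
  have hi : IntervalIntegrable (fun s => ‖X s‖⁻¹ • X s) volume 0 (2 * Real.pi) := by
    refine IntervalIntegrable.mono_fun (intervalIntegrable_const (c := (1 : ℝ)))
      (hX.norm.measurable.inv.smul hX.measurable).aestronglyMeasurable
      (Eventually.of_forall fun s => ?_)
    simp only [norm_smul, norm_inv, norm_norm, norm_one]
    exact inv_mul_le_one
  have h := (EuclideanSpace.proj i : E3 →L[ℝ] ℝ).intervalIntegral_comp_comm hi
  change _ = closingIntegral X i at h
  rw [← h]
  congr 1
  funext s
  rw [inner_single_one, div_eq_inv_mul]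
  rfl

/-- The closing integral as a sum over half arcs, each parametrized from its zero of the cosine and,
on the back arc, reflected such that all half arcs of the collapsed orbit point in the same
direction. -/
theorem closingIntegral_eq_halves {X : ℝ → E3} (hX : Continuous X)
    (hp : Function.Periodic X (2 * Real.pi)) (i : Fin 3) (f : E3)
    (hf : f = EuclideanSpace.single i (1 : ℝ)) :
    closingIntegral X i =
      (∫ t in (0 : ℝ)..(Real.pi / 2), inner ℝ f ((1 : ℝ) • X (-(Real.pi / 2) + 1 * t))
          / ‖(1 : ℝ) • X (-(Real.pi / 2) + 1 * t)‖)
      + (∫ t in (0 : ℝ)..(Real.pi / 2), inner ℝ f ((1 : ℝ) • X (Real.pi / 2 + -1 * t))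
          / ‖(1 : ℝ) • X (Real.pi / 2 + -1 * t)‖)
      - (∫ t in (0 : ℝ)..(Real.pi / 2), inner ℝ f ((-1 : ℝ) • X (Real.pi / 2 + 1 * t))
          / ‖(-1 : ℝ) • X (Real.pi / 2 + 1 * t)‖)
      - ∫ t in (0 : ℝ)..(Real.pi / 2), inner ℝ f ((-1 : ℝ) • X (3 * Real.pi / 2 + -1 * t))
          / ‖(-1 : ℝ) • X (3 * Real.pi / 2 + -1 * t)‖ := by
  rw [closingIntegral_apply hX i, ← hf, integral_period_eq_arcs (fun s => by rw [hp s])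
    (intervalIntegrable_inner_div_norm hX f),
    integral_arc_eq_halves (intervalIntegrable_inner_div_norm
      (by fun_prop : Continuous fun t : ℝ => X (t - Real.pi / 2)) f _ _),
    integral_arc_eq_halves (intervalIntegrable_inner_div_norm
      (by fun_prop : Continuous fun t : ℝ => X (t + Real.pi / 2)) f _ _)]
  simp only [inner_div_norm_neg_one_smul, intervalIntegral.integral_neg, one_smul, one_mul]
  rw [sub_neg_eq_add, sub_neg_eq_add, ← add_assoc]
  congr 2
  · congr 2
    · funext t; rw [sub_eq_neg_add]
    · funext t; rw [show Real.pi - t - Real.pi / 2 = Real.pi / 2 + -1 * t by ring]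
  · congr 1; funext t; rw [add_comm]
  · funext t; rw [show Real.pi - t + Real.pi / 2 = 3 * Real.pi / 2 + -1 * t by ring]

theorem integral_inner_div_norm_eq_sub_deficit {Z : ℝ → E3} (hZ : Continuous Z) (f : E3) :
    ∫ t in (0 : ℝ)..(Real.pi / 2), inner ℝ f (Z t) / ‖Z t‖
      = Real.pi / 2 - ∫ t in (0 : ℝ)..(Real.pi / 2), deficit f (Z t) := by
  simp only [deficit]
  rw [intervalIntegral.integral_sub intervalIntegrable_const
    (intervalIntegrable_inner_div_norm hZ f _ _), intervalIntegral.integral_const]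
  simp

/-! ### Tangential directions -/

/-- A periodic curve that on the two arcs is `sin • w` plus multiples `cos • m` and `-cos • m'` of the
cosine is tangential, if the transversal parts of the coefficients are proportional to the base
orbit. The components of `m` and `m'` along the base orbit come from varying the parameters `a` and
`b`, the transversal ones from rotating its line, and `sin • w` from opening it to an ellipse. -/
theorem mem_tangentialDirections {a b : ℝ} (ha : a ≠ 0) {x : ℝ → E3}
    (hp : Function.Periodic x (2 * Real.pi)) {w m m' : E3} (hw : a = b ∨ w = 0)
    (h1 : a * m' 1 = -(b * m 1)) (h2 : a * m' 2 = -(b * m 2))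
    (hfront : ∀ t ∈ Icc 0 Real.pi, x (t - Real.pi / 2) = Real.sin t • m - Real.cos t • w)
    (hback : ∀ t ∈ Icc 0 Real.pi, x (t + Real.pi / 2) = Real.sin t • m' + Real.cos t • w) :
    x ∈ tangentialDirections (baseOrbit a b) := by
  set e : E3 := EuclideanSpace.single 0 (1 : ℝ) with he
  set v' : E3 := (1 / a) • (m - m 0 • e) with hv'
  set u : ℝ → E3 := fun s => cosTwo (m 0) (-(m' 0)) s • e + cosTwo a b s • v' with hu
  have hu_mem : u ∈ tangentialDirections (baseOrbit a b) := by
    refine Submodule.subset_span (Or.inl ⟨fun t => a + t * m 0, fun t => b + t * -(m' 0),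
      fun t => e + t • v', by fun_prop, by fun_prop, by fun_prop, ?_, fun s => ?_⟩)
    · simp [baseOrbit, he]
    · have hc : ∀ t : ℝ, cosTwo (a + t * m 0) (b + t * -(m' 0)) s
          = cosTwo a b s + t * cosTwo (m 0) (-(m' 0)) s := fun t => by
        simp only [cosTwo]
        split_ifs <;> ring
      have hd1 : HasDerivAt (fun t : ℝ => cosTwo a b s + t * cosTwo (m 0) (-(m' 0)) s)
          (cosTwo (m 0) (-(m' 0)) s) 0 := (hasDerivAt_mul_const _).const_add _
      have hd2 : HasDerivAt (fun t : ℝ => e + t • v') v' 0 := by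
        simpa using ((hasDerivAt_id (0 : ℝ)).smul_const v').const_add e
      have := hd1.smul hd2
      simp only [collapsedOrbit, hc]
      convert! this using 1
      simp only [hu, zero_mul, add_zero, zero_smul]
      abel
  have hz_mem : (fun s => Real.sin s • w) ∈ tangentialDirections (baseOrbit a b) := by
    rcases hw with rfl | rfl
    · refine Submodule.subset_span (Or.inr ⟨fun _ => a • e, fun t => t • w, by fun_prop,
        by fun_prop, ?_, fun s => ?_⟩)
      · funext s
        simp only [ellipticalOrbit, baseOrbit, collapsedOrbit, cosTwo, zero_smul, smul_zero,
          add_zero, ite_self, smul_smul, mul_comm, he]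
      · have := (((hasDerivAt_id (0 : ℝ)).smul_const w).const_smul (Real.sin s)).const_add
          (Real.cos s • a • e)
        simpa [ellipticalOrbit] using this
    · simp only [smul_zero]
      exact Submodule.zero_mem (tangentialDirections (baseOrbit a b))
  have heq : x = u + fun s => Real.sin s • w := by
    -- both sides are periodic and agree on the two arcs
    have hm : m = m 0 • e + a • v' := by
      rw [hv', smul_smul, mul_one_div_cancel ha, one_smul]; abel
    have hm' : m' = m' 0 • e - b • v' := by
      ext i
      fin_cases i
      · simp [hv', he]
      · have : m' 1 = -(b * m 1) / a := by rw [← h1]; field_simp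
        simp [hv', he, this]; ring
      · have : m' 2 = -(b * m 2) / a := by rw [← h2]; field_simp
        simp [hv', he, this]; ring
    have hper : Function.Periodic (fun s => u s + Real.sin s • w) (2 * Real.pi) := fun s => by
      simp only [hu, periodic_cosTwo _ _ s, Real.sin_add_two_pi]
    funext s
    obtain ⟨r, hr, hsr, hsr'⟩ : ∃ r ∈ Ico (-(Real.pi / 2)) (-(Real.pi / 2) + 2 * Real.pi),
        x s = x r ∧ u s + Real.sin s • w = u r + Real.sin r • w := by
      obtain ⟨k, hk, -⟩ := existsUnique_add_zsmul_mem_Ico (by positivity : 0 < 2 * Real.pi) s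
        (-(Real.pi / 2))
      exact ⟨_, hk, (hp.zsmul k s).symm, (hper.zsmul k s).symm⟩
    rw [Pi.add_apply, hsr, hsr']
    rcases le_total r (Real.pi / 2) with h | h
    · have ht : r + Real.pi / 2 ∈ Icc 0 Real.pi := ⟨by linarith [hr.1], by linarith⟩
      have h3 := hfront _ ht
      have h4 := cosTwo_sub_pi_div_two a b ht
      have h5 := cosTwo_sub_pi_div_two (m 0) (-(m' 0)) ht
      rw [add_sub_cancel_right] at h3 h4 h5
      have h6 : Real.sin r = -Real.cos (r + Real.pi / 2) := by rw [Real.cos_add_pi_div_two, neg_neg]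
      rw [h3, h6]
      simp only [hu]
      rw [h4, h5]
      nth_rw 1 [hm]
      module
    · have ht : r - Real.pi / 2 ∈ Icc 0 Real.pi := ⟨by linarith, by linarith [hr.2]⟩
      have h3 := hback _ ht
      have h4 := cosTwo_add_pi_div_two a b ht
      have h5 := cosTwo_add_pi_div_two (m 0) (-(m' 0)) ht
      rw [sub_add_cancel] at h3 h4 h5
      have h6 : Real.sin r = Real.cos (r - Real.pi / 2) := by rw [Real.cos_sub_pi_div_two]
      rw [h3, h6]
      simp only [hu]
      rw [h4, h5]
      nth_rw 1 [hm']
      module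
  rw [heq]
  exact Submodule.add_mem _ hu_mem hz_mem

/-! ### Sequences of almost closed perturbations -/

/-- The half arc of `x` that starts at `c` and runs in direction `η`, multiplied by `σ`. -/
noncomputable def halfArc (σ c η : ℝ) (x : ℝ → E3) (t : ℝ) : E3 := σ • x (c + η * t)

/-- A sequence of perturbations of the collapsed orbit, with positive parameters, whose closing
integrals are of order `o(μ²)` along the line of the orbit and `o(μ)` transversally to it. The
remainder of the expansion need only be small uniformly, not in `H¹`. -/
structure PerturbedOrbits (α β : ℝ) (μ : ℕ → ℝ) (X : ℕ → ℝ → E3) (x₁ x₂ : ℝ → E3) : Prop where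
  pos : ∀ n, 0 < μ n
  tendsto : Tendsto μ atTop (𝓝 0)
  mem : ∀ n, MemH1 (X n)
  mem₁ : MemH1 x₁
  mem₂ : MemH1 x₂
  rem : ∃ ε : ℕ → ℝ, Tendsto ε atTop (𝓝 0) ∧ ∀ n s,
    ‖X n s - (baseOrbit α β s + μ n • x₁ s + μ n ^ 2 • x₂ s)‖ ≤ ε n * μ n ^ 2
  closing₀ : Tendsto (fun n => closingIntegral (X n) 0 / μ n ^ 2) atTop (𝓝 0)
  closing : ∀ i : Fin 3, i ≠ 0 → Tendsto (fun n => closingIntegral (X n) i / μ n) atTop (𝓝 0)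

theorem inner_single_one_single_zero {i : Fin 3} (hi : i ≠ 0) :
    inner ℝ (EuclideanSpace.single i (1 : ℝ) : E3) (EuclideanSpace.single 0 (1 : ℝ)) = 0 := by
  rw [inner_single_one]
  simp [hi]

theorem baseOrbit_front (α β : ℝ) {s t : ℝ} (ht : t ∈ Icc 0 Real.pi) (hs : s = t - Real.pi / 2) :
    baseOrbit α β s = (α * Real.sin t) • (EuclideanSpace.single 0 (1 : ℝ) : E3) := by
  rw [baseOrbit, collapsedOrbit, hs, cosTwo_sub_pi_div_two α β ht]

theorem baseOrbit_back (α β : ℝ) {s t : ℝ} (ht : t ∈ Icc 0 Real.pi) (hs : s = t + Real.pi / 2) :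
    (-1 : ℝ) • baseOrbit α β s = (β * Real.sin t) • (EuclideanSpace.single 0 (1 : ℝ) : E3) := by
  rw [baseOrbit, collapsedOrbit, hs, cosTwo_add_pi_div_two α β ht, smul_smul]
  congr 1
  ring

namespace PerturbedOrbits

variable {α β : ℝ} {μ : ℕ → ℝ} {X : ℕ → ℝ → E3} {x₁ x₂ : ℝ → E3}

/-- The half arcs of the perturbed orbits are perturbations of those of the base orbit. -/
theorem halfExpansion (P : PerturbedOrbits α β μ X x₁ x₂) {σ c η γ : ℝ} (hσ : |σ| = 1)
    (hη : |η| = 1) (h : ∀ t ∈ Icc 0 (Real.pi / 2), σ • baseOrbit α β (c + η * t)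
      = (γ * Real.sin t) • (EuclideanSpace.single 0 (1 : ℝ) : E3)) :
    HalfExpansion γ (EuclideanSpace.single 0 (1 : ℝ) : E3) μ (fun n => halfArc σ c η (X n))
      (halfArc σ c η x₁) (halfArc σ c η x₂) := by
  have hη0 : η ≠ 0 := fun h0 => by simp [h0] at hη
  have H₁ := (P.mem₁.hasL2Density.comp_affine c hη0).const_smul σ
  have H₂ := (P.mem₂.hasL2Density.comp_affine c hη0).const_smul σ
  obtain ⟨ε, hε, hrem⟩ := P.rem
  refine ⟨fun n => (((P.mem n).hasL2Density.comp_affine c hη0).const_smul σ).continuous,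
    H₁.continuous, H₂.continuous, ?_, ?_, ε, hε, fun n t ht => ?_⟩
  · refine ⟨√(∫ t in (0 : ℝ)..(Real.pi / 2), ‖σ • η • deriv x₁ (c + η * t)‖ ^ 2),
      Real.sqrt_nonneg _, fun t ht => ?_⟩
    have h1 := H₁.norm_sub_sq_le ht.1
    rw [sub_zero] at h1
    have h2 : ∫ t in (0 : ℝ)..t, ‖σ • η • deriv x₁ (c + η * t)‖ ^ 2
        ≤ ∫ t in (0 : ℝ)..(Real.pi / 2), ‖σ • η • deriv x₁ (c + η * t)‖ ^ 2 :=
      intervalIntegral.integral_mono_interval le_rfl ht.1 ht.2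
        (ae_of_all _ fun t => by positivity) (H₁.sq _ _)
    rw [mul_comm, ← Real.sqrt_mul ht.1]
    exact Real.le_sqrt_of_sq_le (h1.trans (mul_le_mul_of_nonneg_left h2 ht.1))
  · simpa only [halfArc, zero_add] using H₁.tendsto_norm_sq_div 0
  · simp only [halfArc]
    rw [← h t ht]
    have h1 := hrem n (c + η * t)
    have h2 : σ • X n (c + η * t) - (σ • baseOrbit α β (c + η * t) + μ n • σ • x₁ (c + η * t)
        + μ n ^ 2 • σ • x₂ (c + η * t)) = σ • (X n (c + η * t) - (baseOrbit α β (c + η * t)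
        + μ n • x₁ (c + η * t) + μ n ^ 2 • x₂ (c + η * t))) := by
      module
    rw [h2, norm_smul, Real.norm_eq_abs, hσ, one_mul]
    exact h1

theorem mem_Icc_zero_pi {t : ℝ} (ht : t ∈ Icc 0 (Real.pi / 2)) :
    t ∈ Icc 0 Real.pi ∧ Real.pi - t ∈ Icc 0 Real.pi :=
  ⟨⟨ht.1, by linarith [ht.2, Real.pi_pos]⟩, by linarith [ht.2, Real.pi_pos], by linarith [ht.1]⟩

theorem frontStart (P : PerturbedOrbits α β μ X x₁ x₂) :
    HalfExpansion α (EuclideanSpace.single 0 (1 : ℝ) : E3) μ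
      (fun n => halfArc 1 (-(Real.pi / 2)) 1 (X n)) (halfArc 1 (-(Real.pi / 2)) 1 x₁)
      (halfArc 1 (-(Real.pi / 2)) 1 x₂) :=
  P.halfExpansion (by simp) (by simp) fun t ht => by
    rw [one_smul, baseOrbit_front α β (mem_Icc_zero_pi ht).1 (by ring)]

theorem frontEnd (P : PerturbedOrbits α β μ X x₁ x₂) :
    HalfExpansion α (EuclideanSpace.single 0 (1 : ℝ) : E3) μ
      (fun n => halfArc 1 (Real.pi / 2) (-1) (X n)) (halfArc 1 (Real.pi / 2) (-1) x₁)
      (halfArc 1 (Real.pi / 2) (-1) x₂) :=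
  P.halfExpansion (by simp) (by simp) fun t ht => by
    rw [one_smul, baseOrbit_front α β (mem_Icc_zero_pi ht).2 (by ring), Real.sin_pi_sub]

theorem backStart (P : PerturbedOrbits α β μ X x₁ x₂) :
    HalfExpansion β (EuclideanSpace.single 0 (1 : ℝ) : E3) μ
      (fun n => halfArc (-1) (Real.pi / 2) 1 (X n)) (halfArc (-1) (Real.pi / 2) 1 x₁)
      (halfArc (-1) (Real.pi / 2) 1 x₂) :=
  P.halfExpansion (by simp) (by simp) fun t ht => by
    rw [baseOrbit_back α β (mem_Icc_zero_pi ht).1 (by ring)]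

theorem backEnd (P : PerturbedOrbits α β μ X x₁ x₂) :
    HalfExpansion β (EuclideanSpace.single 0 (1 : ℝ) : E3) μ
      (fun n => halfArc (-1) (3 * Real.pi / 2) (-1) (X n))
      (halfArc (-1) (3 * Real.pi / 2) (-1) x₁) (halfArc (-1) (3 * Real.pi / 2) (-1) x₂) :=
  P.halfExpansion (by simp) (by simp) fun t ht => by
    rw [baseOrbit_back α β (mem_Icc_zero_pi ht).2 (by ring), Real.sin_pi_sub]

theorem closingIntegral_eq (P : PerturbedOrbits α β μ X x₁ x₂) (i : Fin 3) (n : ℕ) :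
    closingIntegral (X n) i =
      (∫ t in (0 : ℝ)..(Real.pi / 2), inner ℝ (EuclideanSpace.single i (1 : ℝ) : E3)
        (halfArc 1 (-(Real.pi / 2)) 1 (X n) t) / ‖halfArc 1 (-(Real.pi / 2)) 1 (X n) t‖)
      + (∫ t in (0 : ℝ)..(Real.pi / 2), inner ℝ (EuclideanSpace.single i (1 : ℝ) : E3)
        (halfArc 1 (Real.pi / 2) (-1) (X n) t) / ‖halfArc 1 (Real.pi / 2) (-1) (X n) t‖)
      - (∫ t in (0 : ℝ)..(Real.pi / 2), inner ℝ (EuclideanSpace.single i (1 : ℝ) : E3)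
        (halfArc (-1) (Real.pi / 2) 1 (X n) t) / ‖halfArc (-1) (Real.pi / 2) 1 (X n) t‖)
      - ∫ t in (0 : ℝ)..(Real.pi / 2), inner ℝ (EuclideanSpace.single i (1 : ℝ) : E3)
        (halfArc (-1) (3 * Real.pi / 2) (-1) (X n) t)
          / ‖halfArc (-1) (3 * Real.pi / 2) (-1) (X n) t‖ :=
  closingIntegral_eq_halves (P.mem n).hasL2Density.continuous (P.mem n).periodic i _ rfl

/-- The front and the back arc have the same length, so along the line of the orbit the closing
integral only compares their deficits. -/
theorem closingIntegral_zero_eq (P : PerturbedOrbits α β μ X x₁ x₂) (n : ℕ) :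
    closingIntegral (X n) 0 =
      (∫ t in (0 : ℝ)..(Real.pi / 2), deficit (EuclideanSpace.single 0 (1 : ℝ) : E3)
        (halfArc (-1) (Real.pi / 2) 1 (X n) t))
      + (∫ t in (0 : ℝ)..(Real.pi / 2), deficit (EuclideanSpace.single 0 (1 : ℝ) : E3)
        (halfArc (-1) (3 * Real.pi / 2) (-1) (X n) t))
      - (∫ t in (0 : ℝ)..(Real.pi / 2), deficit (EuclideanSpace.single 0 (1 : ℝ) : E3)
        (halfArc 1 (-(Real.pi / 2)) 1 (X n) t))
      - ∫ t in (0 : ℝ)..(Real.pi / 2), deficit (EuclideanSpace.single 0 (1 : ℝ) : E3)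
        (halfArc 1 (Real.pi / 2) (-1) (X n) t) := by
  rw [P.closingIntegral_eq, integral_inner_div_norm_eq_sub_deficit (P.frontStart.cont n),
    integral_inner_div_norm_eq_sub_deficit (P.frontEnd.cont n),
    integral_inner_div_norm_eq_sub_deficit (P.backStart.cont n),
    integral_inner_div_norm_eq_sub_deficit (P.backEnd.cont n)]
  ring

theorem halfArc_zero (σ c η : ℝ) (x : ℝ → E3) : halfArc σ c η x 0 = σ • x c := by
  simp [halfArc]

/-- The component of the closing condition along the line of the collapsed orbit, to first
order. -/
theorem first_order (P : PerturbedOrbits α β μ X x₁ x₂) (hα : 0 < α) (hβ : 0 < β) :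
    (x₁ (Real.pi / 2) 0 + x₁ (-(Real.pi / 2)) 0) * (1 / α + 1 / β)
      + (‖x₁ (Real.pi / 2)‖ + ‖x₁ (-(Real.pi / 2))‖) * (1 / β - 1 / α) = 0 := by
  have he := norm_single_one 0
  have h1 := P.frontStart.tendsto_integral_deficit_div hα he P.pos P.tendsto
  have h2 := P.frontEnd.tendsto_integral_deficit_div hα he P.pos P.tendsto
  have h3 := P.backStart.tendsto_integral_deficit_div hβ he P.pos P.tendsto
  have h4 := P.backEnd.tendsto_integral_deficit_div hβ he P.pos P.tendsto
  have h5 : Tendsto (fun n => closingIntegral (X n) 0 / μ n) atTop (𝓝 0) := by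
    have := P.closing₀.mul P.tendsto
    rw [zero_mul] at this
    refine this.congr fun n => ?_
    have := (P.pos n).ne'
    field_simp
  have h6 := tendsto_nhds_unique (((h3.add h4).sub h1).sub h2) (h5.congr fun n => by
    rw [P.closingIntegral_zero_eq]
    simp only [intervalIntegral.integral_div]
    ring)
  simp only [halfArc_zero, inner_single_one, one_smul, neg_one_smul, norm_neg, PiLp.neg_apply,
    apply_three_pi_div_two P.mem₁.periodic] at h6
  rw [← h6]
  ring

/-- The transversal components of the first order perturbations of the two ends of the front arc are
opposite, as the closing integral would diverge logarithmically otherwise. -/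
theorem transversal_ends (P : PerturbedOrbits α β μ X x₁ x₂) (hα : 0 < α) (hβ : 0 < β)
    {i : Fin 3} (hi : i ≠ 0) : x₁ (Real.pi / 2) i + x₁ (-(Real.pi / 2)) i = 0 := by
  have he := norm_single_one 0
  have hf := inner_single_one_single_zero hi
  obtain ⟨B₁, h1⟩ := P.frontStart.exists_abs_integral_inner_sub_log_le hα he P.pos P.tendsto hf
  obtain ⟨B₂, h2⟩ := P.frontEnd.exists_abs_integral_inner_sub_log_le hα he P.pos P.tendsto hf
  obtain ⟨B₃, h3⟩ := P.backStart.exists_abs_integral_inner_sub_log_le hβ he P.pos P.tendsto hf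
  obtain ⟨B₄, h4⟩ := P.backEnd.exists_abs_integral_inner_sub_log_le hβ he P.pos P.tendsto hf
  by_contra hne
  set q := x₁ (Real.pi / 2) i + x₁ (-(Real.pi / 2)) i with hq
  -- the divergent terms of the four half arcs have the same sign and add up
  have hκ : 0 < |q| * (1 / α + 1 / β) := mul_pos (abs_pos.2 hne) (by positivity)
  have hlog : Tendsto (fun n => |q| * (1 / α + 1 / β) * Real.log (1 / μ n)) atTop atTop := by
    refine Tendsto.const_mul_atTop hκ (Real.tendsto_log_atTop.comp ?_)
    simp only [one_div]
    exact (tendsto_nhdsWithin_iff.2 ⟨P.tendsto, Eventually.of_forall P.pos⟩).inv_tendsto_nhdsGT_zero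
  have hc := ((P.closing i hi).abs.eventually_lt_const (by simp : |(0 : ℝ)| < 1))
  obtain ⟨n, g1, g2, g3, g4, g5, g6⟩ := (h1.and (h2.and (h3.and (h4.and (hc.and
    (hlog.eventually_gt_atTop (1 + B₁ + B₂ + B₃ + B₄))))))).exists
  rw [P.closingIntegral_eq] at g5
  simp only [intervalIntegral.integral_div, halfArc_zero, one_smul, neg_one_smul,
    inner_neg_right, inner_single_one i (x₁ _), apply_three_pi_div_two P.mem₁.periodic]
    at g1 g2 g3 g4
  have h7 : |q| * (1 / α + 1 / β) * Real.log (1 / μ n)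
      ≤ |q * (1 / α + 1 / β) * Real.log (1 / μ n)| := by
    rw [abs_mul, abs_mul, abs_of_pos (by positivity : 0 < 1 / α + 1 / β)]
    exact mul_le_mul_of_nonneg_left (le_abs_self _) hκ.le
  have h8 : q * (1 / α + 1 / β) * Real.log (1 / μ n)
      = x₁ (-(Real.pi / 2)) i / α * Real.log (1 / μ n)
        + x₁ (Real.pi / 2) i / α * Real.log (1 / μ n)
        - -x₁ (Real.pi / 2) i / β * Real.log (1 / μ n)
        - -x₁ (-(Real.pi / 2)) i / β * Real.log (1 / μ n) := by
    rw [hq]; ring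
  have h9 := g6.trans_le h7
  rw [h8] at h9
  rw [sub_div, sub_div, add_div] at g5
  rw [abs_le] at g1 g2 g3 g4
  rw [abs_lt] at g5
  rcases lt_abs.1 h9 with h | h <;> linarith

end PerturbedOrbits

/-! ### Energies of the arcs -/

/-- The integral of `u / sin` over an arc. -/
noncomputable def sinMean (u : ℝ → ℝ) : ℝ := ∫ t in (0 : ℝ)..Real.pi, u t / Real.sin t

/-- The integral over an arc of the squared distance of `u / sin` to its average. -/
noncomputable def sinVariance (u : ℝ → ℝ) : ℝ :=
  (∫ t in (0 : ℝ)..Real.pi, (u t / Real.sin t) ^ 2) - sinMean u ^ 2 / Real.pi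

/-- A component of `s ↦ x s - sin s • w` on the front arc. -/
noncomputable def frontProfile (x : ℝ → E3) (w : E3) (i : Fin 3) (t : ℝ) : ℝ :=
  x (t - Real.pi / 2) i + w i * Real.cos t

/-- A component of `s ↦ x s - sin s • w` on the back arc. -/
noncomputable def backProfile (x : ℝ → E3) (w : E3) (i : Fin 3) (t : ℝ) : ℝ :=
  x (t + Real.pi / 2) i + -w i * Real.cos t

theorem intervalIntegrable_div_sin {u g : ℝ → ℝ} (H : HasL2Density u g) (h0 : u 0 = 0)
    (hpi : u Real.pi = 0) :
    IntervalIntegrable (fun t => u t / Real.sin t) volume 0 Real.pi :=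
  intervalIntegrable_of_sq (H.continuous.measurable.div Real.measurable_sin)
    (intervalIntegrable_and_integral_div_sin_sq_le H h0 hpi).1

theorem sinVariance_nonneg {u g : ℝ → ℝ} (H : HasL2Density u g) (h0 : u 0 = 0)
    (hpi : u Real.pi = 0) : 0 ≤ sinVariance u := by
  rw [sinVariance, sinMean, ← integral_sub_average_sq (intervalIntegrable_div_sin H h0 hpi)
    (intervalIntegrable_and_integral_div_sin_sq_le H h0 hpi).1]
  exact intervalIntegral.integral_nonneg Real.pi_pos.le fun t _ => sq_nonneg _

theorem hasL2Density_cos : HasL2Density Real.cos fun t => -Real.sin t := by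
  refine ⟨Real.continuous_sin.neg.stronglyMeasurable, fun a b =>
    (Real.continuous_sin.neg.norm.pow 2).intervalIntegrable a b, fun a b => ?_⟩
  rw [intervalIntegral.integral_neg, integral_sin]
  ring

theorem HasL2Density.add_mul_cos {u g : ℝ → ℝ} (H : HasL2Density u g) (c : ℝ) :
    HasL2Density (fun t => u t + c * Real.cos t) (fun t => g t - c * Real.sin t) := by
  have := H.add (hasL2Density_cos.const_smul c)
  simpa [sub_eq_add_neg] using this

section Profile

variable {x : ℝ → E3} {w : E3}

theorem MemH1.hasL2Density_frontProfile (H : MemH1 x) (w : E3) (i : Fin 3) :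
    HasL2Density (frontProfile x w i)
      (fun t => deriv x (t - Real.pi / 2) i - w i * Real.sin t) :=
  ((H.hasL2Density.apply i).comp_sub (Real.pi / 2)).add_mul_cos (w i)

theorem MemH1.hasL2Density_backProfile (H : MemH1 x) (w : E3) (i : Fin 3) :
    HasL2Density (backProfile x w i)
      (fun t => deriv x (t + Real.pi / 2) i - -w i * Real.sin t) :=
  ((H.hasL2Density.apply i).comp_add (Real.pi / 2)).add_mul_cos (-w i)

theorem frontProfile_ends (hp : x (Real.pi / 2) = w) (hq : x (-(Real.pi / 2)) = -w) (i : Fin 3) :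
    frontProfile x w i 0 = 0 ∧ frontProfile x w i Real.pi = 0 := by
  constructor
  · rw [frontProfile, zero_sub, hq]; simp
  · rw [frontProfile, sub_half, hp]; simp

theorem backProfile_ends (H : MemH1 x) (hp : x (Real.pi / 2) = w) (hq : x (-(Real.pi / 2)) = -w)
    (i : Fin 3) : backProfile x w i 0 = 0 ∧ backProfile x w i Real.pi = 0 := by
  constructor
  · rw [backProfile, zero_add, hp]; simp
  · rw [backProfile, show Real.pi + Real.pi / 2 = 3 * Real.pi / 2 by ring,
      apply_three_pi_div_two H.periodic, hq]; simp

theorem MemH1.sinVariance_frontProfile (H : MemH1 x) (hp : x (Real.pi / 2) = w)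
    (hq : x (-(Real.pi / 2)) = -w) (i : Fin 3) :
    0 ≤ sinVariance (frontProfile x w i) ∧
      sinVariance (frontProfile x w i) ≤ 4 * frontEnergy x i := by
  obtain ⟨h0, hpi⟩ := frontProfile_ends hp hq i
  refine ⟨sinVariance_nonneg (H.hasL2Density_frontProfile w i) h0 hpi, ?_⟩
  rw [frontEnergy,
    ← integral_sq_sub_sq_add_cos ((H.hasL2Density.apply i).comp_sub (Real.pi / 2)) (w i)]
  exact variance_div_sin_le (H.hasL2Density_frontProfile w i) h0 hpi

theorem MemH1.sinVariance_backProfile (H : MemH1 x) (hp : x (Real.pi / 2) = w)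
    (hq : x (-(Real.pi / 2)) = -w) (i : Fin 3) :
    0 ≤ sinVariance (backProfile x w i) ∧
      sinVariance (backProfile x w i) ≤ 4 * backEnergy x i := by
  obtain ⟨h0, hpi⟩ := backProfile_ends H hp hq i
  refine ⟨sinVariance_nonneg (H.hasL2Density_backProfile w i) h0 hpi, ?_⟩
  rw [backEnergy,
    ← integral_sq_sub_sq_add_cos ((H.hasL2Density.apply i).comp_add (Real.pi / 2)) (-w i)]
  exact variance_div_sin_le (H.hasL2Density_backProfile w i) h0 hpi

/-- A perturbation whose profiles have no variance is tangential, if their transversal means are related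
as for perturbations by collapsed orbits. -/
theorem MemH1.mem_tangentialDirections (H : MemH1 x) {a b : ℝ} (ha : a ≠ 0)
    (hw : a = b ∨ w = 0) (hp : x (Real.pi / 2) = w) (hq : x (-(Real.pi / 2)) = -w)
    (hmean : ∀ i : Fin 3, i ≠ 0 →
      a * sinMean (backProfile x w i) = -(b * sinMean (frontProfile x w i)))
    (hA : ∀ i, sinVariance (frontProfile x w i) ≤ 0)
    (hB : ∀ i, sinVariance (backProfile x w i) ≤ 0) :
    x ∈ tangentialDirections (baseOrbit a b) := by
  refine OrbitVariation.mem_tangentialDirections ha H.periodic (w := w)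
    (m := WithLp.toLp 2 fun i => sinMean (frontProfile x w i) / Real.pi)
    (m' := WithLp.toLp 2 fun i => sinMean (backProfile x w i) / Real.pi) hw ?_ ?_ ?_ ?_
  · simp only [mul_div_assoc', hmean 1 (by decide), neg_div]
  · simp only [mul_div_assoc', hmean 2 (by decide), neg_div]
  · intro t ht
    ext i
    obtain ⟨h0, hpi⟩ := frontProfile_ends hp hq i
    have := eq_mul_sin_of_variance_le (H.hasL2Density_frontProfile w i) h0 hpi (hA i) t ht
    rw [← sinMean, frontProfile] at this
    simp only [PiLp.sub_apply, PiLp.smul_apply, smul_eq_mul]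
    linarith
  · intro t ht
    ext i
    obtain ⟨h0, hpi⟩ := backProfile_ends H hp hq i
    have := eq_mul_sin_of_variance_le (H.hasL2Density_backProfile w i) h0 hpi (hB i) t ht
    rw [← sinMean, backProfile] at this
    simp only [PiLp.add_apply, PiLp.smul_apply, smul_eq_mul]
    linarith

end Profile

/-- A perturbation that vanishes at both ends of an arc is integrable against the weight in the
second order expansion of the deficit. -/
theorem HasL2Density.intervalIntegrable_norm_sq_div_sq {u g : ℝ → E3} (H : HasL2Density u g)
    (h0 : u 0 = 0) (hpi : u Real.pi = 0) :
    IntervalIntegrable (fun t => ‖u t‖ ^ 2 / t ^ 2) volume 0 (Real.pi / 2) := by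
  have hs : uIcc 0 (Real.pi / 2) ⊆ uIcc 0 Real.pi := by
    rw [uIcc_of_le (by positivity), uIcc_of_le Real.pi_pos.le]
    exact Icc_subset_Icc le_rfl (by linarith [Real.pi_pos])
  have hi : ∀ i : Fin 3,
      IntervalIntegrable (fun t => (u t i / Real.sin t) ^ 2) volume 0 (Real.pi / 2) := fun i =>
    (intervalIntegrable_and_integral_div_sin_sq_le (H.apply i) (by simp [h0])
      (by simp [hpi])).1.mono_set hs
  refine (((hi 0).add (hi 1)).add (hi 2)).mono_fun
    ((H.continuous.norm.pow 2).measurable.div (by fun_prop)).aestronglyMeasurable ?_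
  rw [EventuallyLE, ae_restrict_iff' measurableSet_uIoc]
  refine ae_of_all _ fun t ht => ?_
  rw [uIoc_of_le (by positivity)] at ht
  obtain ⟨-, hsin⟩ := HalfExpansion.mem_Ioc_pi_div_two ht
  rw [Real.norm_of_nonneg (by positivity), Real.norm_of_nonneg (by positivity), norm_sq_eq_sum,
    div_pow, div_pow, div_pow, ← add_div, ← add_div]
  exact div_le_div_of_nonneg_left (by positivity) (by positivity)
    (pow_le_pow_left₀ hsin.le (Real.sin_le ht.1.le) 2)

namespace PerturbedOrbits

variable {α β : ℝ} {μ : ℕ → ℝ} {X : ℕ → ℝ → E3} {x₁ x₂ : ℝ → E3}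

/-! ### The case of two equal arcs -/

/-- The transversal components of the closing condition to first order. The ends of the arcs need not
be fixed, so front and back arcs have to be paired for the logarithmic terms to cancel. -/
theorem sinMean_add_eq_zero_of_eq (P : PerturbedOrbits α α μ X x₁ x₂) (hα : 0 < α) {w : E3}
    (hp : x₁ (Real.pi / 2) = w) (hq : x₁ (-(Real.pi / 2)) = -w) {i : Fin 3} (hi : i ≠ 0) :
    sinMean (backProfile x₁ w i) = -sinMean (frontProfile x₁ w i) := by
  have he := norm_single_one 0
  have hf := inner_single_one_single_zero hi
  have h13 := P.frontStart.tendsto_integral_inner_sub P.backStart hα he P.pos P.tendsto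
    (by simp only [halfArc_zero, hp, hq]; simp) hf
  have h24 := P.frontEnd.tendsto_integral_inner_sub P.backEnd hα he P.pos P.tendsto
    (by simp only [halfArc_zero, hp, apply_three_pi_div_two P.mem₁.periodic, hq]; simp) hf
  have hint : ∀ {σ c η : ℝ} n, Continuous (halfArc σ c η (X n)) → IntervalIntegrable
      (fun t => inner ℝ (EuclideanSpace.single i (1 : ℝ) : E3) (halfArc σ c η (X n) t)
        / ‖halfArc σ c η (X n) t‖) volume 0 (Real.pi / 2) := fun n hc =>
    intervalIntegrable_inner_div_norm hc _ _ _
  have h5 := tendsto_nhds_unique (h13.add h24) ((P.closing i hi).congr fun n => by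
    rw [P.closingIntegral_eq]
    simp only [intervalIntegral.integral_div]
    rw [intervalIntegral.integral_sub (hint n (P.frontStart.cont n)) (hint n (P.backStart.cont n)),
      intervalIntegral.integral_sub (hint n (P.frontEnd.cont n)) (hint n (P.backEnd.cont n))]
    ring)
  have hA := intervalIntegrable_div_sin (P.mem₁.hasL2Density_frontProfile w i)
    (frontProfile_ends hp hq i).1 (frontProfile_ends hp hq i).2
  have hB := intervalIntegrable_div_sin (P.mem₁.hasL2Density_backProfile w i)
    (backProfile_ends P.mem₁ hp hq i).1 (backProfile_ends P.mem₁ hp hq i).2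
  have h6 : sinMean (frontProfile x₁ w i) + sinMean (backProfile x₁ w i) = 0 := by
    rw [sinMean, sinMean, ← intervalIntegral.integral_add hA hB,
      integral_arc_eq_halves (hA.add hB)]
    have h7 : ∀ a b : ℝ, α⁻¹ * (a + b) = 0 → a + b = 0 := fun a b h => by
      simpa [hα.ne'] using h
    refine h7 _ _ ?_
    rw [mul_add, ← h5, ← intervalIntegral.integral_const_mul, ← intervalIntegral.integral_const_mul]
    congr 2
    · funext t
      rw [inner_single_one]
      simp only [halfArc, frontProfile, backProfile, one_smul, neg_one_smul, sub_neg_eq_add,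
        PiLp.add_apply, one_mul, neg_add_eq_sub, add_comm (Real.pi / 2) t]
      rw [← add_div, mul_comm α, ← div_div, div_eq_inv_mul _ α]
      ring
    · funext t
      rw [inner_single_one]
      simp only [halfArc, frontProfile, backProfile, one_smul, neg_one_smul, sub_neg_eq_add,
        PiLp.add_apply, Real.sin_pi_sub]
      rw [← add_div, mul_comm α, ← div_div, div_eq_inv_mul _ α,
        show Real.pi - t - Real.pi / 2 = Real.pi / 2 + -1 * t by ring,
        show Real.pi - t + Real.pi / 2 = 3 * Real.pi / 2 + -1 * t by ring]
      ring
  linarith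

/-- For `α = β` the second variation is the functional itself, and nonnegative by the spectral gap
applied to `x₁ - sin • w`, where `w = x₁ (π / 2)`. -/
theorem second_variation_of_eq (P : PerturbedOrbits α α μ X x₁ x₂) (hα : 0 < α) :
    0 ≤ lagrangeFunctional x₁ ∧
      (lagrangeFunctional x₁ = 0 → x₁ ∈ tangentialDirections (baseOrbit α α)) := by
  have hends : x₁ (-(Real.pi / 2)) = -x₁ (Real.pi / 2) := by
    have h0 := P.first_order hα hα
    have h1 := P.transversal_ends hα hα (i := 1) (by decide)
    have h2 := P.transversal_ends hα hα (i := 2) (by decide)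
    rw [sub_self, mul_zero, add_zero] at h0
    have h3 : x₁ (Real.pi / 2) 0 + x₁ (-(Real.pi / 2)) 0 = 0 :=
      (mul_eq_zero.1 h0).resolve_right (by positivity)
    ext i
    rw [PiLp.neg_apply]
    fin_cases i <;> simp only [Fin.zero_eta, Fin.mk_one, Fin.reduceFinMk] <;> linarith
  have hA := P.mem₁.sinVariance_frontProfile rfl hends
  have hB := P.mem₁.sinVariance_backProfile rfl hends
  have hL := P.mem₁.two_mul_lagrangeFunctional
  refine ⟨by linarith [hA 0, hA 1, hA 2, hB 0, hB 1, hB 2], fun h0 => ?_⟩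
  refine P.mem₁.mem_tangentialDirections hα.ne' (Or.inl rfl) rfl hends (fun i hi => ?_)
    (fun i => ?_) fun i => ?_
  · rw [P.sinMean_add_eq_zero_of_eq hα rfl hends hi, mul_neg]
  · fin_cases i <;> simp only [Fin.zero_eta, Fin.mk_one, Fin.reduceFinMk] <;>
      linarith [hA 0, hA 1, hA 2, hB 0, hB 1, hB 2]
  · fin_cases i <;> simp only [Fin.zero_eta, Fin.mk_one, Fin.reduceFinMk] <;>
      linarith [hA 0, hA 1, hA 2, hB 0, hB 1, hB 2]

/-! ### The case of two unequal arcs -/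

/-- Since `1 / β > 1 / α`, the deficits at the ends can balance only if they vanish. -/
theorem ends_eq_zero (P : PerturbedOrbits α β μ X x₁ x₂) (hβ : 0 < β) (hβα : β < α)
    (h0 : x₁ (Real.pi / 2) 0 + x₁ (-(Real.pi / 2)) 0 = 0) :
    x₁ (Real.pi / 2) = 0 ∧ x₁ (-(Real.pi / 2)) = 0 := by
  have h1 := P.first_order (hβ.trans hβα) hβ
  rw [h0, zero_mul, zero_add] at h1
  have h2 : 0 < 1 / β - 1 / α := sub_pos.2 (one_div_lt_one_div_of_lt hβ hβα)
  have h3 := (mul_eq_zero.1 h1).resolve_right h2.ne'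
  have h4 := norm_nonneg (x₁ (Real.pi / 2))
  have h5 := norm_nonneg (x₁ (-(Real.pi / 2)))
  exact ⟨norm_eq_zero.1 (by linarith), norm_eq_zero.1 (by linarith)⟩

theorem intervalIntegrable_halfArc (P : PerturbedOrbits α β μ X x₁ x₂) {σ c η : ℝ}
    (hη : |η| = 1) (h0 : x₁ c = 0) (h1 : x₁ (c + η * Real.pi) = 0) :
    IntervalIntegrable (fun t => ‖halfArc σ c η x₁ t‖ ^ 2 / t ^ 2) volume 0 (Real.pi / 2) := by
  have hη0 : η ≠ 0 := fun h0 => by simp [h0] at hη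
  exact ((P.mem₁.hasL2Density.comp_affine c hη0).const_smul σ).intervalIntegrable_norm_sq_div_sq
    (by simp [h0]) (by simp [h1])

theorem transversal_eq (v : E3) :
    ‖v‖ ^ 2 - inner ℝ (EuclideanSpace.single 0 (1 : ℝ) : E3) v ^ 2 = v 1 ^ 2 + v 2 ^ 2 := by
  rw [inner_single_one, norm_sq_eq_sum]
  ring

/-- The deficit of the front arc to second order. -/
theorem tendsto_front_deficit (P : PerturbedOrbits α β μ X x₁ x₂) (hα : 0 < α)
    (hp : x₁ (Real.pi / 2) = 0) (hq : x₁ (-(Real.pi / 2)) = 0) :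
    Tendsto (fun n => ((∫ t in (0 : ℝ)..(Real.pi / 2),
        deficit (EuclideanSpace.single 0 (1 : ℝ) : E3) (halfArc 1 (-(Real.pi / 2)) 1 (X n) t))
      + ∫ t in (0 : ℝ)..(Real.pi / 2),
        deficit (EuclideanSpace.single 0 (1 : ℝ) : E3) (halfArc 1 (Real.pi / 2) (-1) (X n) t))
        / μ n ^ 2) atTop
      (𝓝 (((∫ t in (0 : ℝ)..Real.pi, (frontProfile x₁ 0 1 t / Real.sin t) ^ 2)
          + ∫ t in (0 : ℝ)..Real.pi, (frontProfile x₁ 0 2 t / Real.sin t) ^ 2) / (2 * α ^ 2)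
        + ((‖x₂ (Real.pi / 2)‖ - x₂ (Real.pi / 2) 0)
          + (‖x₂ (-(Real.pi / 2))‖ - x₂ (-(Real.pi / 2)) 0)) / α)) := by
  have he := norm_single_one 0
  have hq' : x₁ (-(Real.pi / 2)) = -0 := by rw [hq, neg_zero]
  have h1 := P.frontStart.tendsto_integral_deficit_div_sq hα he P.pos P.tendsto
    (by simp [halfArc_zero, hq]) (P.intervalIntegrable_halfArc (by simp) hq
      (by rw [show -(Real.pi / 2) + 1 * Real.pi = Real.pi / 2 by ring, hp]))
  have h2 := P.frontEnd.tendsto_integral_deficit_div_sq hα he P.pos P.tendsto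
    (by simp [halfArc_zero, hp]) (P.intervalIntegrable_halfArc (by simp) hp
      (by rw [show Real.pi / 2 + -1 * Real.pi = -(Real.pi / 2) by ring, hq]))
  have hi : ∀ i, IntervalIntegrable (fun t => (frontProfile x₁ 0 i t / Real.sin t) ^ 2) volume 0
      Real.pi := fun i =>
    (intervalIntegrable_and_integral_div_sin_sq_le (P.mem₁.hasL2Density_frontProfile 0 i)
      (frontProfile_ends hp hq' i).1 (frontProfile_ends hp hq' i).2).1
  have hsum : ((∫ t in (0 : ℝ)..Real.pi, (frontProfile x₁ 0 1 t / Real.sin t) ^ 2)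
          + ∫ t in (0 : ℝ)..Real.pi, (frontProfile x₁ 0 2 t / Real.sin t) ^ 2) / (2 * α ^ 2)
      = (∫ t in (0 : ℝ)..(Real.pi / 2), (‖halfArc 1 (-(Real.pi / 2)) 1 x₁ t‖ ^ 2
          - inner ℝ (EuclideanSpace.single 0 (1 : ℝ) : E3) (halfArc 1 (-(Real.pi / 2)) 1 x₁ t) ^ 2)
            / (2 * (α * Real.sin t) ^ 2))
        + ∫ t in (0 : ℝ)..(Real.pi / 2), (‖halfArc 1 (Real.pi / 2) (-1) x₁ t‖ ^ 2
          - inner ℝ (EuclideanSpace.single 0 (1 : ℝ) : E3) (halfArc 1 (Real.pi / 2) (-1) x₁ t) ^ 2)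
            / (2 * (α * Real.sin t) ^ 2) := by
    rw [← intervalIntegral.integral_add (hi 1) (hi 2), integral_arc_eq_halves ((hi 1).add (hi 2)),
      add_div, ← intervalIntegral.integral_div, ← intervalIntegral.integral_div]
    simp only [transversal_eq]
    congr 2
    · funext t
      simp only [halfArc, frontProfile, one_smul, one_mul, neg_add_eq_sub, PiLp.zero_apply,
        zero_mul, add_zero]
      rw [div_pow, div_pow, ← add_div, div_div]
      ring
    · funext t
      simp only [halfArc, frontProfile, one_smul, PiLp.zero_apply,
        zero_mul, add_zero, Real.sin_pi_sub,
        show Real.pi - t - Real.pi / 2 = Real.pi / 2 + -1 * t by ring]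
      rw [div_pow, div_pow, ← add_div, div_div]
      ring
  rw [hsum]
  have h3 := h1.add h2
  simp only [intervalIntegral.integral_div, halfArc_zero, one_smul, inner_single_one 0 (x₂ _),
    ← add_div] at h3
  convert! h3 using 2
  ring

/-- The deficit of the back arc to second order. -/
theorem tendsto_back_deficit (P : PerturbedOrbits α β μ X x₁ x₂) (hβ : 0 < β)
    (hp : x₁ (Real.pi / 2) = 0) (hq : x₁ (-(Real.pi / 2)) = 0) :
    Tendsto (fun n => ((∫ t in (0 : ℝ)..(Real.pi / 2),
        deficit (EuclideanSpace.single 0 (1 : ℝ) : E3) (halfArc (-1) (Real.pi / 2) 1 (X n) t))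
      + ∫ t in (0 : ℝ)..(Real.pi / 2),
        deficit (EuclideanSpace.single 0 (1 : ℝ) : E3) (halfArc (-1) (3 * Real.pi / 2) (-1) (X n) t))
        / μ n ^ 2) atTop
      (𝓝 (((∫ t in (0 : ℝ)..Real.pi, (backProfile x₁ 0 1 t / Real.sin t) ^ 2)
          + ∫ t in (0 : ℝ)..Real.pi, (backProfile x₁ 0 2 t / Real.sin t) ^ 2) / (2 * β ^ 2)
        + ((‖x₂ (Real.pi / 2)‖ + x₂ (Real.pi / 2) 0)
          + (‖x₂ (-(Real.pi / 2))‖ + x₂ (-(Real.pi / 2)) 0)) / β)) := by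
  have he := norm_single_one 0
  have hq' : x₁ (-(Real.pi / 2)) = -0 := by rw [hq, neg_zero]
  have hq3 : x₁ (3 * Real.pi / 2) = 0 := by rw [apply_three_pi_div_two P.mem₁.periodic, hq]
  have h1 := P.backStart.tendsto_integral_deficit_div_sq hβ he P.pos P.tendsto
    (by simp [halfArc_zero, hp]) (P.intervalIntegrable_halfArc (by simp) hp
      (by rw [show Real.pi / 2 + 1 * Real.pi = 3 * Real.pi / 2 by ring, hq3]))
  have h2 := P.backEnd.tendsto_integral_deficit_div_sq hβ he P.pos P.tendsto
    (by simp [halfArc_zero, hq3]) (P.intervalIntegrable_halfArc (by simp) hq3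
      (by rw [show 3 * Real.pi / 2 + -1 * Real.pi = Real.pi / 2 by ring, hp]))
  have hi : ∀ i, IntervalIntegrable (fun t => (backProfile x₁ 0 i t / Real.sin t) ^ 2) volume 0
      Real.pi := fun i =>
    (intervalIntegrable_and_integral_div_sin_sq_le (P.mem₁.hasL2Density_backProfile 0 i)
      (backProfile_ends P.mem₁ hp hq' i).1 (backProfile_ends P.mem₁ hp hq' i).2).1
  have hsum : ((∫ t in (0 : ℝ)..Real.pi, (backProfile x₁ 0 1 t / Real.sin t) ^ 2)
          + ∫ t in (0 : ℝ)..Real.pi, (backProfile x₁ 0 2 t / Real.sin t) ^ 2) / (2 * β ^ 2)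
      = (∫ t in (0 : ℝ)..(Real.pi / 2), (‖halfArc (-1) (Real.pi / 2) 1 x₁ t‖ ^ 2
          - inner ℝ (EuclideanSpace.single 0 (1 : ℝ) : E3) (halfArc (-1) (Real.pi / 2) 1 x₁ t) ^ 2)
            / (2 * (β * Real.sin t) ^ 2))
        + ∫ t in (0 : ℝ)..(Real.pi / 2), (‖halfArc (-1) (3 * Real.pi / 2) (-1) x₁ t‖ ^ 2
          - inner ℝ (EuclideanSpace.single 0 (1 : ℝ) : E3)
            (halfArc (-1) (3 * Real.pi / 2) (-1) x₁ t) ^ 2) / (2 * (β * Real.sin t) ^ 2) := by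
    rw [← intervalIntegral.integral_add (hi 1) (hi 2), integral_arc_eq_halves ((hi 1).add (hi 2)),
      add_div, ← intervalIntegral.integral_div, ← intervalIntegral.integral_div]
    simp only [transversal_eq]
    congr 2
    · funext t
      simp only [halfArc, backProfile, neg_one_smul, PiLp.neg_apply, neg_sq, one_mul,
        add_comm (Real.pi / 2) t, PiLp.zero_apply, neg_zero, zero_mul, add_zero]
      rw [div_pow, div_pow, ← add_div, div_div]
      ring
    · funext t
      simp only [halfArc, backProfile, neg_one_smul, PiLp.neg_apply, neg_sq, PiLp.zero_apply,
        neg_zero, zero_mul, add_zero, Real.sin_pi_sub,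
        show Real.pi - t + Real.pi / 2 = 3 * Real.pi / 2 + -1 * t by ring]
      rw [div_pow, div_pow, ← add_div, div_div]
      ring
  rw [hsum]
  have h3 := h1.add h2
  simp only [intervalIntegral.integral_div, halfArc_zero, neg_one_smul, norm_neg,
    inner_neg_right (EuclideanSpace.single 0 (1 : ℝ) : E3) (x₂ _), inner_single_one 0 (x₂ _),
    apply_three_pi_div_two P.mem₂.periodic, sub_neg_eq_add, ← add_div] at h3
  convert! h3 using 2
  ring

end PerturbedOrbits

namespace PerturbedOrbits

variable {α β : ℝ} {μ : ℕ → ℝ} {X : ℕ → ℝ → E3} {x₁ x₂ : ℝ → E3}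

/-- The transversal components of the closing condition to first order. -/
theorem sinMean_back_eq (P : PerturbedOrbits α β μ X x₁ x₂) (hα : 0 < α) (hβ : 0 < β)
    (hp : x₁ (Real.pi / 2) = 0) (hq : x₁ (-(Real.pi / 2)) = 0) {i : Fin 3} (hi : i ≠ 0) :
    α * sinMean (backProfile x₁ 0 i) = -(β * sinMean (frontProfile x₁ 0 i)) := by
  have he := norm_single_one 0
  have hf := inner_single_one_single_zero hi
  have hq' : x₁ (-(Real.pi / 2)) = -0 := by rw [hq, neg_zero]
  have hq3 : x₁ (3 * Real.pi / 2) = 0 := by rw [apply_three_pi_div_two P.mem₁.periodic, hq]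
  have h1 := P.frontStart.tendsto_integral_inner hα he P.pos P.tendsto
    (by simp [halfArc_zero, hq]) hf
  have h2 := P.frontEnd.tendsto_integral_inner hα he P.pos P.tendsto
    (by simp [halfArc_zero, hp]) hf
  have h3 := P.backStart.tendsto_integral_inner hβ he P.pos P.tendsto
    (by simp [halfArc_zero, hp]) hf
  have h4 := P.backEnd.tendsto_integral_inner hβ he P.pos P.tendsto
    (by simp [halfArc_zero, hq3]) hf
  have h5 := tendsto_nhds_unique (((h1.add h2).sub h3).sub h4) ((P.closing i hi).congr fun n => by
    rw [P.closingIntegral_eq]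
    simp only [intervalIntegral.integral_div]
    ring)
  have hA := intervalIntegrable_div_sin (P.mem₁.hasL2Density_frontProfile 0 i)
    (frontProfile_ends hp hq' i).1 (frontProfile_ends hp hq' i).2
  have hB := intervalIntegrable_div_sin (P.mem₁.hasL2Density_backProfile 0 i)
    (backProfile_ends P.mem₁ hp hq' i).1 (backProfile_ends P.mem₁ hp hq' i).2
  have h6 : α⁻¹ * sinMean (frontProfile x₁ 0 i)
      = (∫ t in (0 : ℝ)..(Real.pi / 2), inner ℝ (EuclideanSpace.single i (1 : ℝ) : E3)
          (halfArc 1 (-(Real.pi / 2)) 1 x₁ t) / (α * Real.sin t))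
        + ∫ t in (0 : ℝ)..(Real.pi / 2), inner ℝ (EuclideanSpace.single i (1 : ℝ) : E3)
          (halfArc 1 (Real.pi / 2) (-1) x₁ t) / (α * Real.sin t) := by
    rw [sinMean, integral_arc_eq_halves hA, mul_add, ← intervalIntegral.integral_const_mul,
      ← intervalIntegral.integral_const_mul]
    congr 2
    · funext t
      rw [inner_single_one]
      simp only [halfArc, frontProfile, one_smul, one_mul, neg_add_eq_sub, PiLp.zero_apply,
        zero_mul, add_zero]
      rw [mul_comm α, ← div_div, div_eq_inv_mul _ α]
    · funext t
      rw [inner_single_one]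
      simp only [halfArc, frontProfile, one_smul, PiLp.zero_apply, zero_mul, add_zero,
        Real.sin_pi_sub, show Real.pi - t - Real.pi / 2 = Real.pi / 2 + -1 * t by ring]
      rw [mul_comm α, ← div_div, div_eq_inv_mul _ α]
  have h7 : -(β⁻¹ * sinMean (backProfile x₁ 0 i))
      = (∫ t in (0 : ℝ)..(Real.pi / 2), inner ℝ (EuclideanSpace.single i (1 : ℝ) : E3)
          (halfArc (-1) (Real.pi / 2) 1 x₁ t) / (β * Real.sin t))
        + ∫ t in (0 : ℝ)..(Real.pi / 2), inner ℝ (EuclideanSpace.single i (1 : ℝ) : E3)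
          (halfArc (-1) (3 * Real.pi / 2) (-1) x₁ t) / (β * Real.sin t) := by
    rw [sinMean, integral_arc_eq_halves hB, mul_add, neg_add,
      ← intervalIntegral.integral_const_mul, ← intervalIntegral.integral_const_mul,
      ← intervalIntegral.integral_neg, ← intervalIntegral.integral_neg]
    congr 2
    · funext t
      rw [inner_single_one]
      simp only [halfArc, backProfile, neg_one_smul, PiLp.neg_apply, one_mul,
        add_comm (Real.pi / 2) t, PiLp.zero_apply, neg_zero, zero_mul, add_zero]
      rw [mul_comm β, ← div_div, div_eq_inv_mul _ β]
      ring
    · funext t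
      rw [inner_single_one]
      simp only [halfArc, backProfile, neg_one_smul, PiLp.neg_apply, PiLp.zero_apply, neg_zero,
        zero_mul, add_zero, Real.sin_pi_sub,
        show Real.pi - t + Real.pi / 2 = 3 * Real.pi / 2 + -1 * t by ring]
      rw [mul_comm β, ← div_div, div_eq_inv_mul _ β]
      ring
  have h8 : α⁻¹ * sinMean (frontProfile x₁ 0 i) + β⁻¹ * sinMean (backProfile x₁ 0 i) = 0 := by
    linarith
  field_simp at h8
  linarith

/-- The component of the closing condition along the line of the collapsed orbit, to second
order. -/
theorem second_order (P : PerturbedOrbits α β μ X x₁ x₂) (hα : 0 < α) (hβ : 0 < β)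
    (hp : x₁ (Real.pi / 2) = 0) (hq : x₁ (-(Real.pi / 2)) = 0) :
    (x₂ (Real.pi / 2) 0 + x₂ (-(Real.pi / 2)) 0) * (1 / α + 1 / β)
      + (‖x₂ (Real.pi / 2)‖ + ‖x₂ (-(Real.pi / 2))‖) * (1 / β - 1 / α)
      + ((∫ t in (0 : ℝ)..Real.pi, (backProfile x₁ 0 1 t / Real.sin t) ^ 2)
          + ∫ t in (0 : ℝ)..Real.pi, (backProfile x₁ 0 2 t / Real.sin t) ^ 2) / (2 * β ^ 2)
      - ((∫ t in (0 : ℝ)..Real.pi, (frontProfile x₁ 0 1 t / Real.sin t) ^ 2)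
          + ∫ t in (0 : ℝ)..Real.pi, (frontProfile x₁ 0 2 t / Real.sin t) ^ 2) / (2 * α ^ 2)
      = 0 := by
  have h := tendsto_nhds_unique ((P.tendsto_back_deficit hβ hp hq).sub
    (P.tendsto_front_deficit hα hp hq)) (P.closing₀.congr fun n => by
      rw [P.closingIntegral_zero_eq]
      ring)
  linear_combination h

/-- For `0 < β < α` the second order closing condition yields the value of the first term of the second
variation. Its negative contribution, from the front arc, is absorbed by the spectral gap. -/
theorem second_variation_of_lt (P : PerturbedOrbits α β μ X x₁ x₂) (hβ : 0 < β) (hβα : β < α)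
    (h0 : x₁ (Real.pi / 2) 0 + x₁ (-(Real.pi / 2)) 0 = 0) :
    0 ≤ -(α - β) * (x₂ (Real.pi / 2) 0 + x₂ (-(Real.pi / 2)) 0) + lagrangeFunctional x₁ ∧
      (-(α - β) * (x₂ (Real.pi / 2) 0 + x₂ (-(Real.pi / 2)) 0) + lagrangeFunctional x₁ = 0 →
        x₁ ∈ tangentialDirections (baseOrbit α β)) := by
  have hα := hβ.trans hβα
  obtain ⟨hp, hq⟩ := P.ends_eq_zero hβ hβα h0
  have hq' : x₁ (-(Real.pi / 2)) = -0 := by rw [hq, neg_zero]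
  have hA := P.mem₁.sinVariance_frontProfile hp hq'
  have hB := P.mem₁.sinVariance_backProfile hp hq'
  have hm := fun i hi => P.sinMean_back_eq hα hβ hp hq (i := i) hi
  have hL := P.mem₁.two_mul_lagrangeFunctional
  have h2 := P.second_order hα hβ hp hq
  have hsq : ∀ u : ℝ → ℝ, ∫ t in (0 : ℝ)..Real.pi, (u t / Real.sin t) ^ 2
      = sinVariance u + sinMean u ^ 2 / Real.pi := fun u => by rw [sinVariance]; ring
  rw [hsq, hsq, hsq, hsq] at h2
  set S := x₂ (Real.pi / 2) 0 + x₂ (-(Real.pi / 2)) 0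
  set R := ‖x₂ (Real.pi / 2)‖ + ‖x₂ (-(Real.pi / 2))‖
  have hR : 0 ≤ R := by positivity
  -- `κ / 2` and `κ' / 2` are the coefficients of the front and back integrals of `|x₁^⊥|² / sin²`
  -- after the condition of second order has been solved for `-(α - β) S`
  set κ := (α - β) * β / (α * (α + β)) with hκ
  set κ' := (α - β) * α / (β * (α + β)) with hκ'
  have hκ'0 : 0 < κ' := div_pos (mul_pos (sub_pos.2 hβα) hα) (by positivity)
  -- equivalent to `α² - 3 α β + 4 β² > 0`, a definite form
  have hκ4 : 0 < 1 / 4 - κ := by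
    rw [sub_pos, hκ, div_lt_iff₀ (by positivity)]
    nlinarith [sq_nonneg (α - β), sq_nonneg (3 * α - 8 * β), pow_pos hα 2, pow_pos hβ 2]
  -- the means are not controlled by the energy, but cancel
  have hmean : ∀ i : Fin 3, i ≠ 0 → κ' * (sinMean (backProfile x₁ 0 i) ^ 2 / Real.pi)
      = κ * (sinMean (frontProfile x₁ 0 i) ^ 2 / Real.pi) := fun i hi => by
    have h3 : sinMean (backProfile x₁ 0 i) = -(β * sinMean (frontProfile x₁ 0 i)) / α := by
      rw [← hm i hi]; field_simp
    rw [h3, hκ, hκ']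
    field_simp
  have m1 := hmean 1 (by decide)
  have m2 := hmean 2 (by decide)
  have hS : -(α - β) * S = (α - β) ^ 2 / (α + β) * R
      + κ' / 2 * (sinVariance (backProfile x₁ 0 1) + sinVariance (backProfile x₁ 0 2))
      - κ / 2 * (sinVariance (frontProfile x₁ 0 1) + sinVariance (frontProfile x₁ 0 2)) := by
    have h4 : -(α - β) * S = (α - β) ^ 2 / (α + β) * R
      + κ' / 2 * (sinVariance (backProfile x₁ 0 1) + sinMean (backProfile x₁ 0 1) ^ 2 / Real.pi
        + (sinVariance (backProfile x₁ 0 2) + sinMean (backProfile x₁ 0 2) ^ 2 / Real.pi))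
      - κ / 2 * (sinVariance (frontProfile x₁ 0 1) + sinMean (frontProfile x₁ 0 1) ^ 2 / Real.pi
        + (sinVariance (frontProfile x₁ 0 2) + sinMean (frontProfile x₁ 0 2) ^ 2 / Real.pi)) := by
      generalize sinVariance (backProfile x₁ 0 1) + sinMean (backProfile x₁ 0 1) ^ 2 / Real.pi
        + (sinVariance (backProfile x₁ 0 2) + sinMean (backProfile x₁ 0 2) ^ 2 / Real.pi) = TB
        at h2 ⊢
      generalize sinVariance (frontProfile x₁ 0 1) + sinMean (frontProfile x₁ 0 1) ^ 2 / Real.pi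
        + (sinVariance (frontProfile x₁ 0 2) + sinMean (frontProfile x₁ 0 2) ^ 2 / Real.pi) = TA
        at h2 ⊢
      rw [hκ, hκ']
      have h5 : α + β ≠ 0 := by positivity
      field_simp at h2 ⊢
      linear_combination (-(α - β)) * h2
    rw [h4]
    linarith
  have hsum : 2 * (-(α - β) * S + lagrangeFunctional x₁)
      = 2 * ((α - β) ^ 2 / (α + β) * R)
        + κ' * (sinVariance (backProfile x₁ 0 1) + sinVariance (backProfile x₁ 0 2))
        - κ * (sinVariance (frontProfile x₁ 0 1) + sinVariance (frontProfile x₁ 0 2))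
        + ((frontEnergy x₁ 0 + backEnergy x₁ 0)
      + (frontEnergy x₁ 1 + backEnergy x₁ 1) + (frontEnergy x₁ 2 + backEnergy x₁ 2)) := by
    rw [hS, mul_add, hL]
    ring
  have hR' : 0 ≤ 2 * ((α - β) ^ 2 / (α + β) * R) := by positivity
  have hB' := mul_nonneg hκ'0.le (add_nonneg (hB 1).1 (hB 2).1)
  have hA1 := mul_nonneg hκ4.le (hA 1).1
  have hA2 := mul_nonneg hκ4.le (hA 2).1
  have hnn : (1 / 4 - κ) * sinVariance (frontProfile x₁ 0 1)
      + (1 / 4 - κ) * sinVariance (frontProfile x₁ 0 2)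
      + (sinVariance (frontProfile x₁ 0 0) + sinVariance (backProfile x₁ 0 0)
        + sinVariance (backProfile x₁ 0 1) + sinVariance (backProfile x₁ 0 2)) / 4
      ≤ 2 * (-(α - β) * S + lagrangeFunctional x₁) := by
    rw [hsum]
    linarith [hA 0, hA 1, hA 2, hB 0, hB 1, hB 2]
  refine ⟨by linarith [hA 0, hB 0, hB 1, hB 2], fun hz => ?_⟩
  rw [hz, mul_zero] at hnn
  refine P.mem₁.mem_tangentialDirections hα.ne' (Or.inr rfl) hp hq' hm (fun i => ?_) fun i => ?_
  · have h1 : sinVariance (frontProfile x₁ 0 1) ≤ 0 :=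
      nonpos_of_mul_nonpos_right (by linarith [hA 0, hB 0, hB 1, hB 2]) hκ4
    have h2 : sinVariance (frontProfile x₁ 0 2) ≤ 0 :=
      nonpos_of_mul_nonpos_right (by linarith [hA 0, hB 0, hB 1, hB 2]) hκ4
    fin_cases i <;> simp only [Fin.zero_eta, Fin.mk_one, Fin.reduceFinMk]
    · linarith [hA 0, hB 0, hB 1, hB 2]
    · exact h1
    · exact h2
  · fin_cases i <;> simp only [Fin.zero_eta, Fin.mk_one, Fin.reduceFinMk] <;>
      linarith [hA 0, hB 0, hB 1, hB 2]

end PerturbedOrbits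

/-! ### The case of a vanishing back arc -/

namespace HalfExpansion

variable {E : Type*} [NormedAddCommGroup E] [InnerProductSpace ℝ E]
  {e : E} {μ : ℕ → ℝ} {Z : ℕ → ℝ → E} {z₁ z₂ : ℝ → E}

theorem measurable_deficit {γ : ℝ} (H : HalfExpansion γ e μ Z z₁ z₂) (n : ℕ) :
    Measurable fun t => deficit e (Z n t) :=
  measurable_const.sub (H.measurable_inner_div e n)

/-- If the unperturbed arc shrinks to a point, then the direction of the perturbed arc is that of the
first order perturbation, wherever this does not vanish. If the deficit tends to zero, it must
therefore point in direction `e`. -/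
theorem eq_norm_smul_of_tendsto (H : HalfExpansion 0 e μ Z z₁ z₂) (he : ‖e‖ = 1)
    (hμ : ∀ n, 0 < μ n) (hμ0 : Tendsto μ atTop (𝓝 0))
    (h : Tendsto (fun n => ∫ t in (0 : ℝ)..(Real.pi / 2), deficit e (Z n t)) atTop (𝓝 0)) :
    ∀ t ∈ Icc 0 (Real.pi / 2), z₁ t = ‖z₁ t‖ • e := by
  classical
  have hpi : (0 : ℝ) < Real.pi / 2 := by positivity
  have hms : MeasurableSet {t | z₁ t = 0} := (isClosed_eq H.cont₁ continuous_const).measurableSet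
  have hbd : ∀ v : E, ‖deficit e v‖ ≤ 2 := fun v => by
    rw [Real.norm_of_nonneg (deficit_nonneg he v)]; exact deficit_le_two he v
  -- where `z₁` vanishes, the deficit need not converge; it is replaced by the lower bound zero
  set f : ℕ → ℝ → ℝ := fun n t => if z₁ t = 0 then 0 else deficit e (Z n t) with hf
  set g : ℝ → ℝ := fun t => if z₁ t = 0 then 0 else deficit e (z₁ t) with hg
  have hgm : Measurable g := by
    have hz := H.cont₁
    exact Measurable.ite hms measurable_const (measurable_const.sub
      ((by fun_prop : Continuous fun t => inner ℝ e (z₁ t)).measurable.div hz.norm.measurable))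
  have hg0 : ∀ t, 0 ≤ g t := fun t => by
    simp only [hg]; split_ifs
    exacts [le_rfl, deficit_nonneg he _]
  have hgi : IntervalIntegrable g volume 0 (Real.pi / 2) := by
    refine (intervalIntegrable_const (c := (2 : ℝ))).mono_fun hgm.aestronglyMeasurable
      (Eventually.of_forall fun t => ?_)
    simp only [hg]; split_ifs
    exacts [by simp, (hbd _).trans (le_abs_self _)]
  have hfm : ∀ n, Measurable (f n) := fun n =>
    Measurable.ite hms measurable_const (H.measurable_deficit n)
  have hfle : ∀ n t, 0 ≤ f n t ∧ f n t ≤ deficit e (Z n t) := fun n t => by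
    simp only [hf]; split_ifs
    exacts [⟨le_rfl, deficit_nonneg he _⟩, ⟨deficit_nonneg he _, le_rfl⟩]
  have hfb : ∀ n t, ‖f n t‖ ≤ 2 := fun n t => by
    rw [Real.norm_of_nonneg (hfle n t).1]; exact (hfle n t).2.trans (deficit_le_two he _)
  have hii : ∀ {k : ℝ → ℝ}, Measurable k → (∀ t, ‖k t‖ ≤ 2) →
      IntervalIntegrable k volume 0 (Real.pi / 2) := fun hk hb =>
    (intervalIntegrable_const (c := (2 : ℝ))).mono_fun hk.aestronglyMeasurable
      (Eventually.of_forall fun t => (hb t).trans (le_abs_self _))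
  have hlim : Tendsto (fun n => ∫ t in (0 : ℝ)..(Real.pi / 2), f n t) atTop
      (𝓝 (∫ t in (0 : ℝ)..(Real.pi / 2), g t)) := by
    refine intervalIntegral.tendsto_integral_filter_of_dominated_convergence (fun _ => 2)
      (Eventually.of_forall fun n => (hfm n).aestronglyMeasurable)
      (Eventually.of_forall fun n => ae_of_all _ fun t _ => hfb n t)
      intervalIntegrable_const (ae_of_all _ fun t ht => ?_)
    rw [uIoc_of_le hpi.le] at ht
    simp only [hf, hg]
    split_ifs with h0
    · exact tendsto_const_nhds
    · have h1 := H.tendsto_scaled hμ hμ0 (Ioc_subset_Icc_self ht)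
      refine (tendsto_const_nhds.sub (tendsto_inner_div_norm e h1 h0)).congr fun n => ?_
      rw [zero_mul, zero_smul, sub_zero, inner_div_norm_smul (inv_pos.2 (hμ n)), deficit]
  have hz : ∫ t in (0 : ℝ)..(Real.pi / 2), g t = 0 := by
    refine tendsto_nhds_unique hlim (squeeze_zero (fun n => ?_) (fun n => ?_) h)
    · exact intervalIntegral.integral_nonneg hpi.le fun t _ => (hfle n t).1
    · exact intervalIntegral.integral_mono hpi.le (hii (hfm n) (hfb n))
        (hii (H.measurable_deficit n) fun t => hbd _) fun t => (hfle n t).2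
  rw [intervalIntegral.integral_of_le hpi.le, integral_eq_zero_iff_of_nonneg hg0
    ((intervalIntegrable_iff_integrableOn_Ioc_of_le hpi.le).1 hgi), restrict_Ioc_eq_restrict_Icc]
    at hz
  refine Measure.eqOn_Icc_of_ae_eq volume hpi.ne ?_ H.cont₁.continuousOn
    (by have := H.cont₁; fun_prop)
  filter_upwards [hz] with t ht
  simp only [hg, Pi.zero_apply] at ht
  split_ifs at ht with h0
  · simp [h0]
  · have h1 : ‖z₁ t‖ ≠ 0 := norm_ne_zero_iff.2 h0
    rw [deficit, sub_eq_zero, eq_comm, div_eq_one_iff_eq h1] at ht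
    have h2 := inner_eq_norm_mul_iff_real.1 (ht.trans (by rw [he, one_mul]))
    rw [h2, he, one_smul]

/-- If the unperturbed arc shrinks to a point and the deficit is of second order, then `z₂(0)` cannot
point away from `e`: in boundary layers of width `K μ²` the curves have the direction of `z₂(0)`, so
otherwise the deficit would be at least `K μ²`, up to `o(μ²)`, for every `K`. -/
theorem inner_nonneg_of_bounded (H : HalfExpansion 0 e μ Z z₁ z₂) (he : ‖e‖ = 1)
    (hμ : ∀ n, 0 < μ n) (hμ0 : Tendsto μ atTop (𝓝 0)) (h0 : z₁ 0 = 0) {B : ℝ}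
    (h : ∀ᶠ n in atTop, ∫ t in (0 : ℝ)..(Real.pi / 2), deficit e (Z n t) / μ n ^ 2 ≤ B) :
    0 ≤ inner ℝ e (z₂ 0) := by
  by_contra! hneg
  have hz : z₂ 0 ≠ 0 := fun h => by simp [h] at hneg
  have hpi : (0 : ℝ) < Real.pi / 2 := by positivity
  have hμ2 : ∀ n, 0 < μ n ^ 2 := fun n => pow_pos (hμ n) 2
  set K : ℝ := |B| + 1 with hK
  have hK0 : 0 < K := by positivity
  have hbd : ∀ v : E, ‖deficit e v‖ ≤ 2 := fun v => by
    rw [Real.norm_of_nonneg (deficit_nonneg he v)]; exact deficit_le_two he v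
  have hii : ∀ n a b, IntervalIntegrable (fun t => deficit e (Z n t)) volume a b := fun n a b =>
    (intervalIntegrable_const (c := (2 : ℝ))).mono_fun (H.measurable_deficit n).aestronglyMeasurable
      (Eventually.of_forall fun t => (hbd _).trans (le_abs_self _))
  have hlim : Tendsto (fun n => ∫ τ in (0 : ℝ)..K, deficit e (Z n (μ n ^ 2 * τ))) atTop
      (𝓝 (∫ _ in (0 : ℝ)..K, deficit e (z₂ 0))) := by
    refine intervalIntegral.tendsto_integral_filter_of_dominated_convergence (fun _ => 2)
      (Eventually.of_forall fun n =>
        ((H.measurable_deficit n).comp (measurable_const_mul (μ n ^ 2))).aestronglyMeasurable)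
      (Eventually.of_forall fun n => ae_of_all _ fun t _ => hbd _)
      intervalIntegrable_const (ae_of_all _ fun τ hτ => ?_)
    rw [uIoc_of_le hK0.le] at hτ
    have h1 := H.tendsto_blowup_two hμ hμ0 h0 hτ.1
    rw [zero_mul, zero_smul, zero_add] at h1
    refine (tendsto_const_nhds.sub (tendsto_inner_div_norm e h1 hz)).congr fun n => ?_
    rw [inner_div_norm_smul (inv_pos.2 (hμ2 n)), deficit]
  have hlt : B < ∫ _ in (0 : ℝ)..K, deficit e (z₂ 0) := by
    rw [intervalIntegral.integral_const, sub_zero, smul_eq_mul]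
    have h1 : 1 ≤ deficit e (z₂ 0) := by
      rw [deficit]
      linarith [div_nonpos_of_nonpos_of_nonneg hneg.le (norm_nonneg (z₂ 0))]
    nlinarith [le_abs_self B]
  obtain ⟨n, hn1, hn2, hn3⟩ := (h.and ((hlim.eventually_const_lt hlt).and
    (eventually_mul_mem hμ2 (tendsto_sq_zero hμ0) hK0))).exists
  refine absurd hn1 (not_le.2 (hn2.trans_le ?_))
  rw [intervalIntegral.integral_comp_mul_left (fun t => deficit e (Z n t)) (hμ2 n).ne', mul_zero,
    intervalIntegral.integral_div, smul_eq_mul, inv_mul_eq_div]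
  refine div_le_div_of_nonneg_right ?_ (hμ2 n).le
  exact intervalIntegral.integral_mono_interval le_rfl hn3.1 hn3.2
    (ae_of_all _ fun t => deficit_nonneg he _) (hii n _ _)

end HalfExpansion

namespace PerturbedOrbits

variable {α : ℝ} {μ : ℕ → ℝ} {X : ℕ → ℝ → E3} {x₁ x₂ : ℝ → E3}

theorem integral_deficit_nonneg (Z : ℝ → E3) :
    0 ≤ ∫ t in (0 : ℝ)..(Real.pi / 2), deficit (EuclideanSpace.single 0 (1 : ℝ) : E3) (Z t) :=
  intervalIntegral.integral_nonneg (by positivity) fun t _ =>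
    deficit_nonneg (norm_single_one 0) _

/-- On the back arc, the first order perturbation is a nonpositive multiple of the direction of the
front arc, as for a collapsed orbit with nonvanishing back arc: the deficit of the front arc tends to
zero, hence so does that of the back arc. -/
theorem back_direction (P : PerturbedOrbits α 0 μ X x₁ x₂) (hα : 0 < α) :
    (∀ t ∈ Icc 0 (Real.pi / 2), halfArc (-1) (Real.pi / 2) 1 x₁ t
        = ‖halfArc (-1) (Real.pi / 2) 1 x₁ t‖ • EuclideanSpace.single 0 (1 : ℝ)) ∧
      ∀ t ∈ Icc 0 (Real.pi / 2), halfArc (-1) (3 * Real.pi / 2) (-1) x₁ t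
        = ‖halfArc (-1) (3 * Real.pi / 2) (-1) x₁ t‖ • EuclideanSpace.single 0 (1 : ℝ) := by
  have he := norm_single_one 0
  have h1 := (P.frontStart.tendsto_integral_deficit_div hα he P.pos P.tendsto).mul P.tendsto
  have h2 := (P.frontEnd.tendsto_integral_deficit_div hα he P.pos P.tendsto).mul P.tendsto
  have h3 := P.closing₀.mul (HalfExpansion.tendsto_sq_zero P.tendsto)
  rw [mul_zero] at h1 h2 h3
  have h4 := (h3.add h1).add h2
  rw [add_zero, add_zero] at h4
  have h5 : Tendsto (fun n => (∫ t in (0 : ℝ)..(Real.pi / 2),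
        deficit (EuclideanSpace.single 0 (1 : ℝ) : E3) (halfArc (-1) (Real.pi / 2) 1 (X n) t))
      + ∫ t in (0 : ℝ)..(Real.pi / 2), deficit (EuclideanSpace.single 0 (1 : ℝ) : E3)
        (halfArc (-1) (3 * Real.pi / 2) (-1) (X n) t)) atTop (𝓝 0) := by
    refine h4.congr fun n => ?_
    have hn := (P.pos n).ne'
    simp only [intervalIntegral.integral_div]
    rw [div_mul_cancel₀ _ (pow_ne_zero 2 hn), div_mul_cancel₀ _ hn, div_mul_cancel₀ _ hn,
      P.closingIntegral_zero_eq]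
    ring
  constructor
  · exact P.backStart.eq_norm_smul_of_tendsto he P.pos P.tendsto (squeeze_zero
      (fun n => integral_deficit_nonneg _)
      (fun n => le_add_of_nonneg_right (integral_deficit_nonneg _)) h5)
  · exact P.backEnd.eq_norm_smul_of_tendsto he P.pos P.tendsto (squeeze_zero
      (fun n => integral_deficit_nonneg _)
      (fun n => le_add_of_nonneg_left (integral_deficit_nonneg _)) h5)

/-- For `β = 0` both terms of the second variation are nonnegative. The first one is so because the
front deficit, and hence the back deficit, is of second order. -/
theorem second_variation_of_zero (P : PerturbedOrbits α 0 μ X x₁ x₂) (hα : 0 < α)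
    (h0 : x₁ (Real.pi / 2) 0 + x₁ (-(Real.pi / 2)) 0 = 0) :
    0 ≤ -(α - 0) * (x₂ (Real.pi / 2) 0 + x₂ (-(Real.pi / 2)) 0) + lagrangeFunctional x₁ ∧
      (-(α - 0) * (x₂ (Real.pi / 2) 0 + x₂ (-(Real.pi / 2)) 0) + lagrangeFunctional x₁ = 0 →
        x₁ ∈ tangentialDirections (baseOrbit α 0)) := by
  have he := norm_single_one 0
  obtain ⟨hd3, hd4⟩ := P.back_direction hα
  have hpi : (0 : ℝ) ≤ Real.pi / 2 := by positivity
  have hq3 := apply_three_pi_div_two P.mem₁.periodic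
  -- at the kinks, the first component of `x₁` is minus its norm, and by `h0` these add up to zero
  have hpq : x₁ (Real.pi / 2) = 0 ∧ x₁ (-(Real.pi / 2)) = 0 := by
    have e3 := hd3 0 ⟨le_rfl, hpi⟩
    have e4 := hd4 0 ⟨le_rfl, hpi⟩
    simp only [halfArc_zero, neg_one_smul, norm_neg, hq3] at e3 e4
    have c3 := congrArg (fun v : E3 => v 0) e3
    have c4 := congrArg (fun v : E3 => v 0) e4
    simp at c3 c4
    have n3 := norm_nonneg (x₁ (Real.pi / 2))
    have n4 := norm_nonneg (x₁ (-(Real.pi / 2)))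
    exact ⟨norm_eq_zero.1 (by linarith), norm_eq_zero.1 (by linarith)⟩
  obtain ⟨hp, hq⟩ := hpq
  have hq' : x₁ (-(Real.pi / 2)) = -0 := by rw [hq, neg_zero]
  have hback : ∀ i : Fin 3, i ≠ 0 → ∀ t ∈ Icc 0 Real.pi, backProfile x₁ 0 i t = 0 := by
    intro i hi t ht
    simp only [backProfile, PiLp.zero_apply, neg_zero, zero_mul, add_zero]
    rcases le_total t (Real.pi / 2) with h | h
    · have := congrArg (fun v : E3 => v i) (hd3 t ⟨ht.1, h⟩)
      simpa [halfArc, hi, add_comm (Real.pi / 2) t] using this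
    · have := congrArg (fun v : E3 => v i) (hd4 (Real.pi - t) ⟨by linarith [ht.2], by linarith⟩)
      simp only [halfArc, neg_one_smul, PiLp.neg_apply, PiLp.smul_apply,
        show 3 * Real.pi / 2 + -1 * (Real.pi - t) = t + Real.pi / 2 by ring] at this
      simpa [hi] using this
  have hmean : ∀ i : Fin 3, i ≠ 0 → sinMean (backProfile x₁ 0 i) = 0 := fun i hi => by
    rw [sinMean, intervalIntegral.integral_congr (g := fun _ => 0), intervalIntegral.integral_zero]
    intro t ht
    rw [uIcc_of_le Real.pi_pos.le] at ht
    simp only [hback i hi t ht, zero_div]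
  have hS : x₂ (Real.pi / 2) 0 ≤ 0 ∧ x₂ (-(Real.pi / 2)) 0 ≤ 0 := by
    have h1 := P.closing₀.add (P.tendsto_front_deficit hα hp hq)
    obtain ⟨B, hB⟩ := h1.bddAbove_range
    have h2 : ∀ n, (∫ t in (0 : ℝ)..(Real.pi / 2), deficit (EuclideanSpace.single 0 (1 : ℝ) : E3)
          (halfArc (-1) (Real.pi / 2) 1 (X n) t) / μ n ^ 2)
        + ∫ t in (0 : ℝ)..(Real.pi / 2), deficit (EuclideanSpace.single 0 (1 : ℝ) : E3)
          (halfArc (-1) (3 * Real.pi / 2) (-1) (X n) t) / μ n ^ 2 ≤ B := fun n => by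
      refine le_trans (le_of_eq ?_) (hB (mem_range_self n))
      rw [P.closingIntegral_zero_eq]
      simp only [intervalIntegral.integral_div]
      ring
    have hnn : ∀ (Z : ℝ → E3) n, 0 ≤ ∫ t in (0 : ℝ)..(Real.pi / 2),
        deficit (EuclideanSpace.single 0 (1 : ℝ) : E3) (Z t) / μ n ^ 2 := fun Z n => by
      rw [intervalIntegral.integral_div]
      exact div_nonneg (integral_deficit_nonneg Z) (sq_nonneg _)
    have b3 := P.backStart.inner_nonneg_of_bounded he P.pos P.tendsto
      (by simp [halfArc_zero, hp])
      (Eventually.of_forall fun n => (le_add_of_nonneg_right (hnn _ n)).trans (h2 n))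
    have b4 := P.backEnd.inner_nonneg_of_bounded he P.pos P.tendsto
      (by simp [halfArc_zero, hq3, hq])
      (Eventually.of_forall fun n => (le_add_of_nonneg_left (hnn _ n)).trans (h2 n))
    rw [halfArc_zero, neg_one_smul, inner_neg_right, inner_single_one] at b3 b4
    rw [apply_three_pi_div_two P.mem₂.periodic] at b4
    exact ⟨by linarith, by linarith⟩
  have hA := P.mem₁.sinVariance_frontProfile hp hq'
  have hB := P.mem₁.sinVariance_backProfile hp hq'
  have hL := P.mem₁.two_mul_lagrangeFunctional
  have hS' : 0 ≤ -(α - 0) * (x₂ (Real.pi / 2) 0 + x₂ (-(Real.pi / 2)) 0) :=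
    mul_nonneg_of_nonpos_of_nonpos (by linarith) (by linarith [hS.1, hS.2])
  refine ⟨by linarith [hA 0, hA 1, hA 2, hB 0, hB 1, hB 2], fun hz => ?_⟩
  refine P.mem₁.mem_tangentialDirections hα.ne' (Or.inr rfl) hp hq' (fun i hi => ?_)
    (fun i => ?_) fun i => ?_
  · rw [hmean i hi, mul_zero, zero_mul, neg_zero]
  · fin_cases i <;> simp only [Fin.zero_eta, Fin.mk_one, Fin.reduceFinMk] <;>
      linarith [hA 0, hA 1, hA 2, hB 0, hB 1, hB 2]
  · fin_cases i <;> simp only [Fin.zero_eta, Fin.mk_one, Fin.reduceFinMk] <;>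
      linarith [hA 0, hA 1, hA 2, hB 0, hB 1, hB 2]

end PerturbedOrbits

/-! ### From sequences to the full expansion -/

theorem deriv_smul_eq (σ : ℝ) (x : ℝ → E3) : deriv (fun s => σ • x s) = fun s => σ • deriv x s :=
  funext fun _ => deriv_fun_const_smul_field σ x

theorem MemH1.const_smul {x : ℝ → E3} (H : MemH1 x) (σ : ℝ) : MemH1 fun s => σ • x s where
  periodic s := by simp only [H.periodic s]
  deriv_memLp := by
    rw [deriv_smul_eq]
    exact H.deriv_memLp.const_smul σ
  sub_eq_integral a b := by
    rw [deriv_smul_eq, intervalIntegral.integral_smul, ← H.sub_eq_integral, smul_sub]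

theorem lagrangeFunctional_smul (σ : ℝ) (x : ℝ → E3) :
    lagrangeFunctional (fun s => σ • x s) = σ ^ 2 * lagrangeFunctional x := by
  simp only [lagrangeFunctional, deriv_smul_eq, norm_smul, mul_pow, ← mul_sub,
    intervalIntegral.integral_const_mul, Real.norm_eq_abs, sq_abs]
  ring

/-- The second variation along a sequence of perturbations with vanishing first variation; `h0` says
that the first variation vanishes. -/
theorem PerturbedOrbits.second_variation {α β : ℝ} {μ : ℕ → ℝ} {X : ℕ → ℝ → E3} {x₁ x₂ : ℝ → E3}
    (P : PerturbedOrbits α β μ X x₁ x₂) (hα : 0 < α) (hβ : 0 ≤ β) (hβα : β ≤ α)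
    (h0 : (α - β) * (x₁ (Real.pi / 2) 0 + x₁ (-(Real.pi / 2)) 0) = 0) :
    0 ≤ -(α - β) * (x₂ (Real.pi / 2) 0 + x₂ (-(Real.pi / 2)) 0) + lagrangeFunctional x₁ ∧
      (-(α - β) * (x₂ (Real.pi / 2) 0 + x₂ (-(Real.pi / 2)) 0) + lagrangeFunctional x₁ = 0 →
        x₁ ∈ tangentialDirections (baseOrbit α β)) := by
  rcases hβα.eq_or_lt with rfl | hlt
  · simpa using P.second_variation_of_eq hα
  · have h1 := (mul_eq_zero.1 h0).resolve_left (sub_pos.2 hlt).ne'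
    rcases hβ.eq_or_lt with rfl | hβ0
    · exact P.second_variation_of_zero hα h1
    · exact P.second_variation_of_lt hβ0 hlt h1

/-- Restriction of a family of perturbations to a sequence of parameters. For negative parameters,
`σ = -1` reverses the sign of the first order perturbation. -/
theorem PerturbedOrbits.of_isLittleO {α β : ℝ} {M : Set ℝ} {X : ℝ → ℝ → E3} {x₁ x₂ : ℝ → E3}
    (hX : ∀ μ ∈ M, MemH1 (X μ)) (hx₁ : MemH1 x₁) (hx₂ : MemH1 x₂)
    (hexp : (fun μ : ℝ => h1Norm (fun s =>
        X μ s - (baseOrbit α β s + μ • x₁ s + μ ^ 2 • x₂ s)))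
      =o[𝓝[M] 0] (fun μ : ℝ => μ ^ 2))
    (hc₀ : (fun μ : ℝ => closingIntegral (X μ) 0) =o[𝓝[M] 0] (fun μ : ℝ => μ ^ 2))
    (hc : ∀ i : Fin 3, i ≠ 0 →
      (fun μ : ℝ => closingIntegral (X μ) i) =o[𝓝[M] 0] (fun μ : ℝ => μ))
    {ν : ℕ → ℝ} (hν : ∀ n, ν n ∈ M) (hν0 : Tendsto ν atTop (𝓝 0)) {σ : ℝ} (hσ : σ * σ = 1)
    (hpos : ∀ n, 0 < σ * ν n) :
    PerturbedOrbits α β (fun n => σ * ν n) (fun n => X (ν n)) (fun s => σ • x₁ s) x₂ := by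
  have hνM : Tendsto ν atTop (𝓝[M] 0) :=
    tendsto_nhdsWithin_iff.2 ⟨hν0, Eventually.of_forall hν⟩
  have hsq : ∀ n, (σ * ν n) ^ 2 = ν n ^ 2 := fun n => by
    rw [mul_pow, sq σ, hσ, one_mul]
  have hne : ∀ n, ν n ≠ 0 := fun n h => by simpa [h] using hpos n
  have hσ0 : σ ≠ 0 := fun h => by simp [h] at hσ
  refine ⟨hpos, by simpa using hν0.const_mul σ, fun n => hX _ (hν n), hx₁.const_smul σ, hx₂,
    ⟨fun n => 4 * (h1Norm (fun s => X (ν n) s - (baseOrbit α β s + ν n • x₁ s + ν n ^ 2 • x₂ s))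
      / ν n ^ 2), ?_, fun n s => ?_⟩, ?_, fun i hi => ?_⟩
  · simpa using (hexp.tendsto_div_nhds_zero.comp hνM).const_mul 4
  · have hper : Function.Periodic
        (fun s => X (ν n) s - (baseOrbit α β s + ν n • x₁ s + ν n ^ 2 • x₂ s))
        (2 * Real.pi) := fun s => by
      simp only [(hX _ (hν n)).periodic s, hx₁.periodic s, hx₂.periodic s, baseOrbit,
        collapsedOrbit, periodic_cosTwo α β s]
    have h1 := ((hasL2Density_baseOrbit α β).remainder hx₁.hasL2Density hx₂.hasL2Density
      (hX _ (hν n)).hasL2Density (ν n)).norm_le_h1Norm hper s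
    have h2 : (σ * ν n) • σ • x₁ s = ν n • x₁ s := by
      rw [smul_smul, mul_right_comm, hσ, one_mul]
    rw [hsq, h2, mul_assoc, div_mul_cancel₀ _ (pow_ne_zero 2 (hne n))]
    exact h1
  · simp only [hsq]
    exact hc₀.tendsto_div_nhds_zero.comp hνM
  · have h1 := ((hc i hi).tendsto_div_nhds_zero.comp hνM).const_mul σ
    rw [mul_zero] at h1
    refine h1.congr fun n => ?_
    have h2 := hne n
    simp only [Function.comp]
    rw [div_mul_eq_div_div_swap, mul_div_assoc']
    field_simp
    linear_combination (closingIntegral (X (ν n)) i) * hσ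

end OrbitVariation

theorem proposition3p2 (α β : ℝ) (hα : 0 < α) (hβ : 0 ≤ β) (hβα : β ≤ α)
    (M : Set ℝ) (hM0 : (0 : ℝ) ∉ M) (hM : (0 : ℝ) ∈ closure M)
    (X : ℝ → ℝ → E3) (x₁ x₂ : ℝ → E3)
    (hX : ∀ μ ∈ M, MemH1 (X μ)) (hx₁ : MemH1 x₁) (hx₂ : MemH1 x₂)
    (hne : ∀ μ ∈ M, ∀ᵐ s : ℝ, X μ s ≠ 0)
    (hexp : (fun μ : ℝ => h1Norm (fun s =>
        X μ s - (baseOrbit α β s + μ • x₁ s + μ ^ 2 • x₂ s)))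
      =o[𝓝[M] 0] (fun μ : ℝ => μ ^ 2))
    (hc₀ : (fun μ : ℝ => closingIntegral (X μ) 0) =o[𝓝[M] 0] (fun μ : ℝ => μ ^ 2))
    (hc₁ : (fun μ : ℝ => closingIntegral (X μ) 1) =o[𝓝[M] 0] (fun μ : ℝ => μ))
    (hc₂ : (fun μ : ℝ => closingIntegral (X μ) 2) =o[𝓝[M] 0] (fun μ : ℝ => μ)) :
    (∃ L₁ L₂ : ℝ, HasSecondOrderExpansion M (baseOrbit α β) X L₁ L₂) ∧
    ∀ L₁ L₂ : ℝ, HasSecondOrderExpansion M (baseOrbit α β) X L₁ L₂ → L₁ = 0 →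
      0 ≤ L₂ ∧ (x₁ ∉ tangentialDirections (baseOrbit α β) → 0 < L₂) := by
  have hE := hasSecondOrderExpansion hX (hasL2Density_baseOrbit α β) hx₁.hasL2Density
    hx₂.hasL2Density hexp
  refine ⟨⟨_, _, hE⟩, fun L₁ L₂ hL hL₁ => ?_⟩
  obtain ⟨h1, h2⟩ := hL.unique hM0 hM hE
  rw [bilinearForm_baseOrbit α β hx₁, hL₁] at h1
  rw [bilinearForm_baseOrbit α β hx₂] at h2
  have hc : ∀ i : Fin 3, i ≠ 0 →
      (fun μ : ℝ => closingIntegral (X μ) i) =o[𝓝[M] 0] (fun μ : ℝ => μ) := fun i hi => by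
    fin_cases i
    exacts [absurd rfl hi, hc₁, hc₂]
  have key : ∀ (σ : ℝ) (ν : ℕ → ℝ), σ * σ = 1 → (∀ n, ν n ∈ M) → Tendsto ν atTop (𝓝 0) →
      (∀ n, 0 < σ * ν n) → 0 ≤ L₂ ∧ (L₂ = 0 → x₁ ∈ tangentialDirections (baseOrbit α β)) := by
    intro σ ν hσ hν hν0 hpos
    have hP := (PerturbedOrbits.of_isLittleO hX hx₁ hx₂ hexp hc₀ hc hν hν0 hσ hpos).second_variation
      hα hβ hβα (by
        simp only [PiLp.smul_apply, smul_eq_mul]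
        linear_combination σ * h1)
    rw [lagrangeFunctional_smul, sq, hσ, one_mul, ← h2] at hP
    refine ⟨hP.1, fun h0 => ?_⟩
    have h3 := Submodule.smul_mem _ σ (hP.2 h0)
    have h4 : (σ • fun s => σ • x₁ s) = x₁ := funext fun s => by
      rw [Pi.smul_apply, smul_smul, hσ, one_smul]
    rwa [h4] at h3
  have hsplit : M = (M ∩ Ioi 0) ∪ (M ∩ Iio 0) := by
    ext μ
    constructor
    · intro hμ
      rcases lt_trichotomy μ 0 with h | h | h
      exacts [Or.inr ⟨hμ, h⟩, absurd (h ▸ hμ) hM0, Or.inl ⟨hμ, h⟩]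
    · rintro (h | h)
      exacts [h.1, h.1]
  have hconcl : 0 ≤ L₂ ∧ (L₂ = 0 → x₁ ∈ tangentialDirections (baseOrbit α β)) := by
    rw [hsplit, closure_union] at hM
    rcases hM with h | h
    · obtain ⟨ν, hν, hν0⟩ := mem_closure_iff_seq_limit.1 h
      exact key 1 ν (one_mul 1) (fun n => (hν n).1) hν0 fun n => by
        rw [one_mul]; exact (hν n).2
    · obtain ⟨ν, hν, hν0⟩ := mem_closure_iff_seq_limit.1 h
      exact key (-1) ν (by norm_num) (fun n => (hν n).1) hν0 fun n => by
        rw [neg_one_mul]; exact neg_pos.2 (hν n).2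
  exact ⟨hconcl.1, fun hx => lt_of_le_of_ne hconcl.1 fun h => hx (hconcl.2 h.symm)⟩
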